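/- **Setting.** Fix a viscosity $\nu>0$ and a conductivity $\sigma>0$. For $c>0$ and $T\in(0,\infty]$, consider on $[0,T)\times\mathbb{R}^3$ the incompressible Navier–Stokes–Maxwell system $$\begin{cases}\partial_t u+u\cdot\nabla u=\nu\Delta u-\nabla\pi+j\times B,& \operatorname{div}u=0,\\ \frac1c\partial_tE-\nabla\times B=-j,&\operatorname{div}E=0,\\ \frac1c\partial_tB+\nabla\times E=0,&\operatorname{div}B=0,\\ j=\sigma\big(cE+P(u\times B)\big),&\operatorname{div}j=0,\end{cases}$$ where $P=\mathrm{Id}-\nabla\Delta^{-1}\operatorname{div}$ is Leray's projector and $u,E,B,j$ take values in $\mathbb{R}^3$. A solution is called *smooth* on $[0,T)$ if $u,E,B\in C^\infty([0,T);H^\infty(\mathbb{R}^3))$, i.e. they are $C^\infty$ on $[0,T)\times\mathbb{R}^3$ and all their space-time derivatives are bounded in $L^2(\mathbb{R}^3)$ uniformly on each $[0,t]$, $t<T$. With cylindrical coordinates $(r,\theta,z)$ and the orthonormal frame $(e_r,e_\theta,e_z)$, a field $F$ is axisymmetric without swirl if $F=F_r(r,z)e_r+F_z(r,z)e_z$,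 and axisymmetric with pure swirl if $F=F_\theta(r,z)e_\theta$. Write $\|f\|_{\dot H^s}=\||D|^sf\|_{L^2(\mathbb{R}^3)}$, let $L^p_t$ denote $L^p$ in time over $[0,T)$, let the subscript $0$ denote the value at $t=0$, and put $\mathcal{E}_0=\|(u_0,E_0,B_0)\|_{L^2}$ and $\|u\|_{L^\infty_t\dot H^1\cap L^2_t\dot H^2}=\|u\|_{L^\infty_t\dot H^1}+\|u\|_{L^2_t\dot H^2}$. **Proposition 4.1.** There is a constant $C$, depending only on $\nu$ and $\sigma$, such that for all $c>0$, $T\in(0,\infty]$, all smooth solutions $(u,E,B)$ on $[0,T)$ for which $u$ and $E$ are axisymmetric without swirl and $B$ is axisymmetric with pure swirl, all $s\in[0,\frac12]$ and all $p\in[2,\infty]$, $$\Big\|\frac1c\partial_tE\Big\|_{L^p_t\dot H^s}=\|j-\nabla\times B\|_{L^p_t\dot H^s}\le C\Big(c^{-\frac2p}\|\nabla\times B_0-j_0\|_{\dot H^s}+c^{-\frac2p}\|E_0\|_{\dot H^{s+1}}+c^{-(\frac2p+1)}\mathcal{A}_s(u,E,B)\Big),$$ where $$\mathcal{A}_s(u,E,B)=\Big(\|u\|_{L^\infty_t\dot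 H^1\cap L^2_t\dot H^2}+\mathcal{E}_0\|B\|_{L^\infty_t\dot H^{3/2}}\Big)\Big(\|B\|_{L^\infty_t\dot H^{s+3/2}}+c\|E\|_{L^2_t\dot H^{s+3/2}}\Big)+\|u\|_{L^\infty_tL^2}^{\frac12-s}\|u\|_{L^\infty_t\dot H^1}^{s+\frac12}\|u\|_{L^2_t\dot H^2}\|B\|_{L^\infty_t\dot H^{3/2}}.$$ Norms may be infinite; the inequality is between elements of $[0,\infty]$, with the convention $0\cdot\infty=0$. -/

import Mathlib

open MeasureTheory Set FourierTransform
open scoped ENNReal NNReal ContDiff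

noncomputable section

namespace NSM

/-- Physical space `ℝ³` with its Euclidean norm. -/
abbrev V3 : Type := EuclideanSpace ℝ (Fin 3)

/-- Complexified `ℝ³`, where Fourier transforms of vector fields take their values. -/
abbrev C3 : Type := EuclideanSpace ℂ (Fin 3)

/-! ### Vector calculus on `ℝ³` -/

/-- The partial derivative `∂ᵢ F (x)` of a vector field. -/
def pd (i : Fin 3) (F : V3 → V3) (x : V3) : V3 :=
  fderiv ℝ F x (EuclideanSpace.single i 1)

/-- The divergence `div F`. -/
def divg (F : V3 → V3) (x : V3) : ℝ := ∑ i, pd i F x i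

/-- The curl `∇ × F`. -/
def curl (F : V3 → V3) (x : V3) : V3 :=
  !₂[pd 1 F x 2 - pd 2 F x 1, pd 2 F x 0 - pd 0 F x 2, pd 0 F x 1 - pd 1 F x 0]

/-- The vector product `a × b`. -/
def cross (a b : V3) : V3 :=
  !₂[a 1 * b 2 - a 2 * b 1, a 2 * b 0 - a 0 * b 2, a 0 * b 1 - a 1 * b 0]

/-- The convective derivative `(u · ∇) F`. -/
def convect (u F : V3 → V3) (x : V3) : V3 := fderiv ℝ F x (u x)

/-! ### The axisymmetric structure -/

/-- The distance `r` to the `z`-axis. -/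
def cylR (x : V3) : ℝ := Real.sqrt (x 0 ^ 2 + x 1 ^ 2)

/-- The radial unit vector `e_r` (off the axis). -/
def eR (x : V3) : V3 := !₂[x 0 / cylR x, x 1 / cylR x, 0]

/-- The angular unit vector `e_θ` (off the axis). -/
def eTheta (x : V3) : V3 := !₂[-(x 1) / cylR x, x 0 / cylR x, 0]

/-- The vertical unit vector `e_z`. -/
def eZ : V3 := !₂[0, 0, 1]

/-- `F` is axisymmetric without swirl: `F = F_r(r,z) e_r + F_z(r,z) e_z` off the axis. -/
def AxisymNoSwirl (F : V3 → V3) : Prop :=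
  ∃ Fr Fz : ℝ → ℝ → ℝ, ∀ x : V3, cylR x ≠ 0 →
    F x = Fr (cylR x) (x 2) • eR x + Fz (cylR x) (x 2) • eZ

/-- `F` is axisymmetric with pure swirl: `F = F_θ(r,z) e_θ` off the axis. -/
def AxisymPureSwirl (F : V3 → V3) : Prop :=
  ∃ Fθ : ℝ → ℝ → ℝ, ∀ x : V3, cylR x ≠ 0 → F x = Fθ (cylR x) (x 2) • eTheta x

/-! ### Fourier transform, homogeneous Sobolev norms and Leray projector -/

/-- A real vector field seen as a complex one. -/
def cplx (F : V3 → V3) (x : V3) : C3 := WithLp.toLp 2 fun i => ((F x i : ℝ) : ℂ)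

open Classical in
/-- The `L²` Fourier transform (with kernel `exp (-2πi x·ξ)`) of a square-integrable field;
the value for other fields is irrelevant. -/
def fourierL2 (F : V3 → V3) : V3 → C3 :=
  if h : MemLp (cplx F) 2 volume then
    ((𝓕 (h.toLp (cplx F)) : Lp C3 2 (volume : Measure V3)) : V3 → C3)
  else 0

open Classical in
/-- The homogeneous Sobolev norm `‖F‖_{Ḣˢ} = ‖ |D|ˢ F ‖_{L²} ∈ [0,∞]` of a square-integrable field.
The symbol of `|D|` is `2π|ξ|` because of the normalization of the Fourier transform.
It is only used for square-integrable fields, for which the Fourier transform is a function;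
it is set to `∞` otherwise. -/
def hsNorm (s : ℝ) (F : V3 → V3) : ℝ≥0∞ :=
  if MemLp F 2 volume then
    eLpNorm (fun ξ : V3 => ((2 * Real.pi * ‖ξ‖) ^ s : ℝ) • fourierL2 F ξ) 2 volume
  else ⊤

/-- `G = P F`, where `P = Id - ∇ Δ⁻¹ div` is Leray's projector on `L²`, the Fourier multiplier
`v ↦ v - (ξ·v) ξ / |ξ|²`. This determines `G` almost everywhere. -/
def IsLerayProj (F G : V3 → V3) : Prop :=
  MemLp F 2 volume ∧ MemLp G 2 volume ∧
    ∀ᵐ ξ : V3 ∂volume, ∀ i : Fin 3,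
      fourierL2 G ξ i = fourierL2 F ξ i -
        ((∑ k, ((ξ k : ℝ) : ℂ) * fourierL2 F ξ k) / ((‖ξ‖ ^ 2 : ℝ) : ℂ)) * ((ξ i : ℝ) : ℂ)

/-! ### Time-dependent fields -/

/-- The time interval `[0,T)`, `T ∈ (0,∞]`. -/
def timeI (T : ℝ≥0∞) : Set ℝ := {t | 0 ≤ t ∧ ENNReal.ofReal t < T}

/-- The time derivative on `[0,T)` (one-sided at `t = 0`). -/
def dt (T : ℝ≥0∞) (F : ℝ → V3 → V3) (t : ℝ) (x : V3) : V3 :=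
  derivWithin (fun τ => F τ x) (timeI T) t

/-- `F ∈ C^∞([0,T); H^∞(ℝ³))`: `F` is `C^∞` on `[0,T) × ℝ³` and all its space-time derivatives
are bounded in `L²(ℝ³)`, locally uniformly in time. -/
def SmoothField (T : ℝ≥0∞) (F : ℝ → V3 → V3) : Prop :=
  ContDiffOn ℝ ∞ (fun q : ℝ × V3 => F q.1 q.2) (timeI T ×ˢ univ) ∧
    ∀ n : ℕ, ∀ t ∈ timeI T, ∃ M : ℝ≥0, ∀ τ ∈ Icc 0 t,
      eLpNorm (fun x : V3 => ‖iteratedFDerivWithin ℝ n (fun q : ℝ × V3 => F q.1 q.2)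
        (timeI T ×ˢ univ) (τ, x)‖) 2 volume ≤ M

/-- The norm of `L^p([0,T); Ḣˢ)`. -/
def lpHs (T p : ℝ≥0∞) (s : ℝ) (F : ℝ → V3 → V3) : ℝ≥0∞ :=
  eLpNorm (fun t => hsNorm s (F t)) p (volume.restrict (timeI T))

/-- The norm of `L^p([0,T); L²)`. -/
def lpL2 (T p : ℝ≥0∞) (F : ℝ → V3 → V3) : ℝ≥0∞ :=
  eLpNorm (fun t => eLpNorm (F t) 2 volume) p (volume.restrict (timeI T))

/-! ### The Navier--Stokes--Maxwell system -/

/-- `(u,E,B)`, with current `j` and pressure `π`, is a smooth solution on `[0,T)` of the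
Navier--Stokes--Maxwell system with viscosity `ν`, conductivity `σ` and speed of light `c`. -/
structure IsSmoothSolution (ν σ c : ℝ) (T : ℝ≥0∞) (u E B j : ℝ → V3 → V3)
    (π : ℝ → V3 → ℝ) : Prop where
  smooth_u : SmoothField T u
  smooth_E : SmoothField T E
  smooth_B : SmoothField T B
  diff_pressure : ∀ t ∈ timeI T, Differentiable ℝ (π t)
  navierStokes : ∀ t ∈ timeI T, ∀ x,
    dt T u t x + convect (u t) (u t) x =
      ν • Laplacian.laplacian (u t) x - gradient (π t) x + cross (j t x) (B t x)
  ampere : ∀ t ∈ timeI T, ∀ x, c⁻¹ • dt T E t x - curl (B t) x = -(j t x)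
  faraday : ∀ t ∈ timeI T, ∀ x, c⁻¹ • dt T B t x + curl (E t) x = 0
  ohm : ∀ t ∈ timeI T, ∃ w : V3 → V3, IsLerayProj (fun x => cross (u t x) (B t x)) w ∧
    ∀ x, j t x = σ • (c • E t x + w x)
  div_u : ∀ t ∈ timeI T, ∀ x, divg (u t) x = 0
  div_E : ∀ t ∈ timeI T, ∀ x, divg (E t) x = 0
  div_B : ∀ t ∈ timeI T, ∀ x, divg (B t) x = 0
  div_j : ∀ t ∈ timeI T, ∀ x, divg (j t) x = 0

/-- The initial energy norm `𝓔₀ = ‖(u₀,E₀,B₀)‖_{L²}`. -/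
def energy0 (u₀ E₀ B₀ : V3 → V3) : ℝ≥0∞ :=
  (eLpNorm u₀ 2 volume ^ 2 + eLpNorm E₀ 2 volume ^ 2 + eLpNorm B₀ 2 volume ^ 2) ^ (1 / 2 : ℝ)

/-- The nonlinear quantity `𝒜_s(u,E,B)` on `[0,T)`. -/
def nonlinA (c : ℝ) (T : ℝ≥0∞) (s : ℝ) (u E B : ℝ → V3 → V3) : ℝ≥0∞ :=
  ((lpHs T ∞ 1 u + lpHs T 2 2 u) + energy0 (u 0) (E 0) (B 0) * lpHs T ∞ (3 / 2) B) *
      (lpHs T ∞ (s + 3 / 2) B + ENNReal.ofReal c * lpHs T 2 (s + 3 / 2) E) +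
    lpL2 T ∞ u ^ (1 / 2 - s) * lpHs T ∞ 1 u ^ (s + 1 / 2) * lpHs T 2 2 u * lpHs T ∞ (3 / 2) B

end NSM

end

noncomputable section

namespace NSM

open scoped SchwartzMap

/-! ### The `L²` Fourier transform of scalar functions -/

/-! Put φ = c⁻¹∂ₜE = curl B - j. Differentiating Ampère's law in time and inserting Faraday's law,
div E = 0 and Ohm's law gives the damped wave equation ∂ₜφ = cΔE - σc²φ - σ∂ₜP(u × B), with ∂ₜE = cφ
(`Sys.ft_dt_dt_E`). Its energy identity in Ḣˢ, with Young's inequality absorbing half of the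
damping, yields ‖φ(t)‖² + σc² ∫‖φ‖² ≤ ‖φ₀‖² + ‖E₀‖²_{Ḣ^{s+1}} + (σ/c²) ∫‖∂ₜP(u × B)‖²
(`damped_wave_energy`, `damped_wave_hs`). So φ is bounded in L^∞ in time, and in L² in time with a
gain c⁻¹; interpolation (`eLpNorm_time_le`) produces c^{-2/p}, and the source carries one further
factor c⁻¹. It remains to bound ∂ₜP(u × B) = P(∂ₜu × B) + P(u × ∂ₜB) in L²_t Ḣˢ.

The second term is harmless: ∂ₜB = -c curl E, and Ḣ¹ · Ḣ^{s+1/2} ⊂ Ḣˢ. The first is critical. The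
momentum equation gives ∂ₜu = νΔu - P(u·∇u) + P(j × B), where Δu is only in L², and L² · Ḣ^{s+3/2}
is not contained in Ḣˢ at the endpoint s = 0. Here the symmetry enters. If F is without swirl, B has
pure swirl and both are solenoidal, then F·B = 0 and B × curl F = 0, so that curl(F × B)_i = -∑_k
F_k (∂_k B_i + ∂_i B_k), with no derivative on F (`crl_crs_eq`). Since |P̂v| ≤ |2πξ|⁻¹ ∑_l |(curl
v)^_l|, the field P(F × B) behaves like |D|⁻¹(F ∇B) (`enorm_lerayFt_crs_le`), and L² · Ḣ^{s+1/2} ⊂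
Ḣ^{s-1} does hold. This is used for F = ∂ₜu and again for F = j, which inherits the absence of swirl
from Ampère's law (`Sys.noSwirl_j`). The norm of j in L²_t L² comes from the energy inequality
(`Sys.lintegral_j_le`); this is the origin of 𝓔₀ in the statement.

The product laws are proved on the Fourier side as weighted convolution inequalities for nonnegative
functions with values in [0,∞] (`exists_conv_bounds`). They follow from the boundedness on L² of
trilinear forms with kernel |x|⁻¹|y|^{-1/2} (`exists_kerBdd_base`) and its permutations, with a
constant independent of s ∈ [0,1/2].

Analytically, the components of all fields are placed in a class `SC` of smooth functions whose
space-time derivatives are all locally bounded in L²; it is closed under products and derivatives,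
and its members are differentiable in time with values in L². The pressure is eliminated by the
symmetry of its second derivatives (`IsSmoothSolution.sys`), so that nothing about its decay is
needed. -/

theorem memLp_ofReal {f : V3 → ℝ} {p : ℝ≥0∞} (hf : MemLp f p volume) :
    MemLp (fun x => (f x : ℂ)) p volume := hf.ofReal

/-- The class in `L²(ℝ³; ℂ)` of a real square-integrable function. -/
def toL2 (f : V3 → ℝ) : Lp ℂ 2 (volume : Measure V3) :=
  open Classical in
  if h : MemLp (fun x => (f x : ℂ)) 2 volume then h.toLp else 0

theorem toL2_of_memLp {f : V3 → ℝ} (hf : MemLp f 2 volume) :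
    toL2 f = (memLp_ofReal hf).toLp := dif_pos _

theorem coeFn_toL2 {f : V3 → ℝ} (hf : MemLp f 2 volume) :
    toL2 f =ᵐ[volume] fun x => (f x : ℂ) := by
  rw [toL2_of_memLp hf]; exact MemLp.coeFn_toLp _

/-- The Fourier transform of a real square-integrable function, as an element of `L²`. -/
def ftL (f : V3 → ℝ) : Lp ℂ 2 (volume : Measure V3) := 𝓕 (toL2 f)

/-- The Fourier transform of a real square-integrable function. -/
def ft (f : V3 → ℝ) : V3 → ℂ := ftL f

theorem memLp_ft (f : V3 → ℝ) : MemLp (ft f) 2 volume := Lp.memLp _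

theorem measurable_ft (f : V3 → ℝ) : Measurable (ft f) :=
  (Lp.stronglyMeasurable _).measurable

/-- The L² transform agrees with the distributional one. Paired with `ae_eq_ft`, this identifies a
transform by testing against Schwartz functions only. -/
theorem integral_schwartz_mul_ft {f : V3 → ℝ} (hf : MemLp f 2 volume) (φ : 𝓢(V3, ℂ)) :
    ∫ ξ, φ ξ * ft f ξ = ∫ x, 𝓕 φ x * (f x : ℂ) := by
  have h := congrArg (fun T => T φ) (Lp.fourier_toTemperedDistribution_eq (toL2 f))
  simp only [TemperedDistribution.fourier_apply, Lp.toTemperedDistribution_apply,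
    smul_eq_mul] at h
  rw [show ft f = (𝓕 (toL2 f) : Lp ℂ 2 (volume : Measure V3)) from rfl, ← h]
  refine integral_congr_ae ?_
  filter_upwards [coeFn_toL2 hf] with x hx
  rw [hx]

/-- Local integrability of the candidate suffices because compactly supported test functions already
separate; thus a polynomial symbol times a transform can be tested before it is known to lie in L².
-/
theorem ae_eq_ft {f : V3 → ℝ} (hf : MemLp f 2 volume) {g : V3 → ℂ}
    (hg : LocallyIntegrable g volume)
    (h : ∀ φ : 𝓢(V3, ℂ), ∫ ξ, φ ξ * g ξ = ∫ x, 𝓕 φ x * (f x : ℂ)) :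
    g =ᵐ[volume] ft f := by
  refine ae_eq_of_integral_contDiff_smul_eq hg
    ((memLp_ft f).locallyIntegrable (by norm_num)) fun φ hφ hc => ?_
  have h1 : HasCompactSupport (Complex.ofRealCLM ∘ φ) := hc.comp_left rfl
  have h2 : ContDiff ℝ ∞ (Complex.ofRealCLM ∘ φ) := by fun_prop
  have := (h (h1.toSchwartzMap h2)).trans (integral_schwartz_mul_ft hf _).symm
  simpa using this

theorem ae_eq_ft_of_memLp {f : V3 → ℝ} (hf : MemLp f 2 volume) {g : V3 → ℂ}
    (hg : MemLp g 2 volume)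
    (h : ∀ φ : 𝓢(V3, ℂ), ∫ ξ, φ ξ * g ξ = ∫ x, 𝓕 φ x * (f x : ℂ)) :
    g =ᵐ[volume] ft f :=
  ae_eq_ft hf (hg.locallyIntegrable (by norm_num)) h

theorem memLp_cplx {F : V3 → V3} (hF : MemLp F 2 volume) : MemLp (cplx F) 2 volume := by
  refine MemLp.of_le hF ?_ (Filter.Eventually.of_forall fun x => ?_)
  · have : Continuous fun v : V3 => (WithLp.toLp 2 fun i => ((v i : ℝ) : ℂ) : C3) := by
      fun_prop
    exact this.comp_aestronglyMeasurable hF.1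
  · simp [cplx, EuclideanSpace.norm_eq]

theorem memLp_comp_apply {F : V3 → V3} {p : ℝ≥0∞} (hF : MemLp F p volume) (i : Fin 3) :
    MemLp (fun x => F x i) p volume :=
  (EuclideanSpace.proj i : V3 →L[ℝ] ℝ).comp_memLp' hF

/-- The vector-valued transform acts componentwise, so the whole argument can be run on scalar
functions. -/
theorem fourierL2_apply_ae {F : V3 → V3} (hF : MemLp F 2 volume) (i : Fin 3) :
    (fun ξ => fourierL2 F ξ i) =ᵐ[volume] ft fun x => F x i := by
  have hc := memLp_cplx hF
  have hL : fourierL2 F = ((𝓕 (hc.toLp (cplx F)) : Lp C3 2 (volume : Measure V3)) : V3 → C3) :=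
    dif_pos hc
  have hm : MemLp (fourierL2 F) 2 volume := by rw [hL]; exact Lp.memLp _
  refine ae_eq_ft_of_memLp (memLp_comp_apply hF i)
    ((EuclideanSpace.proj i : C3 →L[ℂ] ℂ).comp_memLp' hm) fun φ => ?_
  have h := congrArg (fun T => T φ) (Lp.fourier_toTemperedDistribution_eq (hc.toLp (cplx F)))
  simp only [TemperedDistribution.fourier_apply, Lp.toTemperedDistribution_apply] at h
  rw [← hL] at h
  have key : ∀ (ψ : 𝓢(V3, ℂ)) {G : V3 → C3} (_ : MemLp G 2 volume),
      (∫ x, ψ x • G x) i = ∫ x, ψ x * G x i := by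
    intro ψ G hG
    have hi : Integrable (fun x => ψ x • G x) volume :=
      memLp_one_iff_integrable.1 (hG.smul (ψ.memLp 2 volume))
    exact ((EuclideanSpace.proj i : C3 →L[ℂ] ℂ).integral_comp_comm hi).symm
  have h3 := congrArg (fun v : C3 => v i) h
  simp only [] at h3
  rw [key φ hm, key _ (Lp.memLp _)] at h3
  rw [← h3]
  refine integral_congr_ae ?_
  filter_upwards [hc.coeFn_toLp] with x hx
  rw [hx]; rfl

theorem toL2_add {f g : V3 → ℝ} (hf : MemLp f 2 volume) (hg : MemLp g 2 volume) :
    toL2 (fun x => f x + g x) = toL2 f + toL2 g := by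
  have : MemLp (fun x => f x + g x) 2 volume := hf.add hg
  rw [toL2_of_memLp this, toL2_of_memLp hf, toL2_of_memLp hg, ← MemLp.toLp_add]
  refine (MemLp.toLp_eq_toLp_iff _ _).2 (Filter.Eventually.of_forall fun x => ?_)
  simp

theorem toL2_const_mul {f : V3 → ℝ} (hf : MemLp f 2 volume) (a : ℝ) :
    toL2 (fun x => a * f x) = (a : ℂ) • toL2 f := by
  have : MemLp (fun x => a * f x) 2 volume := hf.const_mul a
  rw [toL2_of_memLp this, toL2_of_memLp hf, ← MemLp.toLp_const_smul]
  refine (MemLp.toLp_eq_toLp_iff _ _).2 (Filter.Eventually.of_forall fun x => ?_)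
  simp

theorem toL2_sub {f g : V3 → ℝ} (hf : MemLp f 2 volume) (hg : MemLp g 2 volume) :
    toL2 (fun x => f x - g x) = toL2 f - toL2 g := by
  have : MemLp (fun x => f x - g x) 2 volume := hf.sub hg
  rw [toL2_of_memLp this, toL2_of_memLp hf, toL2_of_memLp hg, ← MemLp.toLp_sub]
  refine (MemLp.toLp_eq_toLp_iff _ _).2 (Filter.Eventually.of_forall fun x => ?_)
  simp

theorem norm_toL2 {f : V3 → ℝ} (hf : MemLp f 2 volume) :
    ‖toL2 f‖ₑ = eLpNorm f 2 volume := by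
  rw [toL2_of_memLp hf, Lp.enorm_toLp]
  exact eLpNorm_congr_norm_ae (Filter.Eventually.of_forall fun x => by simp)

theorem ftL_add {f g : V3 → ℝ} (hf : MemLp f 2 volume) (hg : MemLp g 2 volume) :
    ftL (fun x => f x + g x) = ftL f + ftL g := by
  rw [ftL, toL2_add hf hg]; exact FourierTransform.fourier_add _ _

theorem ftL_sub {f g : V3 → ℝ} (hf : MemLp f 2 volume) (hg : MemLp g 2 volume) :
    ftL (fun x => f x - g x) = ftL f - ftL g := by
  rw [ftL, toL2_sub hf hg]; exact (Lp.fourierTransformₗᵢ V3 ℂ).map_sub _ _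

theorem ftL_const_mul {f : V3 → ℝ} (hf : MemLp f 2 volume) (a : ℝ) :
    ftL (fun x => a * f x) = (a : ℂ) • ftL f := by
  rw [ftL, toL2_const_mul hf]; exact FourierTransform.fourier_smul _ _

theorem ft_add {f g : V3 → ℝ} (hf : MemLp f 2 volume) (hg : MemLp g 2 volume) :
    ft (fun x => f x + g x) =ᵐ[volume] fun ξ => ft f ξ + ft g ξ := by
  rw [ft, ftL_add hf hg]; exact Lp.coeFn_add _ _

theorem ft_sub {f g : V3 → ℝ} (hf : MemLp f 2 volume) (hg : MemLp g 2 volume) :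
    ft (fun x => f x - g x) =ᵐ[volume] fun ξ => ft f ξ - ft g ξ := by
  rw [ft, ftL_sub hf hg]; exact Lp.coeFn_sub _ _

theorem ft_const_mul {f : V3 → ℝ} (hf : MemLp f 2 volume) (a : ℝ) :
    ft (fun x => a * f x) =ᵐ[volume] fun ξ => (a : ℂ) * ft f ξ := by
  rw [ft, ftL_const_mul hf]; exact Lp.coeFn_smul _ _

theorem ft_neg {f : V3 → ℝ} (hf : MemLp f 2 volume) :
    ft (fun x => - f x) =ᵐ[volume] fun ξ => - ft f ξ := by
  have := ft_const_mul hf (-1)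
  simpa using this

theorem ft_sum {ι : Type*} (s : Finset ι) {f : ι → V3 → ℝ}
    (hf : ∀ i ∈ s, MemLp (f i) 2 volume) :
    ft (fun x => ∑ i ∈ s, f i x) =ᵐ[volume] fun ξ => ∑ i ∈ s, ft (f i) ξ := by
  classical
  induction s using Finset.induction_on with
  | empty =>
    have h0 : toL2 (fun _ => (0 : ℝ)) = 0 := by
      have := toL2_const_mul (f := fun _ => (0 : ℝ)) (MemLp.zero) 0
      simpa using this
    have : ftL (fun _ => (0 : ℝ)) = 0 := by
      rw [ftL, h0]; exact (Lp.fourierTransformₗᵢ V3 ℂ).map_zero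
    simp only [Finset.sum_empty]
    rw [ft, this]
    exact Lp.coeFn_zero _ _ _
  | insert a s ha ih =>
    have h1 := ih fun i hi => hf i (Finset.mem_insert_of_mem hi)
    have h2 : MemLp (fun x => ∑ i ∈ s, f i x) 2 volume :=
      memLp_finsetSum s fun i hi => hf i (Finset.mem_insert_of_mem hi)
    simp only [Finset.sum_insert ha]
    filter_upwards [ft_add (hf a (Finset.mem_insert_self _ _)) h2, h1] with ξ e1 e2
    rw [e1, e2]

theorem enorm_ftL {f : V3 → ℝ} (hf : MemLp f 2 volume) : ‖ftL f‖ₑ = eLpNorm f 2 volume := by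
  rw [← norm_toL2 hf, ftL, ← ofReal_norm, Lp.norm_fourier_eq, ofReal_norm]

theorem eLpNorm_ft {f : V3 → ℝ} (hf : MemLp f 2 volume) :
    eLpNorm (ft f) 2 volume = eLpNorm f 2 volume := by
  rw [← enorm_ftL hf, Lp.enorm_def]; rfl

theorem integral_mul_eq_re_inner {f g : V3 → ℝ} (hf : MemLp f 2 volume)
    (hg : MemLp g 2 volume) :
    ((∫ x, f x * g x : ℝ) : ℂ) = ∫ ξ, ft f ξ * (starRingEnd ℂ) (ft g ξ) := by
  have h : inner ℂ (ftL g) (ftL f) = inner ℂ (toL2 g) (toL2 f) := Lp.inner_fourier_eq _ _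
  rw [L2.inner_def, L2.inner_def] at h
  simp only [RCLike.inner_apply] at h
  refine Eq.trans ?_ h.symm
  rw [← integral_complex_ofReal]
  refine integral_congr_ae ?_
  filter_upwards [coeFn_toL2 hf, coeFn_toL2 hg] with x h1 h2
  rw [h1, h2]; simp

/-! ### Fourier transform of derivatives -/

/-- Tested against φ, the symbol moves onto φ, becomes a derivative of 𝓕 φ, and integration by parts
returns it to f. Only f and this one derivative need to be in L². -/
theorem ft_deriv {f : V3 → ℝ} (hd : Differentiable ℝ f) (hf : MemLp f 2 volume) {v : V3}
    (hv : MemLp (fun x => fderiv ℝ f x v) 2 volume) :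
    ft (fun x => fderiv ℝ f x v) =ᵐ[volume]
      fun ξ => (2 * Real.pi * Complex.I * (inner ℝ ξ v : ℝ)) * ft f ξ := by
  refine (ae_eq_ft hv ?_ fun φ => ?_).symm
  · have hc : Continuous fun ξ : V3 => (2 * Real.pi * Complex.I * (inner ℝ ξ v : ℝ) : ℂ) := by
      fun_prop
    exact ((memLp_ft f).locallyIntegrable (by norm_num)).continuous_mul hc
  · have ht : (inner ℝ · v : V3 → ℝ).HasTemperateGrowth :=
      ((innerSL ℝ).flip v).hasTemperateGrowth
    set ψ : 𝓢(V3, ℂ) := (2 * Real.pi * Complex.I : ℂ) •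
      SchwartzMap.smulLeftCLM ℂ (inner ℝ · v) φ with hψ
    have e1 : ∫ ξ, φ ξ * ((2 * Real.pi * Complex.I * (inner ℝ ξ v : ℝ)) * ft f ξ) =
        ∫ ξ, ψ ξ * ft f ξ := by
      refine integral_congr_ae (Filter.Eventually.of_forall fun ξ => ?_)
      simp only [hψ, smul_apply, SchwartzMap.smulLeftCLM_apply_apply ht, smul_eq_mul,
        Complex.real_smul]
      ring
    have e2 : ∀ x, (𝓕 ψ : 𝓢(V3, ℂ)) x = - fderiv ℝ (𝓕 φ : 𝓢(V3, ℂ)) x v := by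
      intro x
      have h := congrArg (fun g : 𝓢(V3, ℂ) => g x) (SchwartzMap.lineDerivOp_fourier_eq φ v)
      have h1 : (LineDeriv.lineDerivOp v (𝓕 φ : 𝓢(V3, ℂ)) : 𝓢(V3, ℂ)) x =
          fderiv ℝ (𝓕 φ : 𝓢(V3, ℂ)) x v :=
        SchwartzMap.lineDerivOp_apply_eq_fderiv _ _ _
      rw [h1] at h
      rw [h, neg_smul, ← hψ]
      have : (𝓕 (-ψ) : 𝓢(V3, ℂ)) = - 𝓕 ψ := (FourierTransform.fourierCLM ℂ 𝓢(V3, ℂ)).map_neg ψ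
      rw [this, neg_apply, neg_neg]
    rw [e1, integral_schwartz_mul_ft hf]
    have hfd : ∀ x, fderiv ℝ (fun x => (f x : ℂ)) x v = ((fderiv ℝ f x v : ℝ) : ℂ) := by
      intro x
      have : HasFDerivAt (fun x => (f x : ℂ)) (Complex.ofRealCLM.comp (fderiv ℝ f x)) x :=
        Complex.ofRealCLM.hasFDerivAt.comp x (hd x).hasFDerivAt
      rw [this.fderiv]; simp
    have hI : ∀ (φ : 𝓢(V3, ℂ)) {g : V3 → ℝ}, MemLp g 2 volume →
        Integrable (fun x => φ x * (g x : ℂ)) volume := fun φ g hg =>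
      (φ.memLp 2 volume).integrable_mul (memLp_ofReal hg)
    have := integral_mul_fderiv_eq_neg_fderiv_mul_of_integrable (μ := (volume : Measure V3))
      (f := (𝓕 φ : 𝓢(V3, ℂ))) (g := fun x => (f x : ℂ)) (v := v) ?_ ?_ ?_ ?_ ?_
    · simp only [hfd] at this
      rw [this, ← integral_neg]
      refine integral_congr_ae (Filter.Eventually.of_forall fun x => ?_)
      simp only [e2]; ring
    · have := (hI (𝓕 ψ) hf).neg
      refine this.congr (Filter.Eventually.of_forall fun x => ?_)
      simp [e2]
    · simp only [hfd]; exact hI _ hv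
    · exact hI _ hf
    · exact fun x _ => (𝓕 φ : 𝓢(V3, ℂ)).differentiableAt
    · exact fun x _ => (Complex.ofRealCLM.hasFDerivAt.comp x (hd x).hasFDerivAt).differentiableAt

end NSM
end


noncomputable section

namespace NSM

open scoped SchwartzMap

/-! ### Products and Fourier convolutions -/

/-- Read off from the Schwartz convolution of the inverse transforms, evaluated at -ξ. -/
theorem fourier_mul_schwartz (φ ψ : 𝓢(V3, ℂ)) (ξ : V3) :
    𝓕 (fun x => φ x * ψ x) ξ = ∫ η, 𝓕 φ (ξ - η) * 𝓕 ψ η := by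
  have h := SchwartzMap.convolution_apply (ContinuousLinearMap.mul ℂ ℂ) (𝓕⁻ φ) (𝓕⁻ ψ) (-ξ)
  have h1 : SchwartzMap.convolution (ContinuousLinearMap.mul ℂ ℂ) (𝓕⁻ φ) (𝓕⁻ ψ) =
      𝓕⁻ (SchwartzMap.pairing (ContinuousLinearMap.mul ℂ ℂ) φ ψ) := by
    simp [SchwartzMap.convolution]
  have hinv : ∀ (g : V3 → ℂ) (x : V3), 𝓕⁻ g x = 𝓕 g (-x) := fun g x => by
    rw [Real.fourierInv_eq_fourier_neg]
  have e : (𝓕⁻ (SchwartzMap.pairing (ContinuousLinearMap.mul ℂ ℂ) φ ψ) : 𝓢(V3, ℂ)) (-ξ) =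
      𝓕 (fun x => φ x * ψ x) ξ := by
    rw [SchwartzMap.fourierInv_coe, hinv, neg_neg]
    rfl
  rw [h1, e] at h
  rw [h, convolution_def]
  rw [← integral_neg_eq_self]
  have e3 : ∀ η : V3, ((ContinuousLinearMap.mul ℂ ℂ) ((𝓕⁻ φ : 𝓢(V3, ℂ)) (-η)))
      ((𝓕⁻ ψ : 𝓢(V3, ℂ)) (-ξ - -η)) = 𝓕 φ η * 𝓕 ψ (ξ - η) := by
    intro η
    rw [SchwartzMap.fourierInv_coe, SchwartzMap.fourierInv_coe, hinv, hinv, SchwartzMap.fourier_coe,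
      SchwartzMap.fourier_coe]
    simp only [ContinuousLinearMap.mul_apply', neg_neg]
    congr 2; simp [sub_eq_add_neg, add_comm]
  simp only [e3]
  rw [← integral_sub_left_eq_self _ _ ξ]
  simp

/-- The modulation `e^{-2πi x·ξ}` as an element of `L^∞`. -/
theorem memLp_modulation (ξ : V3) :
    MemLp (fun x : V3 => ((Real.fourierChar (-(inner ℝ x ξ : ℝ)) : Circle) : ℂ)) ⊤ volume := by
  refine memLp_top_of_bound ?_ 1 (Filter.Eventually.of_forall fun x => (Circle.norm_coe _).le)
  have : Continuous fun x : V3 => ((Real.fourierChar (-(inner ℝ x ξ : ℝ)) : Circle) : ℂ) := by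
    have := Real.continuous_fourierChar
    fun_prop
  exact this.aestronglyMeasurable

theorem measurePreserving_sub_left' (ξ : V3) :
    MeasurePreserving (fun η : V3 => ξ - η) volume volume :=
  Measure.measurePreserving_sub_left volume ξ

/-- For fixed ξ both sides are continuous bilinear forms on L² × L², and they agree on Schwartz
functions, which are dense. Hence the identity holds at every ξ, without any assumption on the
product beyond integrability. -/
theorem integral_modulation_mul (a b : Lp ℂ 2 (volume : Measure V3)) (ξ : V3) :
    ∫ x, ((Real.fourierChar (-(inner ℝ x ξ : ℝ)) : Circle) : ℂ) * a x * b x =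
      ∫ η, (𝓕 a : Lp ℂ 2 (volume : Measure V3)) (ξ - η) *
        (𝓕 b : Lp ℂ 2 (volume : Measure V3)) η := by
  set e : Lp ℂ ⊤ (volume : Measure V3) := (memLp_modulation ξ).toLp with he
  set mulC := ContinuousLinearMap.mul ℂ ℂ
  set A : Lp ℂ 2 (volume : Measure V3) →L[ℂ] Lp ℂ 2 (volume : Measure V3) →L[ℂ] ℂ :=
    (mulC.lpPairing volume 2 2) ∘L (mulC.holderL volume ⊤ 2 2 e) with hA
  set R : Lp ℂ 2 (volume : Measure V3) →L[ℂ] Lp ℂ 2 (volume : Measure V3) :=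
    (Lp.compMeasurePreservingₗᵢ ℂ (fun η : V3 => ξ - η)
      (measurePreserving_sub_left' ξ)).toContinuousLinearMap with hR
  set FF : Lp ℂ 2 (volume : Measure V3) →L[ℂ] Lp ℂ 2 (volume : Measure V3) :=
    FourierTransform.fourierCLM ℂ (Lp ℂ 2 (volume : Measure V3))
  have hAe : ∀ a b : Lp ℂ 2 (volume : Measure V3), A a b =
      ∫ x, ((Real.fourierChar (-(inner ℝ x ξ : ℝ)) : Circle) : ℂ) * a x * b x := by
    intro a b
    rw [hA, ContinuousLinearMap.comp_apply, ContinuousLinearMap.lpPairing_eq_integral]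
    refine integral_congr_ae ?_
    have h1 : (mulC.holderL volume ⊤ 2 2 e a : V3 → ℂ) =ᵐ[volume] fun x => mulC (e x) (a x) :=
      mulC.coeFn_holder (r := 2) e a
    filter_upwards [h1, (memLp_modulation ξ).coeFn_toLp] with x h1 h2
    rw [h1, he, h2]; rfl
  have hBe : ∀ a b : Lp ℂ 2 (volume : Measure V3), (mulC.lpPairing volume 2 2) (R (FF a)) (FF b) =
      ∫ η, (𝓕 a : Lp ℂ 2 (volume : Measure V3)) (ξ - η) *
        (𝓕 b : Lp ℂ 2 (volume : Measure V3)) η := by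
    intro a b
    rw [ContinuousLinearMap.lpPairing_eq_integral]
    refine integral_congr_ae ?_
    have h1 : (R (FF a) : V3 → ℂ) =ᵐ[volume] (𝓕 a : Lp ℂ 2 (volume : Measure V3)) ∘ (ξ - ·) :=
      Lp.coeFn_compMeasurePreserving _ (measurePreserving_sub_left' ξ)
    filter_upwards [h1] with x h1
    rw [h1]; rfl
  rw [← hAe, ← hBe]
  have hd := SchwartzMap.denseRange_toLpCLM (E := V3) (F := ℂ) (μ := volume) (p := 2)
    ENNReal.ofNat_ne_top
  refine DenseRange.induction_on (p := fun a => A a b = mulC.lpPairing volume 2 2 (R (FF a)) (FF b))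
    hd a ?_ fun φ => ?_
  · refine isClosed_eq ?_ ?_
    · exact (A.flip b).continuous
    · exact (((mulC.lpPairing volume 2 2).flip (FF b)) ∘L R ∘L FF).continuous
  refine DenseRange.induction_on
    (p := fun b => A (SchwartzMap.toLpCLM ℂ ℂ 2 volume φ) b =
      mulC.lpPairing volume 2 2 (R (FF (SchwartzMap.toLpCLM ℂ ℂ 2 volume φ))) (FF b))
    hd b ?_ fun ψ => ?_
  · refine isClosed_eq ?_ ?_
    · exact (A _).continuous
    · exact ((mulC.lpPairing volume 2 2 (R (FF _))) ∘L FF).continuous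
  rw [hAe, hBe]
  have h := fourier_mul_schwartz φ ψ ξ
  rw [Real.fourier_eq] at h
  simp only [SchwartzMap.toLpCLM_apply, SchwartzMap.toLp_fourier_eq]
  refine Eq.trans (integral_congr_ae ?_) (h.trans (integral_congr_ae ?_))
  · filter_upwards [φ.coeFn_toLp 2 volume, ψ.coeFn_toLp 2 volume] with x h1 h2
    rw [h1, h2, mul_assoc]; rfl
  · have h1 := (measurePreserving_sub_left' ξ).quasiMeasurePreserving.ae
      ((𝓕 φ).coeFn_toLp 2 volume)
    filter_upwards [h1, (𝓕 ψ).coeFn_toLp 2 volume] with x h1 h2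
    rw [h1, h2]

theorem fourier_mul_eq {f g : V3 → ℝ} (hf : MemLp f 2 volume) (hg : MemLp g 2 volume) (ξ : V3) :
    𝓕 (fun x => ((f x * g x : ℝ) : ℂ)) ξ = ∫ η, ft f (ξ - η) * ft g η := by
  have h := integral_modulation_mul (toL2 f) (toL2 g) ξ
  rw [Real.fourier_eq]
  refine Eq.trans (integral_congr_ae ?_) h
  filter_upwards [coeFn_toL2 hf, coeFn_toL2 hg] with x h1 h2
  rw [h1, h2, Circle.smul_def]
  push_cast
  simp only [smul_eq_mul]; ring

theorem ft_eq_fourier {f : V3 → ℝ} (hf : MemLp f 2 volume) (h1 : Integrable f volume) :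
    ft f =ᵐ[volume] 𝓕 fun x => (f x : ℂ) := by
  have hi : Integrable (fun x => (f x : ℂ)) volume := h1.ofReal
  have hc : Continuous (𝓕 fun x => (f x : ℂ)) :=
    VectorFourier.fourierIntegral_continuous Real.continuous_fourierChar
      (by exact continuous_inner) hi
  refine (ae_eq_ft hf hc.locallyIntegrable fun φ => ?_).symm
  have := VectorFourier.integral_fourierIntegral_smul_eq_flip (L := innerₗ V3) (μ := volume)
    (ν := volume) Real.continuous_fourierChar continuous_inner φ.integrable hi
  simp only [smul_eq_mul, flip_innerₗ] at this
  exact this.symm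

theorem ft_mul {f g : V3 → ℝ} (hf : MemLp f 2 volume) (hg : MemLp g 2 volume)
    (hfg : MemLp (fun x => f x * g x) 2 volume) :
    ft (fun x => f x * g x) =ᵐ[volume] fun ξ => ∫ η, ft f (ξ - η) * ft g η := by
  filter_upwards [ft_eq_fourier hfg (hf.integrable_mul hg)] with ξ h
  rw [h, fourier_mul_eq hf hg]

theorem enorm_ft_mul_le {f g : V3 → ℝ} (hf : MemLp f 2 volume) (hg : MemLp g 2 volume)
    (hfg : MemLp (fun x => f x * g x) 2 volume) :
    ∀ᵐ ξ, ‖ft (fun x => f x * g x) ξ‖ₑ ≤ ∫⁻ η, ‖ft f (ξ - η)‖ₑ * ‖ft g η‖ₑ := by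
  filter_upwards [ft_mul hf hg hfg] with ξ h
  rw [h]
  exact (enorm_integral_le_lintegral_enorm _).trans_eq (by simp only [enorm_mul])

/-! ### The supremum bound -/

/-- If the transform is integrable this is Fourier inversion; otherwise the right-hand side is
infinite. The inversion formula is obtained weakly, by testing against 𝓕⁻ of a smooth compactly
supported function. -/
theorem ae_enorm_le_lintegral_ft {f : V3 → ℝ} (hf : MemLp f 2 volume) :
    ∀ᵐ x, ‖f x‖ₑ ≤ ∫⁻ ξ, ‖ft f ξ‖ₑ := by
  by_cases hi : Integrable (ft f) volume
  swap
  · have : ∫⁻ ξ, ‖ft f ξ‖ₑ = ⊤ := by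
      by_contra h
      exact hi ⟨(measurable_ft f).aestronglyMeasurable, lt_top_iff_ne_top.2 h⟩
    simp [this]
  have hc : Continuous (𝓕⁻ (ft f)) := by
    have : 𝓕⁻ (ft f) = fun x => 𝓕 (ft f) (-x) := by
      ext x; rw [Real.fourierInv_eq_fourier_neg]
    rw [this]
    have h1 : Continuous (𝓕 (ft f)) := VectorFourier.fourierIntegral_continuous
      Real.continuous_fourierChar (by exact continuous_inner) hi
    exact h1.comp continuous_neg
  have key : 𝓕⁻ (ft f) =ᵐ[volume] fun x => (f x : ℂ) := by
    refine ae_eq_of_integral_contDiff_smul_eq hc.locallyIntegrable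
      ((memLp_ofReal hf).locallyIntegrable (by norm_num)) fun φ hφ hcs => ?_
    have h1 : HasCompactSupport (Complex.ofRealCLM ∘ φ) := hcs.comp_left rfl
    have h2 : ContDiff ℝ ∞ (Complex.ofRealCLM ∘ φ) := by fun_prop
    set Φ : 𝓢(V3, ℂ) := h1.toSchwartzMap h2 with hΦ
    have h3 := integral_schwartz_mul_ft hf (𝓕⁻ Φ)
    rw [FourierTransform.fourier_fourierInv_eq] at h3
    have h4 := VectorFourier.integral_fourierIntegral_smul_eq_flip (L := innerₗ V3) (μ := volume)
      (ν := volume) Real.continuous_fourierChar continuous_inner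
      (f := fun x => Φ (-x)) (g := ft f) (Φ.integrable.comp_neg) hi
    simp only [smul_eq_mul, flip_innerₗ] at h4
    have h5 : ∀ ξ, (𝓕⁻ Φ) ξ = VectorFourier.fourierIntegral Real.fourierChar volume (innerₗ V3)
        (fun x => Φ (-x)) ξ := by
      intro ξ
      rw [SchwartzMap.fourierInv_coe, Real.fourierInv_eq_fourier_comp_neg]; rfl
    have h6 : ∫ x, Φ x * 𝓕⁻ (ft f) x = ∫ x, Φ (-x) * 𝓕 (ft f) x := by
      rw [← integral_neg_eq_self]
      refine integral_congr_ae (Filter.Eventually.of_forall fun x => ?_)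
      simp only []
      rw [Real.fourierInv_eq_fourier_neg, neg_neg]
    have h7 : ∫ x, Φ x * 𝓕⁻ (ft f) x = ∫ x, Φ x * (f x : ℂ) := by
      rw [h6, ← h3]
      refine h4.symm.trans (integral_congr_ae (Filter.Eventually.of_forall fun x => ?_))
      simp only [h5]
    simpa [hΦ] using h7
  filter_upwards [key] with x hx
  have : ‖f x‖ₑ = ‖(f x : ℂ)‖ₑ := by simp [← ofReal_norm]
  rw [this, ← hx, Real.fourierInv_eq]
  exact (enorm_integral_le_lintegral_enorm _).trans_eq (by simp [← ofReal_norm])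

end NSM
end


noncomputable section

namespace NSM

/-! ### Weighted norms of nonnegative functions and convolution inequalities -/

/-- The `L²` norm of a nonnegative function. -/
def N2 (f : V3 → ℝ≥0∞) : ℝ≥0∞ := (∫⁻ ξ, f ξ ^ 2) ^ (1 / 2 : ℝ)

/-- The symbol of `|D|^s`. -/
def wt (s : ℝ) (ξ : V3) : ℝ≥0∞ := ENNReal.ofReal (2 * Real.pi * ‖ξ‖) ^ s

/-- The convolution of nonnegative functions. -/
def conv (f g : V3 → ℝ≥0∞) (ξ : V3) : ℝ≥0∞ := ∫⁻ η, f (ξ - η) * g η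

theorem N2_sq (f : V3 → ℝ≥0∞) : N2 f ^ 2 = ∫⁻ ξ, f ξ ^ 2 := by
  rw [N2, ← ENNReal.rpow_natCast, ← ENNReal.rpow_mul]; norm_num

theorem N2_mono_ae {f g : V3 → ℝ≥0∞} (h : ∀ᵐ ξ, f ξ ≤ g ξ) : N2 f ≤ N2 g := by
  refine ENNReal.rpow_le_rpow (lintegral_mono_ae ?_) (by norm_num)
  filter_upwards [h] with ξ hξ using pow_le_pow_left' hξ 2

theorem N2_congr_ae {f g : V3 → ℝ≥0∞} (h : f =ᵐ[volume] g) : N2 f = N2 g :=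
  le_antisymm (N2_mono_ae (h.mono fun _ e => e.le)) (N2_mono_ae (h.mono fun _ e => e.ge))

theorem N2_const_mul {f : V3 → ℝ≥0∞} (hf : Measurable f) (a : ℝ≥0∞) :
    N2 (fun ξ => a * f ξ) = a * N2 f := by
  simp only [N2, mul_pow]
  rw [lintegral_const_mul _ (hf.pow_const 2), ENNReal.mul_rpow_of_nonneg _ _ (by norm_num)]
  congr 1
  rw [← ENNReal.rpow_natCast, ← ENNReal.rpow_mul]; norm_num

theorem N2_add_le {f g : V3 → ℝ≥0∞} (hf : Measurable f) (hg : Measurable g) :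
    N2 (fun ξ => f ξ + g ξ) ≤ N2 f + N2 g := by
  have := ENNReal.lintegral_Lp_add_le (μ := (volume : Measure V3)) hf.aemeasurable hg.aemeasurable
    (p := 2) (by norm_num)
  simpa [N2] using this

theorem N2_sum_le {ι : Type*} (t : Finset ι) {f : ι → V3 → ℝ≥0∞} (hf : ∀ i, Measurable (f i)) :
    N2 (fun ξ => ∑ i ∈ t, f i ξ) ≤ ∑ i ∈ t, N2 (f i) := by
  classical
  induction t using Finset.induction_on with
  | empty => simp [N2]
  | insert a s ha ih =>
    simp only [Finset.sum_insert ha]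
    exact (N2_add_le (hf a) (Finset.measurable_sum _ fun i _ => hf i)).trans
      (add_le_add le_rfl ih)

theorem eLpNorm_two_eq_N2 {E : Type*} [NormedAddCommGroup E] (f : V3 → E) :
    eLpNorm f 2 volume = N2 fun ξ => ‖f ξ‖ₑ := by
  rw [eLpNorm_eq_lintegral_rpow_enorm_toReal (by norm_num) (by norm_num), N2]
  simp

@[fun_prop]
theorem measurable_wt (s : ℝ) : Measurable (wt s) := by
  unfold wt; fun_prop

theorem wt_base_ne {ξ : V3} (h : ξ ≠ 0) :
    ENNReal.ofReal (2 * Real.pi * ‖ξ‖) ≠ 0 := by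
  have : 0 < 2 * Real.pi * ‖ξ‖ := by have := norm_pos_iff.2 h; positivity
  simpa using this

theorem wt_add {ξ : V3} (h : ξ ≠ 0) (a b : ℝ) : wt (a + b) ξ = wt a ξ * wt b ξ :=
  ENNReal.rpow_add _ _ (wt_base_ne h) ENNReal.ofReal_ne_top

theorem wt_zero (ξ : V3) : wt 0 ξ = 1 := ENNReal.rpow_zero

theorem wt_neg_mul_self {ξ : V3} (h : ξ ≠ 0) (a : ℝ) : wt (-a) ξ * wt a ξ = 1 := by
  rw [← wt_add h, neg_add_cancel, wt_zero]

theorem wt_neg (a : ℝ) (ξ : V3) : wt a (-ξ) = wt a ξ := by simp [wt]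

/-- Weights with negative exponent take the value ⊤ at the origin, so the multiplication rules for
`wt` are only used off this null set. -/
theorem ae_ne_zero : ∀ᵐ ξ : V3, ξ ≠ 0 := by
  simp [ae_iff]

/-- Replacing the larger of X and Y by the smaller one only increases the negative powers. This
converts any intermediate exponents into the two extreme ones, without an s-dependent constant. -/
theorem rpow_neg_mul_rpow_neg_le {X Y : ℝ≥0∞} (hX : X ≠ 0) (hX' : X ≠ ⊤) (hY : Y ≠ 0)
    (hY' : Y ≠ ⊤) {a b : ℝ} (ha : 0 ≤ a) (hb : 0 ≤ b) :
    X ^ (-a) * Y ^ (-b) ≤ X ^ (-(a + b)) + Y ^ (-(a + b)) := by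
  have key : ∀ {U W : ℝ≥0∞} {c : ℝ}, U ≤ W → 0 ≤ c → W ^ (-c) ≤ U ^ (-c) := by
    intro U W c h hc
    rw [ENNReal.rpow_neg, ENNReal.rpow_neg]
    exact ENNReal.inv_le_inv.2 (ENNReal.rpow_le_rpow h hc)
  rw [neg_add]
  rcases le_total X Y with h | h
  · refine le_add_right ?_
    rw [ENNReal.rpow_add _ _ hX hX']
    exact mul_le_mul' le_rfl (key h hb)
  · refine le_add_left ?_
    rw [ENNReal.rpow_add _ _ hY hY']
    exact mul_le_mul' (key h ha) le_rfl

/-! #### Bounded kernels -/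

/-- `w` is the kernel of a bounded trilinear form on `L²`. -/
def KerBdd (w : V3 → V3 → ℝ≥0∞) (K : ℝ≥0∞) : Prop :=
  ∀ F G H : V3 → ℝ≥0∞, Measurable F → Measurable G → Measurable H →
    ∫⁻ x, ∫⁻ y, w x y * (F x * G y * H (x + y)) ≤ K * (N2 F * N2 G * N2 H)

theorem KerBdd.add {w w' : V3 → V3 → ℝ≥0∞} {K K' : ℝ≥0∞} (h : KerBdd w K) (h' : KerBdd w' K')
    (hw : Measurable (Function.uncurry w)) :
    KerBdd (fun x y => w x y + w' x y) (K + K') := by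
  intro F G H hF hG hH
  have hm : Measurable (Function.uncurry fun x y => w x y * (F x * G y * H (x + y))) := by
    have : Measurable fun p : V3 × V3 => w p.1 p.2 := hw
    unfold Function.uncurry
    fun_prop
  have e1 : ∀ x, ∫⁻ y, (w x y + w' x y) * (F x * G y * H (x + y)) =
      (∫⁻ y, w x y * (F x * G y * H (x + y))) + ∫⁻ y, w' x y * (F x * G y * H (x + y)) := by
    intro x
    simp only [add_mul]
    exact lintegral_add_left (f := fun y => w x y * (F x * G y * H (x + y)))
      (hm.comp measurable_prodMk_left) _
  have e2 : Measurable fun x => ∫⁻ y, w x y * (F x * G y * H (x + y)) := hm.lintegral_prod_right'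
  simp only [e1]
  rw [lintegral_add_left e2, add_mul]
  exact add_le_add (h F G H hF hG hH) (h' F G H hF hG hH)

theorem KerBdd.mono {w w' : V3 → V3 → ℝ≥0∞} {K : ℝ≥0∞} (h : KerBdd w K)
    (hw : ∀ᵐ x : V3, ∀ᵐ y : V3, w' x y ≤ w x y) : KerBdd w' K := by
  intro F G H hF hG hH
  refine le_trans (lintegral_mono_ae ?_) (h F G H hF hG hH)
  filter_upwards [hw] with x hx
  refine lintegral_mono_ae ?_
  filter_upwards [hx] with y hy
  gcongr

theorem N2_comp_neg (F : V3 → ℝ≥0∞) : N2 (fun x => F (-x)) = N2 F := by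
  rw [N2, N2, lintegral_neg_eq_self (fun x => F x ^ 2)]

/-- Exchange of the first two variables. -/
theorem KerBdd.swap {w : V3 → V3 → ℝ≥0∞} {K : ℝ≥0∞} (h : KerBdd w K)
    (hw : Measurable (Function.uncurry w)) : KerBdd (fun x y => w y x) K := by
  intro F G H hF hG hH
  have := h G F H hG hF hH
  rw [lintegral_lintegral_swap] at this
  · calc _ = _ := ?_
      _ ≤ _ := this
      _ = _ := by ring
    refine lintegral_congr fun x => lintegral_congr fun y => ?_
    rw [add_comm y x]; ring
  · have : Measurable fun p : V3 × V3 => w p.1 p.2 := hw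
    unfold Function.uncurry
    fun_prop

/-- Exchange of the last two variables. -/
theorem KerBdd.rot {w : V3 → V3 → ℝ≥0∞} {K : ℝ≥0∞} (h : KerBdd w K) :
    KerBdd (fun x y => w (-x) (x + y)) K := by
  intro F G H hF hG hH
  have := h (fun x => F (-x)) H G (hF.comp measurable_neg) hH hG
  rw [N2_comp_neg] at this
  calc _ = _ := ?_
    _ ≤ _ := this
    _ = _ := by ring
  rw [← lintegral_neg_eq_self]
  refine lintegral_congr fun x => ?_
  rw [← lintegral_add_left_eq_self _ x]
  refine lintegral_congr fun y => ?_
  simp only [neg_neg]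
  rw [show -x + (x + y) = y by abel]; ring

theorem lintegral_mul_le_sqrt_mul_sqrt {α : Type*} [MeasurableSpace α] {μ : Measure α}
    {f g : α → ℝ≥0∞} (hf : AEMeasurable f μ) (hg : AEMeasurable g μ) :
    ∫⁻ a, f a * g a ∂μ ≤ (∫⁻ a, f a ^ 2 ∂μ) ^ (1 / 2 : ℝ) * (∫⁻ a, g a ^ 2 ∂μ) ^ (1 / 2 : ℝ) := by
  have := ENNReal.lintegral_mul_le_Lp_mul_Lq μ (p := 2) (q := 2) ⟨by norm_num, by norm_num, by norm_num⟩ hf hg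
  simpa using this

/-- Cauchy–Schwarz on the product space with the grouping (F w)(G H(x + y)): the first factor is
controlled by the hypothesis, and the second has norm exactly N2 G · N2 H by translation invariance.
-/
theorem kerBdd_of_lintegral_sq_le {w : V3 → V3 → ℝ≥0∞} {K : ℝ≥0∞}
    (hw : Measurable (Function.uncurry w)) (h : ∀ᵐ x, ∫⁻ y, w x y ^ 2 ≤ K ^ 2) : KerBdd w K := by
  intro F G H hF hG hH
  have hw' : Measurable fun p : V3 × V3 => w p.1 p.2 := hw
  have e1 : ∫⁻ x, ∫⁻ y, w x y * (F x * G y * H (x + y)) =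
      ∫⁻ p : V3 × V3, (F p.1 * w p.1 p.2) * (G p.2 * H (p.1 + p.2)) := by
    rw [Measure.volume_eq_prod, lintegral_prod _ (by fun_prop)]
    refine lintegral_congr fun x => lintegral_congr fun y => by ring
  rw [e1]
  refine (lintegral_mul_le_sqrt_mul_sqrt (by fun_prop) (by fun_prop)).trans ?_
  have e2 : ∫⁻ p : V3 × V3, (F p.1 * w p.1 p.2) ^ 2 ≤ (K * N2 F) ^ 2 := by
    rw [Measure.volume_eq_prod, lintegral_prod _ (by fun_prop), mul_pow, N2_sq,
      ← lintegral_const_mul _ (hF.pow_const 2)]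
    refine lintegral_mono_ae ?_
    filter_upwards [h] with x hx
    simp only [mul_pow]
    rw [lintegral_const_mul _ (by fun_prop), mul_comm]
    gcongr
  have e3 : ∫⁻ p : V3 × V3, (G p.2 * H (p.1 + p.2)) ^ 2 = (N2 G * N2 H) ^ 2 := by
    rw [Measure.volume_eq_prod, lintegral_prod_symm _ (by fun_prop), mul_pow, N2_sq, N2_sq,
      ← lintegral_mul_const _ (hG.pow_const 2)]
    refine lintegral_congr fun y => ?_
    simp only [mul_pow]
    rw [lintegral_const_mul _ (by fun_prop), lintegral_add_right_eq_self (fun x => H x ^ 2)]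
  have r : ∀ a : ℝ≥0∞, (a ^ 2) ^ (1 / 2 : ℝ) = a := fun a => by
    rw [← ENNReal.rpow_natCast, ← ENNReal.rpow_mul]; norm_num
  calc _ ≤ ((K * N2 F) ^ 2) ^ (1 / 2 : ℝ) * ((N2 G * N2 H) ^ 2) ^ (1 / 2 : ℝ) := by
        rw [e3]; gcongr
    _ = _ := by rw [r, r]; ring

/-- Duality for a function whose norm may be infinite. One tests against φ capped at height n and
restricted to the ball of radius n, whose norm is finite and can be cancelled, and concludes by
monotone convergence. -/
theorem N2_le_of_forall_lintegral_mul_le {φ : V3 → ℝ≥0∞} (hφ : Measurable φ) {A : ℝ≥0∞}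
    (h : ∀ H : V3 → ℝ≥0∞, Measurable H → ∫⁻ ξ, φ ξ * H ξ ≤ A * N2 H) : N2 φ ≤ A := by
  set H : ℕ → V3 → ℝ≥0∞ := fun n => (Metric.closedBall 0 n).indicator fun ξ => min (φ ξ) n with hH
  have hm : ∀ n, Measurable (H n) := fun n =>
    (hφ.min measurable_const).indicator Metric.isClosed_closedBall.measurableSet
  have hle : ∀ n, N2 (H n) ≤ A := by
    intro n
    have h1 : N2 (H n) ^ 2 ≤ A * N2 (H n) := by
      rw [N2_sq]
      refine le_trans (lintegral_mono fun ξ => ?_) (h (H n) (hm n))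
      rw [sq]
      gcongr
      simp only [hH]
      exact (indicator_le_self _ _ _).trans (min_le_left _ _)
    have hfin : N2 (H n) ≠ ⊤ := by
      refine ENNReal.rpow_ne_top_of_nonneg (by norm_num) (ne_of_lt ?_)
      calc ∫⁻ ξ, H n ξ ^ 2 ≤ ∫⁻ ξ, (Metric.closedBall (0 : V3) n).indicator
            (fun _ => ((n : ℝ≥0∞)) ^ 2) ξ := by
            refine lintegral_mono fun ξ => ?_
            simp only [hH, indicator]
            split_ifs
            · exact pow_le_pow_left' (min_le_right _ _) 2
            · simp
        _ = (n : ℝ≥0∞) ^ 2 * volume (Metric.closedBall (0 : V3) n) := by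
            rw [lintegral_indicator_const Metric.isClosed_closedBall.measurableSet]
        _ < ⊤ := ENNReal.mul_lt_top (by finiteness) measure_closedBall_lt_top
    rcases eq_or_ne (N2 (H n)) 0 with h0 | h0
    · rw [h0]; exact zero_le
    · rw [sq] at h1
      exact (ENNReal.mul_le_mul_iff_left h0 hfin).1 h1
  have hmono : Monotone fun n => fun ξ => H n ξ ^ 2 := by
    intro m n hmn ξ
    have hc : (m : ℝ≥0∞) ≤ n := by exact_mod_cast hmn
    have hc' : (m : ℝ) ≤ n := by exact_mod_cast hmn
    refine pow_le_pow_left' ?_ 2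
    simp only [hH, indicator, Metric.mem_closedBall]
    split_ifs with h1 h2
    · exact min_le_min le_rfl hc
    · exact absurd (h1.trans hc') h2
    · exact zero_le
    · exact le_rfl
  have hsup : ∀ ξ, ⨆ n, H n ξ ^ 2 = φ ξ ^ 2 := by
    intro ξ
    refine le_antisymm (iSup_le fun n => pow_le_pow_left' ?_ 2) ?_
    · simp only [hH]
      exact (indicator_le_self _ _ _).trans (min_le_left _ _)
    · obtain ⟨m, hm⟩ := exists_nat_ge ‖ξ‖
      have hev : ∀ n ≥ m, H n ξ = min (φ ξ) n := by
        intro n hn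
        simp only [hH]
        rw [indicator_of_mem]
        simp only [Metric.mem_closedBall, dist_zero_right]
        exact hm.trans (by exact_mod_cast hn)
      have ht : Filter.Tendsto (fun n : ℕ => H n ξ ^ 2) Filter.atTop (nhds (φ ξ ^ 2)) := by
        have h1 : Filter.Tendsto (fun n : ℕ => min (φ ξ) (n : ℝ≥0∞)) Filter.atTop
            (nhds (min (φ ξ) ⊤)) := tendsto_const_nhds.min ENNReal.tendsto_nat_nhds_top
        rw [min_top_right] at h1
        have h2 := (ENNReal.continuous_pow 2).tendsto (φ ξ) |>.comp h1
        refine h2.congr' ?_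
        filter_upwards [Filter.eventually_ge_atTop m] with n hn
        simp [hev n hn]
      exact le_of_tendsto ht (Filter.Eventually.of_forall fun n => le_iSup (fun n => H n ξ ^ 2) n)
  have h2 : N2 φ ^ 2 ≤ A ^ 2 := by
    rw [N2_sq]
    simp_rw [← hsup]
    rw [lintegral_iSup (fun n => (hm n).pow_const 2) hmono]
    refine iSup_le fun n => ?_
    rw [← N2_sq]
    exact pow_le_pow_left' (hle n) 2
  exact (ENNReal.pow_le_pow_left_iff two_ne_zero).1 h2

theorem measurable_conv {f g : V3 → ℝ≥0∞} (hf : Measurable f) (hg : Measurable g) :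
    Measurable (conv f g) := by
  unfold conv
  refine Measurable.lintegral_prod_right' (f := fun p : V3 × V3 => f (p.1 - p.2) * g p.2) ?_
  fun_prop

/-- A bounded kernel gives a weighted convolution inequality. -/
theorem KerBdd.N2_conv_le {w : V3 → V3 → ℝ≥0∞} {K : ℝ≥0∞} (h : KerBdd w K)
    {a b c : V3 → ℝ≥0∞} (ha : Measurable a) (hb : Measurable b) (hc : Measurable c)
    (hle : ∀ᵐ x : V3, ∀ᵐ y : V3, c (x + y) ≤ w x y * (a x * b y))
    {f g : V3 → ℝ≥0∞} (hf : Measurable f) (hg : Measurable g) :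
    N2 (fun ξ => c ξ * conv f g ξ) ≤
      K * (N2 (fun ξ => a ξ * f ξ) * N2 fun ξ => b ξ * g ξ) := by
  refine N2_le_of_forall_lintegral_mul_le (hc.mul (measurable_conv hf hg)) fun H hH => ?_
  have h1 := h (fun ξ => a ξ * f ξ) (fun ξ => b ξ * g ξ) H (ha.mul hf) (hb.mul hg) hH
  rw [mul_assoc]
  refine le_trans ?_ h1
  -- Tonelli and the change of variables ξ = x + y turn the pairing with H into the trilinear form
  -- of `KerBdd`.
  calc ∫⁻ ξ, c ξ * conv f g ξ * H ξ
      = ∫⁻ ξ, ∫⁻ η, c ξ * H ξ * (f (ξ - η) * g η) := by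
        refine lintegral_congr fun ξ => ?_
        rw [lintegral_const_mul _ (by fun_prop)]
        unfold conv; ring
    _ = ∫⁻ ξ, ∫⁻ x, c ξ * H ξ * (f x * g (ξ - x)) := by
        refine lintegral_congr fun ξ => ?_
        rw [← lintegral_sub_left_eq_self _ ξ]
        simp
    _ = ∫⁻ x, ∫⁻ ξ, c ξ * H ξ * (f x * g (ξ - x)) := by
        refine lintegral_lintegral_swap ?_
        unfold Function.uncurry
        fun_prop
    _ = ∫⁻ x, ∫⁻ y, c (x + y) * H (x + y) * (f x * g y) := by
        refine lintegral_congr fun x => ?_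
        rw [← lintegral_add_left_eq_self _ x]
        simp
    _ ≤ _ := by
        refine lintegral_mono_ae ?_
        filter_upwards [hle] with x hx
        refine lintegral_mono_ae ?_
        filter_upwards [hx] with y hy
        calc _ ≤ w x y * (a x * b y) * H (x + y) * (f x * g y) := by gcongr
          _ = _ := by ring

end NSM
end


/-! ### Singular kernels on ℝ³ and the product laws in homogeneous Sobolev spaces -/

noncomputable section

namespace NSM

/-- In polar coordinates the radial density is r^{2-a}, bounded by R^{2-a} on (0,R] because a ≤ 2;
this crude bound gives the right homogeneity R^{3-a}. -/
theorem lintegral_closedBall_inv_pow_le {a : ℕ} (ha : a ≤ 2) {R : ℝ} (hR : 0 < R) :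
    ∫⁻ y in Metric.closedBall (0 : V3) R, ENNReal.ofReal ((‖y‖ ^ a)⁻¹) ≤
      ENNReal.ofReal (3 * volume.real (Metric.ball (0 : V3) 1) * R ^ (3 - a)) := by
  set g : ℝ → ℝ := (Iic R).indicator fun r => (r ^ a)⁻¹ with hg
  have hdim : Module.finrank ℝ V3 = 3 := by simp
  have hb : ∀ r ∈ Ioi (0 : ℝ), r ^ 2 • g r ≤ (Iic R).indicator (fun _ => R ^ (2 - a)) r := by
    intro r hr
    have hr0 : 0 < r := hr
    simp only [hg, indicator, mem_Iic, smul_eq_mul]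
    split_ifs with h
    · have : r ^ 2 * (r ^ a)⁻¹ = r ^ (2 - a) := by
        rw [pow_sub₀ _ hr0.ne' ha]
      rw [this]; gcongr
    · simp
  have hnn : ∀ r ∈ Ioi (0 : ℝ), 0 ≤ r ^ 2 • g r := by
    intro r hr
    have hr0 : 0 < r := hr
    simp only [hg, indicator, smul_eq_mul]
    split_ifs <;> positivity
  have hgm : Measurable g := by
    refine Measurable.indicator ?_ measurableSet_Iic
    fun_prop
  have hdom : IntegrableOn ((Iic R).indicator fun _ => R ^ (2 - a)) (Ioi (0 : ℝ)) volume := by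
    rw [IntegrableOn, integrable_indicator_iff measurableSet_Iic]
    rw [IntegrableOn, Measure.restrict_restrict measurableSet_Iic]
    refine integrableOn_const ?_
    rw [Iic_inter_Ioi]; simp
  have hint : IntegrableOn (fun r => r ^ 2 • g r) (Ioi (0 : ℝ)) volume := by
    refine Integrable.mono' hdom ?_ ?_
    · exact ((measurable_id.pow_const 2).smul hgm).aestronglyMeasurable
    · filter_upwards [ae_restrict_mem measurableSet_Ioi] with r hr
      rw [Real.norm_of_nonneg (hnn r hr)]; exact hb r hr
  have hI : Integrable (fun x : V3 => g ‖x‖) volume := by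
    rw [integrable_fun_norm_addHaar, hdim]; exact hint
  have hval : ∫ x : V3, g ‖x‖ ≤ 3 * volume.real (Metric.ball (0 : V3) 1) * R ^ (3 - a) := by
    rw [integral_fun_norm_addHaar, hdim]
    have : ∫ r in Ioi (0 : ℝ), r ^ (3 - 1) • g r ≤ R ^ (3 - a) := by
      calc _ ≤ ∫ r in Ioi (0 : ℝ), (Iic R).indicator (fun _ => R ^ (2 - a)) r :=
            setIntegral_mono_on hint hdom measurableSet_Ioi hb
        _ = R * R ^ (2 - a) := by
            rw [integral_indicator measurableSet_Iic, Measure.restrict_restrict measurableSet_Iic,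
              setIntegral_const, Iic_inter_Ioi]
            simp [Measure.real, hR.le]
        _ = _ := by rw [← pow_succ', show 2 - a + 1 = 3 - a by omega]
    simp only [nsmul_eq_mul, smul_eq_mul]
    push_cast
    rw [← mul_assoc]
    exact mul_le_mul_of_nonneg_left this (by positivity)
  calc _ = ∫⁻ x : V3, ENNReal.ofReal (g ‖x‖) := by
        rw [← lintegral_indicator Metric.isClosed_closedBall.measurableSet]
        refine lintegral_congr fun x => ?_
        simp only [hg, indicator, Metric.mem_closedBall, dist_zero_right, mem_Iic]
        split_ifs <;> simp
    _ = ENNReal.ofReal (∫ x : V3, g ‖x‖) := by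
        rw [ofReal_integral_eq_lintegral_ofReal hI]
        refine Filter.Eventually.of_forall fun x => ?_
        simp only [hg, indicator, Pi.zero_apply]
        split_ifs <;> positivity
    _ ≤ _ := ENNReal.ofReal_le_ofReal hval

theorem wt_neg_natCast {y : V3} (hy : y ≠ 0) (a : ℕ) :
    wt (-(a : ℝ)) y = ENNReal.ofReal (((2 * Real.pi) ^ a)⁻¹) * ENNReal.ofReal ((‖y‖ ^ a)⁻¹) := by
  have hp : 0 < 2 * Real.pi * ‖y‖ := by have := norm_pos_iff.2 hy; positivity
  rw [wt, ENNReal.ofReal_rpow_of_pos hp, ← ENNReal.ofReal_mul (by positivity),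
    Real.rpow_neg hp.le, Real.rpow_natCast, mul_pow, mul_inv]

theorem wt_sq (s : ℝ) (y : V3) : wt s y ^ 2 = wt (2 * s) y := by
  rw [wt, wt, mul_comm 2 s, ENNReal.rpow_mul]; norm_num

/-- Split into |y| ≤ |x| and |x| ≤ |y|. On the first region, Cauchy–Schwarz needs |x|⁻² ∫_{|y| ≤
|x|} |y|⁻¹ dy to be bounded. On the second, after exchanging the variables, it needs |x|⁻¹ ∫_{|y| ≤
|x|} |y|⁻² dy. Both are scale invariant in dimension three. -/
theorem exists_kerBdd_base : ∃ K : ℝ≥0, KerBdd (fun x y => wt (-1) x * wt (-(1 / 2)) y) K := by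
  set κ : ℝ := 3 * volume.real (Metric.ball (0 : V3) 1) with hκ
  have hκ0 : 0 ≤ κ := by positivity
  have hp : ∀ a : ℕ, 0 < ((2 * Real.pi) ^ a)⁻¹ := fun a => by have := Real.pi_pos; positivity
  set p1 : ℝ := ((2 * Real.pi) ^ 1)⁻¹ with hp1
  set p2 : ℝ := ((2 * Real.pi) ^ 2)⁻¹ with hp2
  have hp1' : 0 < p1 := hp 1
  have hp2' : 0 < p2 := hp 2
  set K : ℝ := Real.sqrt (p1 * p2 * κ) with hK
  have hKsq : ENNReal.ofReal K ^ 2 = ENNReal.ofReal (p1 * p2 * κ) := by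
    rw [← ENNReal.ofReal_pow (Real.sqrt_nonneg _), Real.sq_sqrt (by positivity)]
  -- The squared weights have exponents a in y and b in x; a + b = 3 makes the integral independent
  -- of |x|. The two regions correspond to (a, b) = (1, 2) and (2, 1).
  have main : ∀ a b : ℕ, 1 ≤ a → a ≤ 2 → b = 3 - a → ∀ᵐ x : V3,
      ∫⁻ y, (if ‖y‖ ≤ ‖x‖ then wt (-(b : ℝ) / 2) x * wt (-(a : ℝ) / 2) y else 0) ^ 2 ≤
        ENNReal.ofReal K ^ 2 := by
    intro a b ha1 ha hb
    filter_upwards [ae_ne_zero] with x hx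
    have hx0 := norm_pos_iff.2 hx
    have e : ∀ᵐ y : V3, (if ‖y‖ ≤ ‖x‖ then wt (-(b : ℝ) / 2) x * wt (-(a : ℝ) / 2) y else 0) ^ 2 ≤
        wt (-(b : ℝ)) x * (ENNReal.ofReal (((2 * Real.pi) ^ a)⁻¹) *
          (Metric.closedBall (0 : V3) ‖x‖).indicator (fun y => ENNReal.ofReal ((‖y‖ ^ a)⁻¹)) y) := by
      filter_upwards [ae_ne_zero] with y hy
      simp only [indicator, Metric.mem_closedBall, dist_zero_right]
      split_ifs with h
      · rw [mul_pow, wt_sq, wt_sq, ← wt_neg_natCast hy a]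
        rw [show 2 * (-(b : ℝ) / 2) = -b by ring, show 2 * (-(a : ℝ) / 2) = -a by ring]
      · simp
    refine (lintegral_mono_ae e).trans ?_
    rw [lintegral_const_mul _ (by
        refine Measurable.const_mul (Measurable.indicator ?_
          Metric.isClosed_closedBall.measurableSet) _
        fun_prop), lintegral_const_mul _ (by
        refine Measurable.indicator ?_ Metric.isClosed_closedBall.measurableSet
        fun_prop), lintegral_indicator Metric.isClosed_closedBall.measurableSet]
    calc _ ≤ wt (-(b : ℝ)) x * (ENNReal.ofReal (((2 * Real.pi) ^ a)⁻¹) *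
          ENNReal.ofReal (κ * ‖x‖ ^ (3 - a))) := by
          gcongr
          exact lintegral_closedBall_inv_pow_le ha hx0
      _ = ENNReal.ofReal (p1 * p2 * κ) := by
          rw [wt_neg_natCast hx, ← hb, ← ENNReal.ofReal_mul (by positivity),
            ← ENNReal.ofReal_mul (by positivity), ← ENNReal.ofReal_mul (by positivity)]
          congr 1
          have : ‖x‖ ^ b ≠ 0 := by positivity
          have h12 : ((2 * Real.pi) ^ b)⁻¹ * ((2 * Real.pi) ^ a)⁻¹ = p1 * p2 := by
            rcases (show a = 1 ∨ a = 2 by omega) with rfl | rfl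
            · have : b = 2 := by omega
              subst this; rw [hp1, hp2, mul_comm]
            · have : b = 1 := by omega
              subst this; rw [hp1, hp2]
          calc _ = (((2 * Real.pi) ^ b)⁻¹ * ((2 * Real.pi) ^ a)⁻¹) * κ * ((‖x‖ ^ b)⁻¹ * ‖x‖ ^ b) := by
                ring
            _ = _ := by rw [inv_mul_cancel₀ this, h12, mul_one]
      _ = _ := hKsq.symm
  have hm : ∀ s t : ℝ, Measurable (Function.uncurry fun x y : V3 =>
      if ‖y‖ ≤ ‖x‖ then wt s x * wt t y else 0) := by
    intro s t
    unfold Function.uncurry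
    refine Measurable.ite (measurableSet_le (by fun_prop) (by fun_prop)) (by fun_prop) (by fun_prop)
  have k1 := kerBdd_of_lintegral_sq_le (hm _ _) (main 1 2 le_rfl (by norm_num) rfl)
  have k2 := (kerBdd_of_lintegral_sq_le (hm _ _) (main 2 1 (by norm_num) le_rfl rfl)).swap (hm _ _)
  refine ⟨K.toNNReal + K.toNNReal, ?_⟩
  have k3 := (k1.add k2 (hm _ _)).mono (w' := fun x y => wt (-1) x * wt (-(1 / 2)) y)
    (Filter.Eventually.of_forall fun x => Filter.Eventually.of_forall fun y => ?_)
  · rw [ENNReal.coe_add]; exact k3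
  · norm_num
    rcases le_total ‖y‖ ‖x‖ with h | h
    · simp [h]
    · simp only [h, if_true]
      rw [mul_comm]; exact le_add_left (le_of_eq (by norm_num [neg_div]))

/-- The six bounded kernels with weights `|·|⁻¹` and `|·|^{-1/2}` on two of the three variables. -/
theorem exists_kerBdd_all : ∃ K : ℝ≥0,
    KerBdd (fun x y => wt (-1) x * wt (-(1 / 2)) y) K ∧
    KerBdd (fun x y => wt (-(1 / 2)) x * wt (-1) y) K ∧
    KerBdd (fun x y => wt (-1) x * wt (-(1 / 2)) (x + y)) K ∧
    KerBdd (fun x y => wt (-(1 / 2)) x * wt (-1) (x + y)) K ∧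
    KerBdd (fun x y => wt (-1) y * wt (-(1 / 2)) (x + y)) K ∧
    KerBdd (fun x y => wt (-(1 / 2)) y * wt (-1) (x + y)) K := by
  obtain ⟨K, hK⟩ := exists_kerBdd_base
  have m : ∀ s t : ℝ, Measurable (Function.uncurry fun x y : V3 => wt s x * wt t y) := by
    intro s t; unfold Function.uncurry; fun_prop
  have m' : ∀ s t : ℝ, Measurable (Function.uncurry fun x y : V3 => wt s x * wt t (x + y)) := by
    intro s t; unfold Function.uncurry; fun_prop
  have h2 : KerBdd (fun x y => wt (-(1 / 2)) x * wt (-1) y) K := by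
    have := hK.swap (m _ _)
    simpa only [mul_comm] using this
  have h3 := hK.rot
  have h4 := h2.rot
  simp only [wt_neg] at h3 h4
  have h5 := h3.swap (m' _ _)
  have h6 := h4.swap (m' _ _)
  refine ⟨K, hK, h2, h3, h4, ?_, ?_⟩
  · simpa only [add_comm] using h5
  · simpa only [add_comm] using h6

theorem ae_triple_ne_zero : ∀ᵐ x : V3, ∀ᵐ y : V3, x ≠ 0 ∧ y ≠ 0 ∧ x + y ≠ 0 := by
  filter_upwards [ae_ne_zero] with x hx
  have : ∀ᵐ y : V3, y ≠ -x := by simp [ae_iff]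
  filter_upwards [ae_ne_zero, this] with y hy hxy
  exact ⟨hx, hy, fun h => hxy (eq_neg_of_add_eq_zero_right h)⟩

theorem wt_mul_wt_le {x y : V3} (hx : x ≠ 0) (hy : y ≠ 0) {a b : ℝ} (ha : 0 ≤ a) (hb : 0 ≤ b) :
    wt (-a) x * wt (-b) y ≤ wt (-(a + b)) x + wt (-(a + b)) y :=
  rpow_neg_mul_rpow_neg_le (wt_base_ne hx) ENNReal.ofReal_ne_top (wt_base_ne hy)
    ENNReal.ofReal_ne_top ha hb

/-- The convolution inequalities `Ḣᵃ × Ḣᵇ → Ḣ^{a+b-3/2}` needed below. -/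
theorem exists_conv_bounds : ∃ K : ℝ≥0, ∀ s : ℝ, 0 ≤ s → s ≤ 1 / 2 →
    ∀ f g : V3 → ℝ≥0∞, Measurable f → Measurable g →
    N2 (fun ξ => wt (s - 1) ξ * conv f g ξ) ≤
      K * (N2 (fun ξ => wt 0 ξ * f ξ) * N2 fun ξ => wt (s + 1 / 2) ξ * g ξ) ∧
    N2 (fun ξ => wt (s - 1) ξ * conv f g ξ) ≤
      K * (N2 (fun ξ => wt s ξ * f ξ) * N2 fun ξ => wt (1 / 2) ξ * g ξ) ∧
    N2 (fun ξ => wt s ξ * conv f g ξ) ≤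
      K * (N2 (fun ξ => wt 1 ξ * f ξ) * N2 fun ξ => wt (s + 1 / 2) ξ * g ξ) := by
  obtain ⟨K, h1, h2, h3, h4, h5, h6⟩ := exists_kerBdd_all
  have mxy : ∀ s t : ℝ, Measurable (Function.uncurry fun x y : V3 => wt s x * wt t y) := by
    intro s t; unfold Function.uncurry; fun_prop
  have myz : ∀ s t : ℝ, Measurable (Function.uncurry fun x y : V3 => wt s y * wt t (x + y)) := by
    intro s t; unfold Function.uncurry; fun_prop
  -- For s in [0,1/2] both exponents lie between 1/2 and 1. After a factor |·|^{-1/2} is taken from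
  -- each variable, the remaining total exponent 1/2 goes to the smaller one, leaving only the two
  -- extreme kernels.
  have split : ∀ {x y : V3} {s : ℝ}, x ≠ 0 → y ≠ 0 → 0 ≤ s → s ≤ 1 / 2 →
      wt (-(1 - s)) x * wt (-(s + 1 / 2)) y ≤
        wt (-1) x * wt (-(1 / 2)) y + wt (-(1 / 2)) x * wt (-1) y := by
    intro x y s hx hy h0 h1
    calc _ = (wt (-(1 / 2)) x * wt (-(1 / 2)) y) * (wt (-(1 / 2 - s)) x * wt (-s) y) := by
          rw [show -(1 - s) = -(1 / 2) + -(1 / 2 - s) by ring, wt_add hx,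
            show -(s + 1 / 2) = -(1 / 2) + -s by ring, wt_add hy]
          ring
      _ ≤ (wt (-(1 / 2)) x * wt (-(1 / 2)) y) * (wt (-(1 / 2)) x + wt (-(1 / 2)) y) := by
          gcongr
          have := wt_mul_wt_le hx hy (a := 1 / 2 - s) (b := s) (by linarith) h0
          rwa [show 1 / 2 - s + s = 1 / 2 by ring] at this
      _ = _ := by
          have e : ∀ {z : V3}, z ≠ 0 → wt (-1) z = wt (-(1 / 2)) z * wt (-(1 / 2)) z := by
            intro z hz
            rw [← wt_add hz]; norm_num
          rw [e hx, e hy]; ring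
  refine ⟨K + K + K, fun s hs0 hs1 f g hf hg => ⟨?_, ?_, ?_⟩⟩
  -- The factor in L² carries no weight, so the kernels must be singular in y and x + y only.
  · refine ((h5.add h6 (myz _ _)).N2_conv_le (measurable_wt 0) (measurable_wt (s + 1 / 2))
      (measurable_wt (s - 1)) ?_ hf hg).trans ?_
    · filter_upwards [ae_triple_ne_zero] with x hx
      filter_upwards [hx] with y hy
      obtain ⟨hx, hy, hz⟩ := hy
      rw [wt_zero, one_mul]
      calc wt (s - 1) (x + y) = (wt (-(1 - s)) (x + y) * wt (-(s + 1 / 2)) y) * wt (s + 1 / 2) y := by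
            rw [mul_assoc, wt_neg_mul_self hy, mul_one]; congr 1; ring
        _ ≤ _ := by
            gcongr
            refine (split hz hy hs0 hs1).trans (le_of_eq ?_)
            ring
    · push_cast; gcongr; exact le_self_add
  -- Here y always has exponent 1/2, and the remaining exponent 1 is shared between x and x + y.
  · refine ((h1.add h6 (mxy _ _)).N2_conv_le (measurable_wt s) (measurable_wt (1 / 2))
      (measurable_wt (s - 1)) ?_ hf hg).trans ?_
    · filter_upwards [ae_triple_ne_zero] with x hx
      filter_upwards [hx] with y hy
      obtain ⟨hx, hy, hz⟩ := hy
      have e := wt_mul_wt_le hx hz hs0 (show (0 : ℝ) ≤ 1 - s by linarith)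
      rw [show s + (1 - s) = 1 by ring] at e
      calc wt (s - 1) (x + y) = (wt (-s) x * wt s x) * (wt (-(1 / 2)) y * wt (1 / 2) y) *
            wt (-(1 - s)) (x + y) := by
            rw [wt_neg_mul_self hx, wt_neg_mul_self hy, one_mul, one_mul]; congr 1; ring
        _ = (wt (-s) x * wt (-(1 - s)) (x + y)) * (wt (-(1 / 2)) y * (wt s x * wt (1 / 2) y)) := by
            ring
        _ ≤ (wt (-1) x + wt (-1) (x + y)) * (wt (-(1 / 2)) y * (wt s x * wt (1 / 2) y)) := by
            gcongr
        _ = _ := by ring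
    · push_cast; gcongr; exact le_self_add
  -- The output weight is positive and is split by the triangle inequality: |x|^s is absorbed by the
  -- first two kernels, |y|^s by the third. This case uses three kernels and fixes the constant 3K.
  · refine (((h1.add h2 (mxy _ _)).add h1 (by
      unfold Function.uncurry; fun_prop)).N2_conv_le (measurable_wt 1) (measurable_wt (s + 1 / 2))
      (measurable_wt s) ?_ hf hg).trans ?_
    · filter_upwards [ae_triple_ne_zero] with x hx
      filter_upwards [hx] with y hy
      obtain ⟨hx, hy, hz⟩ := hy
      have tri : wt s (x + y) ≤ wt s x + wt s y := by
        have hle : ENNReal.ofReal (2 * Real.pi * ‖x + y‖) ≤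
            ENNReal.ofReal (2 * Real.pi * ‖x‖) + ENNReal.ofReal (2 * Real.pi * ‖y‖) := by
          rw [← ENNReal.ofReal_add (by positivity) (by positivity), ← mul_add]
          exact ENNReal.ofReal_le_ofReal (by gcongr; exact norm_add_le _ _)
        exact (ENNReal.rpow_le_rpow hle hs0).trans
          (ENNReal.rpow_add_le_add_rpow _ _ hs0 (by linarith))
      calc wt s (x + y) ≤ wt s x + wt s y := tri
        _ = (wt (-(1 - s)) x * wt (-(s + 1 / 2)) y) * (wt 1 x * wt (s + 1 / 2) y) +
            (wt (-1) x * wt (-(1 / 2)) y) * (wt 1 x * wt (s + 1 / 2) y) := by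
            congr 1
            · calc wt s x = (wt (-(1 - s)) x * wt 1 x) * (wt (-(s + 1 / 2)) y * wt (s + 1 / 2) y) := by
                    rw [wt_neg_mul_self hy, mul_one, ← wt_add hx]; congr 1; ring
                _ = _ := by ring
            · calc wt s y = (wt (-1) x * wt 1 x) * (wt (-(1 / 2)) y * wt (s + 1 / 2) y) := by
                    rw [wt_neg_mul_self hx, one_mul, ← wt_add hy]; congr 1; ring
                _ = _ := by ring
        _ = (wt (-(1 - s)) x * wt (-(s + 1 / 2)) y + wt (-1) x * wt (-(1 / 2)) y) *
              (wt 1 x * wt (s + 1 / 2) y) := by ring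
        _ ≤ _ := by
            gcongr
            exact split hx hy hs0 hs1
    · push_cast; exact le_rfl

end NSM
end


noncomputable section

namespace NSM

/-! ### Smooth scalar fields with square-integrable derivatives -/

theorem mem_timeI_of_le {T : ℝ≥0∞} {t τ : ℝ} (ht : t ∈ timeI T) (h : τ ∈ Icc 0 t) : τ ∈ timeI T :=
  ⟨h.1, (ENNReal.ofReal_le_ofReal h.2).trans_lt ht.2⟩

theorem zero_mem_timeI {T : ℝ≥0∞} (hT : 0 < T) : (0 : ℝ) ∈ timeI T := ⟨le_rfl, by simpa using hT⟩

theorem exists_Icc_subset_timeI {T : ℝ≥0∞} {t : ℝ} (ht : t ∈ timeI T) :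
    ∃ t' ∈ timeI T, t < t' := by
  obtain ⟨r, h1, h2⟩ := ENNReal.lt_iff_exists_real_btwn.1 ht.2
  obtain ⟨h3, h4⟩ := h2
  refine ⟨r, ⟨h1, h4⟩, ?_⟩
  by_contra h
  exact absurd (h3.trans_le (ENNReal.ofReal_le_ofReal (not_lt.1 h))) (lt_irrefl _)

theorem convex_timeI (T : ℝ≥0∞) : Convex ℝ (timeI T) := by
  refine OrdConnected.convex ⟨fun a ha b hb c hc => ?_⟩
  exact ⟨ha.1.trans hc.1, (ENNReal.ofReal_le_ofReal hc.2).trans_lt hb.2⟩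

theorem interior_timeI_nonempty {T : ℝ≥0∞} (hT : 0 < T) : (interior (timeI T)).Nonempty := by
  obtain ⟨t, ht, h0⟩ := exists_Icc_subset_timeI (zero_mem_timeI hT)
  refine ⟨t / 2, mem_interior.2 ⟨Ioo 0 t, fun τ hτ => ?_, isOpen_Ioo, by constructor <;> linarith⟩⟩
  exact mem_timeI_of_le ht ⟨hτ.1.le, hτ.2.le⟩

theorem uniqueDiffOn_timeI {T : ℝ≥0∞} (hT : 0 < T) : UniqueDiffOn ℝ (timeI T) :=
  uniqueDiffOn_convex (convex_timeI T) (interior_timeI_nonempty hT)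

/-- The space-time domain `[0,T) × ℝ³`. -/
abbrev dom (T : ℝ≥0∞) : Set (ℝ × V3) := timeI T ×ˢ univ

theorem uniqueDiffOn_dom {T : ℝ≥0∞} (hT : 0 < T) : UniqueDiffOn ℝ (dom T) :=
  (uniqueDiffOn_timeI hT).prod uniqueDiffOn_univ

/-- The domain contains its boundary slice t = 0; this inclusion is what makes second derivatives
within the domain symmetric there as well. -/
theorem dom_subset_closure_interior {T : ℝ≥0∞} (hT : 0 < T) :
    dom T ⊆ closure (interior (dom T)) := by
  rw [interior_prod_eq, closure_prod_eq, interior_univ, closure_univ]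
  refine prod_mono ?_ le_rfl
  rw [(convex_timeI T).closure_interior_eq_closure_of_nonempty_interior (interior_timeI_nonempty hT)]
  exact subset_closure

/-- The direction in space-time of a partial derivative; `none` is time. -/
def dirv : Option (Fin 3) → ℝ × V3
  | none => (1, 0)
  | some i => (0, EuclideanSpace.single i 1)

theorem norm_dirv_le (d : Option (Fin 3)) : ‖dirv d‖ ≤ 1 := by
  cases d <;> simp [dirv, Prod.norm_def]

/-- Space-time partial derivatives of scalar fields on `[0,T) × ℝ³`. -/
def Dm (T : ℝ≥0∞) (d : Option (Fin 3)) (f : ℝ → V3 → ℝ) (t : ℝ) (x : V3) : ℝ :=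
  fderivWithin ℝ (fun q : ℝ × V3 => f q.1 q.2) (dom T) (t, x) (dirv d)

/-- Iterated partial derivatives. -/
def word (T : ℝ≥0∞) : List (Option (Fin 3)) → (ℝ → V3 → ℝ) → ℝ → V3 → ℝ
  | [], f => f
  | d :: l, f => word T l (Dm T d f)

/-- Smooth scalar fields on `[0,T) × ℝ³` all of whose derivatives are bounded in `L²`, locally
uniformly in time. -/
structure SC (T : ℝ≥0∞) (f : ℝ → V3 → ℝ) : Prop where
  smooth : ContDiffOn ℝ ∞ (fun q : ℝ × V3 => f q.1 q.2) (dom T)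
  bdd : ∀ l, ∀ t ∈ timeI T, ∃ M : ℝ≥0, ∀ τ ∈ Icc 0 t, eLpNorm (word T l f τ) 2 volume ≤ M

variable {T : ℝ≥0∞} {f g : ℝ → V3 → ℝ}

theorem Dm_congr (h : ∀ t ∈ timeI T, ∀ x, f t x = g t x) (d : Option (Fin 3)) :
    ∀ t ∈ timeI T, ∀ x, Dm T d f t x = Dm T d g t x := by
  intro t ht x
  unfold Dm
  rw [fderivWithin_congr (f := fun q : ℝ × V3 => g q.1 q.2) (fun q hq => h q.1 hq.1 q.2)
    (h t ht x)]

theorem word_congr (h : ∀ t ∈ timeI T, ∀ x, f t x = g t x) (l : List (Option (Fin 3))) :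
    ∀ t ∈ timeI T, ∀ x, word T l f t x = word T l g t x := by
  induction l generalizing f g with
  | nil => exact h
  | cons d l ih => exact ih (Dm_congr h d)

theorem SC.congr (hf : SC T f) (h : ∀ t ∈ timeI T, ∀ x, g t x = f t x) : SC T g where
  smooth := hf.smooth.congr fun q hq => h q.1 hq.1 q.2
  bdd l t ht := by
    obtain ⟨M, hM⟩ := hf.bdd l t ht
    refine ⟨M, fun τ hτ => ?_⟩
    rw [show word T l g τ = word T l f τ from funext fun x =>
      word_congr h l τ (mem_timeI_of_le ht hτ) x]
    exact hM τ hτ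

theorem SC.contDiffOn_fderivWithin (hT : 0 < T) (hf : SC T f) :
    ContDiffOn ℝ ∞ (fderivWithin ℝ (fun q : ℝ × V3 => f q.1 q.2) (dom T)) (dom T) :=
  hf.smooth.fderivWithin (uniqueDiffOn_dom hT) (by simp)

theorem SC.differentiableWithinAt (hf : SC T f) {t : ℝ} (ht : t ∈ timeI T) (x : V3) :
    DifferentiableWithinAt ℝ (fun q : ℝ × V3 => f q.1 q.2) (dom T) (t, x) :=
  (hf.smooth.differentiableOn (by simp)) _ ⟨ht, mem_univ _⟩

theorem SC.Dm (hT : 0 < T) (hf : SC T f) (d : Option (Fin 3)) : SC T (Dm T d f) where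
  smooth := (hf.contDiffOn_fderivWithin hT).clm_apply contDiffOn_const
  bdd l := hf.bdd (d :: l)

theorem Dm_some (hf : SC T f) (i : Fin 3) {t : ℝ} (ht : t ∈ timeI T) (x : V3) :
    NSM.Dm T (some i) f t x = fderiv ℝ (f t) x (EuclideanSpace.single i 1) := by
  have h := (hf.differentiableWithinAt ht x).hasFDerivWithinAt
  have h2 : HasFDerivWithinAt (fun y : V3 => (t, y)) (ContinuousLinearMap.inr ℝ ℝ V3) univ x :=
    (hasFDerivAt_prodMk_right t x).hasFDerivWithinAt
  have h3 := h.comp x h2 fun y _ => (⟨ht, mem_univ _⟩ : (t, y) ∈ dom T)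
  rw [hasFDerivWithinAt_univ] at h3
  have h4 : fderiv ℝ (f t) x = _ := h3.fderiv
  rw [h4]; rfl

theorem hasDerivWithinAt_Dm (hf : SC T f) {t : ℝ} (ht : t ∈ timeI T) (x : V3) :
    HasDerivWithinAt (fun τ => f τ x) (NSM.Dm T none f t x) (timeI T) t := by
  have h := (hf.differentiableWithinAt ht x).hasFDerivWithinAt
  have h2 : HasFDerivWithinAt (fun τ : ℝ => (τ, x)) (ContinuousLinearMap.inl ℝ ℝ V3) (timeI T) t :=
    (hasFDerivAt_prodMk_left t x).hasFDerivWithinAt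
  have h3 := h.comp t h2 fun y hy => (⟨hy, mem_univ _⟩ : (y, x) ∈ dom T)
  exact h3.hasDerivWithinAt

theorem SC.contDiff (hf : SC T f) {t : ℝ} (ht : t ∈ timeI T) : ContDiff ℝ ∞ (f t) := by
  rw [← contDiffOn_univ]
  exact hf.smooth.comp (f := fun y : V3 => (t, y)) (by fun_prop) fun y _ => ⟨ht, mem_univ _⟩

theorem SC.differentiable (hf : SC T f) {t : ℝ} (ht : t ∈ timeI T) : Differentiable ℝ (f t) :=
  (hf.contDiff ht).differentiable (by simp)

theorem SC.continuous (hf : SC T f) {t : ℝ} (ht : t ∈ timeI T) : Continuous (f t) :=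
  (hf.contDiff ht).continuous

theorem SC.exists_bound (hf : SC T f) {t : ℝ} (ht : t ∈ timeI T) :
    ∃ M : ℝ≥0, ∀ τ ∈ Icc 0 t, eLpNorm (f τ) 2 volume ≤ M := hf.bdd [] t ht

theorem SC.memLp (hf : SC T f) {t : ℝ} (ht : t ∈ timeI T) : MemLp (f t) 2 volume := by
  obtain ⟨M, hM⟩ := hf.exists_bound ht
  exact ⟨(hf.continuous ht).aestronglyMeasurable,
    (hM t ⟨ht.1, le_rfl⟩).trans_lt ENNReal.coe_lt_top⟩

theorem SC.memLp_fderiv (hT : 0 < T) (hf : SC T f) {t : ℝ} (ht : t ∈ timeI T) (i : Fin 3) :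
    MemLp (fun x => fderiv ℝ (f t) x (EuclideanSpace.single i 1)) 2 volume := by
  have := (hf.Dm hT (some i)).memLp ht
  rwa [show NSM.Dm T (some i) f t = _ from funext fun x => Dm_some hf i ht x] at this

theorem Dm_add_of_smooth (hT : 0 < T)
    (hf : ContDiffOn ℝ ∞ (fun q : ℝ × V3 => f q.1 q.2) (dom T))
    (hg : ContDiffOn ℝ ∞ (fun q : ℝ × V3 => g q.1 q.2) (dom T)) (d : Option (Fin 3)) :
    ∀ t ∈ timeI T, ∀ x, NSM.Dm T d (fun t x => f t x + g t x) t x =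
      NSM.Dm T d f t x + NSM.Dm T d g t x := by
  intro t ht x
  unfold NSM.Dm
  have := fderivWithin_fun_add (uniqueDiffOn_dom hT (t, x) ⟨ht, mem_univ _⟩)
    (hf.differentiableOn (by simp) _ ⟨ht, mem_univ _⟩)
    (hg.differentiableOn (by simp) _ ⟨ht, mem_univ _⟩)
  rw [this]; rfl

theorem Dm_add (hT : 0 < T) (hf : SC T f) (hg : SC T g) (d : Option (Fin 3)) :
    ∀ t ∈ timeI T, ∀ x, NSM.Dm T d (fun t x => f t x + g t x) t x =
      NSM.Dm T d f t x + NSM.Dm T d g t x :=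
  Dm_add_of_smooth hT hf.smooth hg.smooth d

theorem Dm_mul (hT : 0 < T) (hf : SC T f) (hg : SC T g) (d : Option (Fin 3)) :
    ∀ t ∈ timeI T, ∀ x, NSM.Dm T d (fun t x => f t x * g t x) t x =
      NSM.Dm T d f t x * g t x + f t x * NSM.Dm T d g t x := by
  intro t ht x
  unfold NSM.Dm
  have := fderivWithin_fun_mul (uniqueDiffOn_dom hT (t, x) ⟨ht, mem_univ _⟩)
    (hf.differentiableWithinAt ht x) (hg.differentiableWithinAt ht x)
  rw [this]
  simp only [add_apply, smul_apply, smul_eq_mul]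
  ring

theorem Dm_const_mul (hT : 0 < T) (hf : SC T f) (a : ℝ) (d : Option (Fin 3)) :
    ∀ t ∈ timeI T, ∀ x, NSM.Dm T d (fun t x => a * f t x) t x = a * NSM.Dm T d f t x := by
  intro t ht x
  unfold NSM.Dm
  have := fderivWithin_const_mul (uniqueDiffOn_dom hT (t, x) ⟨ht, mem_univ _⟩)
    (hf.differentiableWithinAt ht x) a
  rw [this]; rfl

theorem smooth_Dm (hT : 0 < T) (hf : ContDiffOn ℝ ∞ (fun q : ℝ × V3 => f q.1 q.2) (dom T))
    (d : Option (Fin 3)) :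
    ContDiffOn ℝ ∞ (fun q : ℝ × V3 => NSM.Dm T d f q.1 q.2) (dom T) :=
  (hf.fderivWithin (uniqueDiffOn_dom hT) (by simp) :
    ContDiffOn ℝ ∞ (fderivWithin ℝ (fun q : ℝ × V3 => f q.1 q.2) (dom T)) (dom T)).clm_apply
      contDiffOn_const

theorem smooth_word (hT : 0 < T) (l : List (Option (Fin 3)))
    (hf : ContDiffOn ℝ ∞ (fun q : ℝ × V3 => f q.1 q.2) (dom T)) :
    ContDiffOn ℝ ∞ (fun q : ℝ × V3 => word T l f q.1 q.2) (dom T) := by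
  induction l generalizing f with
  | nil => exact hf
  | cons d l ih => exact ih (smooth_Dm hT hf d)

theorem continuous_of_smooth (hf : ContDiffOn ℝ ∞ (fun q : ℝ × V3 => f q.1 q.2) (dom T)) {t : ℝ}
    (ht : t ∈ timeI T) : Continuous (f t) := by
  rw [← continuousOn_univ]
  exact hf.continuousOn.comp (f := fun y : V3 => (t, y)) (by fun_prop) fun y _ => ⟨ht, mem_univ _⟩

theorem word_add (hT : 0 < T) (l : List (Option (Fin 3)))
    (hf : ContDiffOn ℝ ∞ (fun q : ℝ × V3 => f q.1 q.2) (dom T))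
    (hg : ContDiffOn ℝ ∞ (fun q : ℝ × V3 => g q.1 q.2) (dom T)) :
    ∀ t ∈ timeI T, ∀ x, word T l (fun t x => f t x + g t x) t x = word T l f t x + word T l g t x := by
  induction l generalizing f g with
  | nil => exact fun t _ x => rfl
  | cons d l ih =>
    intro t ht x
    change word T l (NSM.Dm T d _) t x = _
    rw [word_congr (Dm_add_of_smooth hT hf hg d) l t ht x]
    exact ih (smooth_Dm hT hf d) (smooth_Dm hT hg d) t ht x

theorem eLpNorm_word_add_le (hT : 0 < T) (l : List (Option (Fin 3)))
    (hf : ContDiffOn ℝ ∞ (fun q : ℝ × V3 => f q.1 q.2) (dom T))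
    (hg : ContDiffOn ℝ ∞ (fun q : ℝ × V3 => g q.1 q.2) (dom T)) {τ : ℝ} (hτ : τ ∈ timeI T) :
    eLpNorm (word T l (fun t x => f t x + g t x) τ) 2 volume ≤
      eLpNorm (word T l f τ) 2 volume + eLpNorm (word T l g τ) 2 volume := by
  rw [show word T l _ τ = word T l f τ + word T l g τ from
    funext fun x => word_add hT l hf hg τ hτ x]
  exact eLpNorm_add_le (continuous_of_smooth (smooth_word hT l hf) hτ).aestronglyMeasurable
    (continuous_of_smooth (smooth_word hT l hg) hτ).aestronglyMeasurable (by norm_num)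

theorem SC.add (hT : 0 < T) (hf : SC T f) (hg : SC T g) : SC T fun t x => f t x + g t x where
  smooth := hf.smooth.add hg.smooth
  bdd l t ht := by
    obtain ⟨M, hM⟩ := hf.bdd l t ht
    obtain ⟨N, hN⟩ := hg.bdd l t ht
    refine ⟨M + N, fun τ hτ => ?_⟩
    refine (eLpNorm_word_add_le hT l hf.smooth hg.smooth (mem_timeI_of_le ht hτ)).trans ?_
    push_cast
    exact add_le_add (hM τ hτ) (hN τ hτ)

theorem word_const_mul (hT : 0 < T) (l : List (Option (Fin 3))) (hf : SC T f) (a : ℝ) :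
    ∀ t ∈ timeI T, ∀ x, NSM.word T l (fun t x => a * f t x) t x = a * NSM.word T l f t x := by
  induction l generalizing f with
  | nil => exact fun t _ x => rfl
  | cons d l ih =>
    intro t ht x
    change NSM.word T l (NSM.Dm T d _) t x = _
    rw [word_congr (Dm_const_mul hT hf a d) l t ht x]
    exact ih (hf.Dm hT d) t ht x

theorem SC.const_mul (hT : 0 < T) (hf : SC T f) (a : ℝ) : SC T fun t x => a * f t x where
  smooth := contDiffOn_const.mul hf.smooth
  bdd l t ht := by
    obtain ⟨M, hM⟩ := hf.bdd l t ht
    refine ⟨‖a‖₊ * M, fun τ hτ => ?_⟩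
    have hτ' := mem_timeI_of_le ht hτ
    rw [show NSM.word T l _ τ = a • NSM.word T l f τ from
      funext fun x => word_const_mul hT l hf a τ hτ' x, eLpNorm_const_smul]
    push_cast
    exact mul_le_mul' le_rfl (hM τ hτ)

theorem SC.neg (hT : 0 < T) (hf : SC T f) : SC T fun t x => - f t x :=
  (hf.const_mul hT (-1)).congr fun t _ x => by ring

theorem SC.sub (hT : 0 < T) (hf : SC T f) (hg : SC T g) : SC T fun t x => f t x - g t x :=
  (hf.add hT (hg.neg hT)).congr fun t _ x => by ring

theorem Dm_neg (hT : 0 < T) (hf : SC T f) (d : Option (Fin 3)) :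
    ∀ t ∈ timeI T, ∀ x, NSM.Dm T d (fun t x => - f t x) t x = - NSM.Dm T d f t x := by
  intro t ht x
  rw [Dm_congr (g := fun t x => (-1) * f t x) (fun t _ x => by ring) d t ht x,
    Dm_const_mul hT hf (-1) d t ht x]
  ring

theorem Dm_sub (hT : 0 < T) (hf : SC T f) (hg : SC T g) (d : Option (Fin 3)) :
    ∀ t ∈ timeI T, ∀ x, NSM.Dm T d (fun t x => f t x - g t x) t x =
      NSM.Dm T d f t x - NSM.Dm T d g t x := by
  intro t ht x
  rw [Dm_congr (g := fun t x => f t x + - g t x) (fun t _ x => by ring) d t ht x,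
    Dm_add hT hf (hg.neg hT) d t ht x, Dm_neg hT hg d t ht x]
  ring

theorem Dm_comm (hT : 0 < T) (hf : SC T f) (d e : Option (Fin 3)) :
    ∀ t ∈ timeI T, ∀ x, NSM.Dm T d (NSM.Dm T e f) t x = NSM.Dm T e (NSM.Dm T d f) t x := by
  intro t ht x
  have hmem : (t, x) ∈ dom T := ⟨ht, mem_univ _⟩
  have hsymm : IsSymmSndFDerivWithinAt ℝ (fun q : ℝ × V3 => f q.1 q.2) (dom T) (t, x) :=
    (hf.smooth _ hmem).isSymmSndFDerivWithinAt
      (by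
        rw [minSmoothness_of_isRCLikeNormedField]
        exact WithTop.coe_le_coe.2 (le_top : (2 : ℕ∞) ≤ ⊤))
      (uniqueDiffOn_dom hT) (dom_subset_closure_interior hT hmem) hmem
  have hd : DifferentiableWithinAt ℝ (fderivWithin ℝ (fun q : ℝ × V3 => f q.1 q.2) (dom T))
      (dom T) (t, x) := (hf.contDiffOn_fderivWithin hT).differentiableOn (by simp) _ hmem
  have key : ∀ d e : Option (Fin 3), NSM.Dm T d (NSM.Dm T e f) t x =
      fderivWithin ℝ (fderivWithin ℝ (fun q : ℝ × V3 => f q.1 q.2) (dom T)) (dom T) (t, x)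
        (dirv d) (dirv e) := by
    intro d e
    have := (hd.hasFDerivWithinAt.clm_apply
      (hasFDerivWithinAt_const (dirv e) (t, x) (dom T))).fderivWithin
      (uniqueDiffOn_dom hT _ hmem)
    unfold NSM.Dm
    refine (congrArg (fun A => A (dirv d)) this).trans ?_
    simp
  rw [key, key]
  exact hsymm _ _

/-- Each coordinate direction has norm at most one, so an iterated partial derivative is dominated
by the full derivative of the same order. This transfers the L² bounds of `SmoothField` to `SC`. -/
theorem abs_word_le (hT : 0 < T) (l : List (Option (Fin 3)))
    (hf : ContDiffOn ℝ ∞ (fun q : ℝ × V3 => f q.1 q.2) (dom T)) :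
    ∀ t ∈ timeI T, ∀ x, |word T l f t x| ≤
      ‖iteratedFDerivWithin ℝ l.length (fun q : ℝ × V3 => f q.1 q.2) (dom T) (t, x)‖ := by
  induction l generalizing f with
  | nil => intro t ht x; simp [NSM.word]
  | cons d l ih =>
    intro t ht x
    have hmem : (t, x) ∈ dom T := ⟨ht, mem_univ _⟩
    have h1 : ContDiffOn ℝ ∞ (fderivWithin ℝ (fun q : ℝ × V3 => f q.1 q.2) (dom T)) (dom T) :=
      hf.fderivWithin (uniqueDiffOn_dom hT) (by simp)
    refine (ih (f := NSM.Dm T d f) (h1.clm_apply contDiffOn_const) t ht x).trans ?_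
    rw [List.length_cons, ← norm_iteratedFDerivWithin_fderivWithin (uniqueDiffOn_dom hT) hmem]
    have := (ContinuousLinearMap.apply ℝ ℝ (dirv d)).norm_iteratedFDerivWithin_comp_left
      (N := ∞) (h1 _ hmem) (uniqueDiffOn_dom hT) hmem (n := l.length) (by exact_mod_cast le_top)
    refine this.trans ?_
    have hn : ‖ContinuousLinearMap.apply ℝ ℝ (dirv d)‖ ≤ 1 := by
      refine ContinuousLinearMap.opNorm_le_bound _ zero_le_one fun A => ?_
      rw [one_mul]
      refine (A.le_opNorm _).trans ?_
      exact mul_le_of_le_one_right (norm_nonneg _) (norm_dirv_le d)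
    exact mul_le_of_le_one_left (norm_nonneg _) hn

theorem SmoothField.SC {F : ℝ → V3 → V3} (hT : 0 < T) (hF : SmoothField T F) (i : Fin 3) :
    SC T fun t x => F t x i := by
  have hs : ContDiffOn ℝ ∞ (fun q : ℝ × V3 => F q.1 q.2 i) (dom T) :=
    (EuclideanSpace.proj i : V3 →L[ℝ] ℝ).contDiff.comp_contDiffOn hF.1
  refine ⟨hs, fun l t ht => ?_⟩
  obtain ⟨M, hM⟩ := hF.2 l.length t ht
  refine ⟨M, fun τ hτ => le_trans ?_ (hM τ hτ)⟩
  refine eLpNorm_mono_real fun x => ?_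
  have hτ' := mem_timeI_of_le ht hτ
  have hmem : (τ, x) ∈ dom T := ⟨hτ', mem_univ _⟩
  refine (abs_word_le hT l hs τ hτ' x).trans ?_
  have := (EuclideanSpace.proj i : V3 →L[ℝ] ℝ).norm_iteratedFDerivWithin_comp_left
      (N := ∞) (hF.1 _ hmem) (uniqueDiffOn_dom hT) hmem (n := l.length) (by exact_mod_cast le_top)
  refine this.trans (mul_le_of_le_one_left (norm_nonneg _) ?_)
  refine ContinuousLinearMap.opNorm_le_bound _ zero_le_one fun v => ?_
  rw [one_mul]
  exact PiLp.norm_apply_le v i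

end NSM
end


noncomputable section

namespace NSM

variable {T : ℝ≥0∞} {f g : ℝ → V3 → ℝ}

/-! ### Supremum bounds and products -/

theorem ft_Dm (hT : 0 < T) (hf : SC T f) {t : ℝ} (ht : t ∈ timeI T) (i : Fin 3) :
    ft (NSM.Dm T (some i) f t) =ᵐ[volume]
      fun ξ => (2 * Real.pi * Complex.I * (ξ i : ℝ)) * ft (f t) ξ := by
  rw [show NSM.Dm T (some i) f t = _ from funext fun x => Dm_some hf i ht x]
  filter_upwards [ft_deriv (hf.differentiable ht) (hf.memLp ht) (hf.memLp_fderiv hT ht i)] with ξ h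
  rw [h]
  simp [EuclideanSpace.inner_single_right]

/-- Cauchy–Schwarz with the weight w = 1 + |2πξ|²: its inverse is square integrable on ℝ³, and w
times the transform is the transform of f - Δf. With Fourier inversion this is the embedding H² ⊂
L^∞. -/
theorem lintegral_ft_le : ∃ K : ℝ≥0, ∀ {T : ℝ≥0∞} {f : ℝ → V3 → ℝ}, 0 < T → SC T f →
    ∀ t ∈ timeI T, ∫⁻ ξ, ‖ft (f t) ξ‖ₑ ≤ K * (eLpNorm (f t) 2 volume +
      ∑ i, eLpNorm (NSM.Dm T (some i) (NSM.Dm T (some i) f) t) 2 volume) := by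
  set w : V3 → ℝ := fun ξ => 1 + (2 * Real.pi * ‖ξ‖) ^ 2 with hw
  have hwpos : ∀ ξ, 0 < w ξ := fun ξ => by positivity
  have hfin : ∫⁻ ξ, ENNReal.ofReal ((w ξ)⁻¹) ^ 2 < ⊤ := by
    -- w⁻² is compared with 4(1 + |ξ|)⁻⁴, integrable because 4 > 3.
    have h1 : Integrable (fun ξ : V3 => (1 + ‖ξ‖) ^ (-(4 : ℝ))) volume :=
      integrable_one_add_norm (by simp; norm_num)
    have h2 : Integrable (fun ξ : V3 => 4 * (1 + ‖ξ‖) ^ (-(4 : ℝ))) volume := h1.const_mul 4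
    refine lt_of_le_of_lt (lintegral_mono fun ξ => ?_) h2.lintegral_lt_top
    rw [← ENNReal.ofReal_pow (by have := hwpos ξ; positivity)]
    refine ENNReal.ofReal_le_ofReal ?_
    have hn := norm_nonneg ξ
    rw [Real.rpow_neg (by positivity), show (4 : ℝ) = ((4 : ℕ) : ℝ) by norm_num, Real.rpow_natCast,
      inv_pow]
    have h3 : (1 + ‖ξ‖) ^ 2 ≤ 2 * w ξ := by
      simp only [hw]
      have := Real.pi_gt_three
      have : 9 ≤ Real.pi ^ 2 := by nlinarith
      nlinarith [sq_nonneg (1 - ‖ξ‖), sq_nonneg ‖ξ‖, mul_nonneg (sq_nonneg ‖ξ‖) (sub_nonneg.2 this)]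
    have h4 : (1 + ‖ξ‖) ^ 4 ≤ 4 * w ξ ^ 2 := by
      have : ((1 + ‖ξ‖) ^ 2) ^ 2 ≤ (2 * w ξ) ^ 2 := by gcongr
      nlinarith
    have hw2 : 0 < w ξ ^ 2 := pow_pos (hwpos ξ) 2
    rw [← div_eq_mul_inv, inv_eq_one_div, div_le_div_iff₀ hw2 (by positivity)]
    push_cast
    linarith
  set K := (∫⁻ ξ, ENNReal.ofReal ((w ξ)⁻¹) ^ 2) ^ (1 / 2 : ℝ) with hK
  have hKfin : K ≠ ⊤ := ENNReal.rpow_ne_top_of_nonneg (by norm_num) hfin.ne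
  refine ⟨K.toNNReal, fun {T f} hT hf t ht => ?_⟩
  rw [ENNReal.coe_toNNReal hKfin]
  have hm : Measurable (w) := by simp only [hw]; fun_prop
  have hft := measurable_ft (f t)
  have hD := fun i => (hf.Dm hT (some i)).Dm hT (some i)
  have e : ∀ᵐ ξ, ENNReal.ofReal (w ξ) * ‖ft (f t) ξ‖ₑ ≤ ‖ft (f t) ξ‖ₑ +
      ∑ i, ‖ft (NSM.Dm T (some i) (NSM.Dm T (some i) f) t) ξ‖ₑ := by
    have h1 := fun i => ft_Dm hT hf ht i
    have h2 := fun i => ft_Dm hT (hf.Dm hT (some i)) ht i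
    filter_upwards [ae_all_iff.2 h1, ae_all_iff.2 h2] with ξ e1 e2
    have e3 : ((w ξ : ℝ) : ℂ) * ft (f t) ξ = ft (f t) ξ -
        ∑ i, ft (NSM.Dm T (some i) (NSM.Dm T (some i) f) t) ξ := by
      have hn : ((‖ξ‖ ^ 2 : ℝ) : ℂ) = ∑ i, ((ξ i : ℝ) : ℂ) ^ 2 := by
        rw [EuclideanSpace.norm_sq_eq]; push_cast; simp [← Complex.ofReal_pow]
      have hwc : ((w ξ : ℝ) : ℂ) = 1 + (2 * Real.pi) ^ 2 * ∑ i, ((ξ i : ℝ) : ℂ) ^ 2 := by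
        rw [← hn]; simp only [hw]; push_cast; ring
      rw [hwc]
      simp only [e2, e1, Fin.sum_univ_three]
      linear_combination ((2 * Real.pi : ℂ) ^ 2 * ft (f t) ξ * (((ξ 0 : ℝ) : ℂ) ^ 2 +
        ((ξ 1 : ℝ) : ℂ) ^ 2 + ((ξ 2 : ℝ) : ℂ) ^ 2)) * Complex.I_sq
    have e4 : ENNReal.ofReal (w ξ) * ‖ft (f t) ξ‖ₑ = ‖((w ξ : ℝ) : ℂ) * ft (f t) ξ‖ₑ := by
      rw [enorm_mul, ← ofReal_norm (w ξ : ℂ), Complex.norm_real, Real.norm_of_nonneg (hwpos ξ).le]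
    rw [e4, e3]
    refine (enorm_sub_le).trans (add_le_add le_rfl (enorm_sum_le _ _))
  calc ∫⁻ ξ, ‖ft (f t) ξ‖ₑ = ∫⁻ ξ, ENNReal.ofReal ((w ξ)⁻¹) * (ENNReal.ofReal (w ξ) * ‖ft (f t) ξ‖ₑ) := by
        refine lintegral_congr fun ξ => ?_
        rw [← mul_assoc, ← ENNReal.ofReal_mul (by have := hwpos ξ; positivity),
          inv_mul_cancel₀ (hwpos ξ).ne']
        simp
    _ ≤ K * N2 (fun ξ => ENNReal.ofReal (w ξ) * ‖ft (f t) ξ‖ₑ) :=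
        lintegral_mul_le_sqrt_mul_sqrt (by fun_prop) (by fun_prop)
    _ ≤ K * (N2 (fun ξ => ‖ft (f t) ξ‖ₑ) +
          ∑ i, N2 fun ξ => ‖ft (NSM.Dm T (some i) (NSM.Dm T (some i) f) t) ξ‖ₑ) := by
        gcongr
        refine (N2_mono_ae e).trans ((N2_add_le (by fun_prop) ?_).trans ?_)
        · exact Finset.measurable_sum _ fun i _ => (measurable_ft _).enorm
        · exact add_le_add le_rfl (N2_sum_le _ fun i => (measurable_ft _).enorm)
    _ = _ := by
        simp only [← eLpNorm_two_eq_N2]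
        rw [eLpNorm_ft (hf.memLp ht)]
        congr 2
        refine Finset.sum_congr rfl fun i _ => ?_
        rw [eLpNorm_ft ((hD i).memLp ht)]

theorem SC.exists_sup_bound (hT : 0 < T) (hf : SC T f) {t : ℝ} (ht : t ∈ timeI T) :
    ∃ M : ℝ≥0, ∀ τ ∈ Icc 0 t, ∀ᵐ x, ‖f τ x‖ₑ ≤ M := by
  obtain ⟨K, hK⟩ := lintegral_ft_le
  obtain ⟨M, hM⟩ := hf.exists_bound ht
  choose N hN using fun i => ((hf.Dm hT (some i)).Dm hT (some i)).exists_bound ht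
  refine ⟨K * (M + ∑ i, N i), fun τ hτ => ?_⟩
  have hτ' := mem_timeI_of_le ht hτ
  filter_upwards [ae_enorm_le_lintegral_ft (hf.memLp hτ')] with x hx
  refine hx.trans ((hK hT hf τ hτ').trans ?_)
  push_cast
  gcongr with i
  · exact hM τ hτ
  · exact hN i τ hτ

/-- Induction on the number of derivatives by Leibniz' rule, for all pairs f, g at once since a
derivative may fall on either factor. The base case is L^∞ · L² ⊂ L². -/
theorem SC.mul (hT : 0 < T) (hf : SC T f) (hg : SC T g) : SC T fun t x => f t x * g t x := by
  refine ⟨hf.smooth.mul hg.smooth, fun l => ?_⟩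
  induction l generalizing f g with
  | nil =>
    intro t ht
    obtain ⟨M, hM⟩ := hf.exists_sup_bound hT ht
    obtain ⟨N, hN⟩ := hg.exists_bound ht
    refine ⟨M * N, fun τ hτ => ?_⟩
    have := eLpNorm_le_nnreal_smul_eLpNorm_of_ae_le_mul (μ := volume) (f := fun x => f τ x * g τ x)
      (g := g τ) (c := M) ?_ 2
    · refine this.trans ?_
      rw [ENNReal.smul_def, smul_eq_mul]
      push_cast
      exact mul_le_mul' le_rfl (hN τ hτ)
    · filter_upwards [hM τ hτ] with x hx
      rw [nnnorm_mul]
      gcongr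
      exact_mod_cast hx
  | cons d l ih =>
    intro t ht
    obtain ⟨M, hM⟩ := ih (hf.Dm hT d) hg t ht
    obtain ⟨N, hN⟩ := ih hf (hg.Dm hT d) t ht
    refine ⟨M + N, fun τ hτ => ?_⟩
    have hτ' := mem_timeI_of_le ht hτ
    have e : NSM.word T (d :: l) (fun t x => f t x * g t x) τ =
        NSM.word T l (fun t x => NSM.Dm T d f t x * g t x + f t x * NSM.Dm T d g t x) τ :=
      funext fun x => word_congr (Dm_mul hT hf hg d) l τ hτ' x
    rw [e]
    refine (eLpNorm_word_add_le hT l ((hf.Dm hT d).smooth.mul hg.smooth)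
      (hf.smooth.mul (hg.Dm hT d).smooth) hτ').trans ?_
    push_cast
    exact add_le_add (hM τ hτ) (hN τ hτ)

theorem SC.sum (hT : 0 < T) {ι : Type*} (s : Finset ι) {f : ι → ℝ → V3 → ℝ}
    (hs : s.Nonempty) (hf : ∀ i ∈ s, SC T (f i)) : SC T fun t x => ∑ i ∈ s, f i t x := by
  classical
  induction hs using Finset.Nonempty.cons_induction with
  | singleton a => simpa using hf a (by simp)
  | cons a s ha hs ih =>
    have := (hf a (by simp)).add hT (ih fun i hi => hf i (by simp [hi]))
    refine this.congr fun t _ x => ?_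
    rw [Finset.sum_cons]

/-! ### Differentiability in time, with values in `L²` -/

/-- The mean value inequality in L², from the pointwise fundamental theorem of calculus,
Cauchy–Schwarz in time, and Tonelli. No differentiability with values in L² is presupposed, since
that is what it will prove. -/
theorem eLpNorm_sub_le_of_hasDerivWithinAt {φ ψ : ℝ → V3 → ℝ} {a b : ℝ} (hab : a ≤ b)
    (hd : ∀ τ ∈ Icc a b, ∀ x, HasDerivWithinAt (fun τ => φ τ x) (ψ τ x) (Icc a b) τ)
    (hc : ContinuousOn (fun q : ℝ × V3 => ψ q.1 q.2) (Icc a b ×ˢ univ)) {M : ℝ≥0∞}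
    (hM : ∀ τ ∈ Icc a b, eLpNorm (ψ τ) 2 volume ≤ M) :
    eLpNorm (fun x => φ b x - φ a x) 2 volume ≤ ENNReal.ofReal (b - a) * M := by
  have hcx : ∀ x, ContinuousOn (fun τ => ψ τ x) (Icc a b) := fun x =>
    hc.comp (f := fun τ : ℝ => (τ, x)) (by fun_prop) fun τ hτ => ⟨hτ, mem_univ _⟩
  have h1 : ∀ x, ‖φ b x - φ a x‖ₑ ≤ ∫⁻ τ in Icc a b, ‖ψ τ x‖ₑ := by
    intro x
    have hftc := intervalIntegral.integral_eq_sub_of_hasDerivAt_of_le hab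
      (fun τ hτ => (hd τ hτ x).continuousWithinAt)
      (fun τ hτ => (hd τ (Ioo_subset_Icc_self hτ) x).hasDerivAt (Icc_mem_nhds hτ.1 hτ.2))
      ((hcx x).intervalIntegrable_of_Icc hab)
    rw [← hftc, intervalIntegral.integral_of_le hab]
    refine (enorm_integral_le_lintegral_enorm _).trans ?_
    exact lintegral_mono_set Ioc_subset_Icc_self
  have hmeas : AEMeasurable (fun q : ℝ × V3 => ‖ψ q.1 q.2‖ₑ)
      ((volume.restrict (Icc a b)).prod volume) := by
    have := (hc.aemeasurable (measurableSet_Icc.prod MeasurableSet.univ) (μ := volume)).enorm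
    rwa [Measure.volume_eq_prod, ← Measure.prod_restrict, Measure.restrict_univ] at this
  have h2 : ∀ x, ‖φ b x - φ a x‖ₑ ^ 2 ≤ ENNReal.ofReal (b - a) * ∫⁻ τ in Icc a b, ‖ψ τ x‖ₑ ^ 2 := by
    intro x
    have hm : AEMeasurable (fun τ => ‖ψ τ x‖ₑ) (volume.restrict (Icc a b)) :=
      ((hcx x).aemeasurable measurableSet_Icc).enorm
    have := lintegral_mul_le_sqrt_mul_sqrt (μ := volume.restrict (Icc a b)) (f := fun _ => 1)
      aemeasurable_const hm
    simp only [one_mul, one_pow, lintegral_const, Measure.restrict_apply_univ, Real.volume_Icc] at this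
    have h3 := pow_le_pow_left' ((h1 x).trans this) 2
    refine h3.trans (le_of_eq ?_)
    rw [mul_pow]
    have r : ∀ a : ℝ≥0∞, (a ^ (1 / 2 : ℝ)) ^ 2 = a := fun a => by
      rw [← ENNReal.rpow_natCast, ← ENNReal.rpow_mul]; norm_num
    rw [r, r]
  have hM2 : ∀ τ ∈ Icc a b, ∫⁻ x, ‖ψ τ x‖ₑ ^ 2 ≤ M ^ 2 := by
    intro τ hτ
    have := pow_le_pow_left' (hM τ hτ) 2
    rwa [eLpNorm_two_eq_N2, N2_sq] at this
  rw [eLpNorm_two_eq_N2]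
  refine (ENNReal.pow_le_pow_left_iff two_ne_zero).1 ?_
  rw [N2_sq]
  calc _ ≤ ∫⁻ x, ENNReal.ofReal (b - a) * ∫⁻ τ in Icc a b, ‖ψ τ x‖ₑ ^ 2 := lintegral_mono h2
    _ = ENNReal.ofReal (b - a) * ∫⁻ x, ∫⁻ τ in Icc a b, ‖ψ τ x‖ₑ ^ 2 :=
        lintegral_const_mul' _ _ ENNReal.ofReal_ne_top
    _ = ENNReal.ofReal (b - a) * ∫⁻ τ in Icc a b, ∫⁻ x, ‖ψ τ x‖ₑ ^ 2 := by
        rw [lintegral_lintegral_swap]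
        exact ((hmeas.pow_const 2).prod_swap)
    _ ≤ ENNReal.ofReal (b - a) * ∫⁻ τ in Icc a b, M ^ 2 := by
        refine mul_le_mul' le_rfl ?_
        exact setLIntegral_mono measurable_const hM2
    _ = _ := by
        rw [lintegral_const, Measure.restrict_apply_univ, Real.volume_Icc]; ring

theorem SC.eLpNorm_sub_le (hf : SC T f) {a b : ℝ} (hab : a ≤ b) (ha : 0 ≤ a)
    (hb : b ∈ timeI T) (hT : 0 < T) {M : ℝ≥0∞}
    (hM : ∀ τ ∈ Icc a b, eLpNorm (NSM.Dm T none f τ) 2 volume ≤ M) :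
    eLpNorm (fun x => f b x - f a x) 2 volume ≤ ENNReal.ofReal (b - a) * M := by
  have hsub : Icc a b ⊆ timeI T := fun τ hτ => mem_timeI_of_le hb ⟨ha.trans hτ.1, hτ.2⟩
  exact eLpNorm_sub_le_of_hasDerivWithinAt hab
    (fun τ hτ x => (hasDerivWithinAt_Dm hf (hsub hτ) x).mono hsub)
    ((hf.Dm hT none).smooth.continuousOn.mono (prod_mono hsub le_rfl)) hM

/-- Two applications of the mean value inequality. The base point s is free in [a,b] so that both
increments to the right and to the left of a given time are covered. -/
theorem SC.eLpNorm_taylor_le (hf : SC T f) {a b s : ℝ} (hab : a ≤ b) (ha : 0 ≤ a)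
    (hb : b ∈ timeI T) (hT : 0 < T) (hs : s ∈ Icc a b) {M : ℝ≥0}
    (hM : ∀ τ ∈ Icc a b, eLpNorm (NSM.Dm T none (NSM.Dm T none f) τ) 2 volume ≤ M) :
    eLpNorm (fun x => f b x - f a x - (b - a) * NSM.Dm T none f s x) 2 volume ≤
      ENNReal.ofReal ((b - a) * ((b - a) * M)) := by
  have hsub : Icc a b ⊆ timeI T := fun τ hτ => mem_timeI_of_le hb ⟨ha.trans hτ.1, hτ.2⟩
  have hg := hf.Dm hT none
  have h1 : ∀ τ ∈ Icc a b, eLpNorm (fun x => NSM.Dm T none f τ x - NSM.Dm T none f s x) 2 volume ≤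
      ENNReal.ofReal ((b - a) * M) := by
    intro τ hτ
    have hle : ∀ p q : ℝ, p ∈ Icc a b → q ∈ Icc a b → p ≤ q →
        eLpNorm (fun x => NSM.Dm T none f q x - NSM.Dm T none f p x) 2 volume ≤
          ENNReal.ofReal ((b - a) * M) := by
      intro p q hp hq hpq
      refine (hg.eLpNorm_sub_le hpq (ha.trans hp.1) (hsub hq) hT
        fun r hr => hM r ⟨hp.1.trans hr.1, hr.2.trans hq.2⟩).trans ?_
      rw [ENNReal.ofReal_mul (by linarith), ENNReal.ofReal_coe_nnreal]
      gcongr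
      · exact hq.2
      · exact hp.1
    rcases le_total τ s with h | h
    · have := hle τ s hτ hs h
      rw [show (fun x => NSM.Dm T none f s x - NSM.Dm T none f τ x) =
        -fun x => NSM.Dm T none f τ x - NSM.Dm T none f s x from funext fun x => by simp,
        eLpNorm_neg] at this
      exact this
    · exact hle s τ hs hτ h
  have h2 := eLpNorm_sub_le_of_hasDerivWithinAt (φ := fun τ x => f τ x - τ * NSM.Dm T none f s x)
    (ψ := fun τ x => NSM.Dm T none f τ x - NSM.Dm T none f s x) hab ?_ ?_ h1
  · rw [ENNReal.ofReal_mul (by linarith)]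
    refine le_trans (le_of_eq ?_) h2
    congr 1
    ext x; ring
  · intro τ hτ x
    have h3 := (hasDerivWithinAt_Dm hf (hsub hτ) x).mono hsub
    have h4 := ((hasDerivAt_id τ).mul_const (NSM.Dm T none f s x)).hasDerivWithinAt (s := Icc a b)
    have h5 := h3.sub h4
    rw [one_mul] at h5
    exact h5
  · refine (hg.smooth.continuousOn.mono (prod_mono hsub le_rfl)).sub ?_
    exact ((hg.continuous (hsub hs)).comp continuous_snd).continuousOn

/-- The second time derivative is bounded in L² up to some t' > t, so the Taylor remainder is O((τ -
t)²) in L². -/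
theorem SC.hasDerivWithinAt_toL2 (hT : 0 < T) (hf : SC T f) {t : ℝ} (ht : t ∈ timeI T) :
    HasDerivWithinAt (fun τ => toL2 (f τ)) (toL2 (NSM.Dm T none f t)) (timeI T) t := by
  obtain ⟨t', ht', htt'⟩ := exists_Icc_subset_timeI ht
  obtain ⟨M, hM⟩ := ((hf.Dm hT none).Dm hT none).exists_bound ht'
  have hg := (hf.Dm hT none).memLp ht
  rw [hasDerivWithinAt_iff_isLittleO]
  have hO : (fun τ => toL2 (f τ) - toL2 (f t) - (τ - t) • toL2 (NSM.Dm T none f t)) =O[nhdsWithin t (timeI T)]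
      fun τ => (τ - t) * (τ - t) := by
    refine Asymptotics.IsBigO.of_bound M ?_
    have h1 : ∀ᶠ τ in nhdsWithin t (timeI T), τ < t' :=
      mem_nhdsWithin_of_mem_nhds (Iio_mem_nhds htt')
    filter_upwards [h1, self_mem_nhdsWithin] with τ hτ hτI
    have hfτ := hf.memLp hτI
    have hft := hf.memLp ht
    have e : toL2 (f τ) - toL2 (f t) - (τ - t) • toL2 (NSM.Dm T none f t) =
        toL2 fun x => f τ x - f t x - (τ - t) * NSM.Dm T none f t x := by
      rw [toL2_sub (f := fun x => f τ x - f t x) (hfτ.sub hft) (hg.const_mul _), toL2_sub hfτ hft,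
        toL2_const_mul hg]
      congr 1
    have hmem : MemLp (fun x => f τ x - f t x - (τ - t) * NSM.Dm T none f t x) 2 volume :=
      (hfτ.sub hft).sub (hg.const_mul _)
    have key : eLpNorm (fun x => f τ x - f t x - (τ - t) * NSM.Dm T none f t x) 2 volume ≤
        ENNReal.ofReal (M * ((τ - t) * (τ - t))) := by
      rcases le_total t τ with h | h
      · refine (hf.eLpNorm_taylor_le h ht.1 hτI hT ⟨le_rfl, h⟩ fun r hr =>
          hM r ⟨ht.1.trans hr.1, hr.2.trans hτ.le⟩).trans (le_of_eq ?_)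
        congr 1; ring
      · have := hf.eLpNorm_taylor_le h hτI.1 ht hT ⟨h, le_rfl⟩ fun r hr =>
          hM r ⟨hτI.1.trans hr.1, hr.2.trans htt'.le⟩
        rw [← eLpNorm_neg] at this
        refine le_trans (le_of_eq ?_) (this.trans (le_of_eq ?_))
        · congr 1; ext x; simp only [Pi.neg_apply]; ring
        · congr 1; ring
    rw [e, ← toReal_enorm, norm_toL2 hmem]
    refine (ENNReal.toReal_mono ENNReal.ofReal_ne_top key).trans (le_of_eq ?_)
    rw [ENNReal.toReal_ofReal (by have := mul_self_nonneg (τ - t); positivity),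
      Real.norm_of_nonneg (mul_self_nonneg _)]
  refine hO.trans_isLittleO ?_
  have h0 : Filter.Tendsto (fun τ : ℝ => τ - t) (nhdsWithin t (timeI T)) (nhds 0) := by
    have : Filter.Tendsto (fun τ : ℝ => τ - t) (nhds t) (nhds (t - t)) := by
      exact (continuous_id.sub continuous_const).tendsto t
    rw [sub_self] at this
    exact this.mono_left nhdsWithin_le_nhds
  have := ((Asymptotics.isLittleO_one_iff ℝ).2 h0).mul_isBigO
    (Asymptotics.isBigO_refl (fun τ : ℝ => τ - t) (nhdsWithin t (timeI T)))
  simpa using this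

theorem SC.hasDerivWithinAt_ftL (hT : 0 < T) (hf : SC T f) {t : ℝ} (ht : t ∈ timeI T) :
    HasDerivWithinAt (fun τ => ftL (f τ)) (ftL (NSM.Dm T none f t)) (timeI T) t := by
  have h := ((Lp.fourierTransformₗᵢ V3 ℂ).toContinuousLinearEquiv.toContinuousLinearMap.restrictScalars
    ℝ).hasFDerivAt.comp_hasDerivWithinAt t (hf.hasDerivWithinAt_toL2 hT ht)
  exact h

end NSM
end


/-! ### The damped wave equation in homogeneous Sobolev spaces -/

noncomputable section

namespace NSM

/-! ### Bounded Fourier multipliers -/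

/-- Multiplication by a bounded function on `L²(ℝ³; ℂ)`. -/
def mulOp {a : V3 → ℂ} (ha : MemLp a ⊤ volume) :
    Lp ℂ 2 (volume : Measure V3) →L[ℂ] Lp ℂ 2 (volume : Measure V3) :=
  (ContinuousLinearMap.mul ℂ ℂ).holderL volume ⊤ 2 2 ha.toLp

theorem coeFn_mulOp {a : V3 → ℂ} (ha : MemLp a ⊤ volume) (g : Lp ℂ 2 (volume : Measure V3)) :
    mulOp ha g =ᵐ[volume] fun ξ => a ξ * g ξ := by
  have h1 : (mulOp ha g : V3 → ℂ) =ᵐ[volume]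
      fun ξ => ContinuousLinearMap.mul ℂ ℂ ((ha.toLp a : Lp ℂ ⊤ (volume : Measure V3)) ξ) (g ξ) :=
    (ContinuousLinearMap.mul ℂ ℂ).coeFn_holder (r := 2) (ha.toLp a) g
  filter_upwards [h1, ha.coeFn_toLp] with ξ h1 h2
  rw [h1, h2]; rfl

attribute [irreducible] mulOp

theorem enorm_mulOp {a : V3 → ℂ} (ha : MemLp a ⊤ volume) (g : Lp ℂ 2 (volume : Measure V3)) :
    ‖mulOp ha g‖ₑ = N2 fun ξ => ‖a ξ‖ₑ * ‖g ξ‖ₑ := by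
  rw [Lp.enorm_def, eLpNorm_two_eq_N2]
  refine N2_congr_ae ?_
  filter_upwards [coeFn_mulOp ha g] with ξ h
  rw [h, enorm_mul]

theorem inner_mulOp_real {a : V3 → ℝ} (ha : MemLp (fun ξ => (a ξ : ℂ)) ⊤ volume)
    (f g : Lp ℂ 2 (volume : Measure V3)) :
    inner ℂ (mulOp ha f) g = inner ℂ f (mulOp ha g) := by
  rw [L2.inner_def, L2.inner_def]
  refine integral_congr_ae ?_
  filter_upwards [coeFn_mulOp ha f, coeFn_mulOp ha g] with ξ h1 h2
  rw [h1, h2]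
  simp only [RCLike.inner_apply, map_mul, Complex.conj_ofReal]
  ring

/-! ### The damped wave energy estimate -/

/-- For x' = -cLz - σc²x - σg and z' = cLx, the terms in L cancel in the derivative of ‖x‖² + ‖z‖²
because L is symmetric. Young's inequality leaves half of the damping on the left and the source
with weight σ/c². -/
theorem damped_wave_energy {H : Type*} [NormedAddCommGroup H] [InnerProductSpace ℂ H]
    {L : H →L[ℂ] H} (hL : ∀ x y, inner ℂ (L x) y = inner ℂ x (L y)) {σ c : ℝ} (hσ : 0 < σ)
    (hc : 0 < c) {x z g : ℝ → H} {t : ℝ} (ht : 0 ≤ t)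
    (hx : ∀ τ ∈ Icc 0 t, HasDerivWithinAt x
      (-((c : ℂ) • L (z τ)) - ((σ * c ^ 2 : ℝ) : ℂ) • x τ - (σ : ℂ) • g τ) (Icc 0 t) τ)
    (hz : ∀ τ ∈ Icc 0 t, HasDerivWithinAt z ((c : ℂ) • L (x τ)) (Icc 0 t) τ)
    (hg : ContinuousOn g (Icc 0 t)) :
    ‖x t‖ₑ ^ 2 + ‖z t‖ₑ ^ 2 + ENNReal.ofReal (σ * c ^ 2) * ∫⁻ τ in Icc 0 t, ‖x τ‖ₑ ^ 2 ≤
      ‖x 0‖ₑ ^ 2 + ‖z 0‖ₑ ^ 2 + ENNReal.ofReal (σ / c ^ 2) * ∫⁻ τ in Icc 0 t, ‖g τ‖ₑ ^ 2 := by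
  have hxc : ContinuousOn x (Icc 0 t) := fun τ hτ => (hx τ hτ).continuousWithinAt
  have hzc : ContinuousOn z (Icc 0 t) := fun τ hτ => (hz τ hτ).continuousWithinAt
  set Y : ℝ → ℝ := fun τ => ‖x τ‖ ^ 2 + ‖z τ‖ ^ 2 with hY
  have hYc : ContinuousOn Y (Icc 0 t) := (hxc.norm.pow 2).add (hzc.norm.pow 2)
  have hI1 : IntegrableOn (fun τ => ‖x τ‖ ^ 2) (Icc 0 t) volume :=
    (hxc.norm.pow 2).integrableOn_Icc
  have hI2 : IntegrableOn (fun τ => ‖g τ‖ ^ 2) (Icc 0 t) volume :=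
    (hg.norm.pow 2).integrableOn_Icc
  let _ : InnerProductSpace ℝ H := InnerProductSpace.rclikeToReal ℂ H
  have hre : ∀ a b : H, inner ℝ a b = (inner ℂ a b).re := fun a b => rfl
  set x' : ℝ → H := fun τ =>
    -((c : ℂ) • L (z τ)) - ((σ * c ^ 2 : ℝ) : ℂ) • x τ - (σ : ℂ) • g τ with hx'
  have hder : ∀ τ ∈ Ioo 0 t, HasDerivWithinAt Y
      (2 * inner ℝ (x τ) (x' τ) + 2 * inner ℝ (z τ) ((c : ℂ) • L (x τ))) (Ioi τ) τ := by
    intro τ hτ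
    have h1 := ((hx τ (Ioo_subset_Icc_self hτ)).hasDerivAt (Icc_mem_nhds hτ.1 hτ.2)).norm_sq
    have h2 := ((hz τ (Ioo_subset_Icc_self hτ)).hasDerivAt (Icc_mem_nhds hτ.1 hτ.2)).norm_sq
    exact (h1.add h2).hasDerivWithinAt
  have hbound : ∀ τ ∈ Ioo 0 t,
      2 * inner ℝ (x τ) (x' τ) + 2 * inner ℝ (z τ) ((c : ℂ) • L (x τ)) ≤
        σ / c ^ 2 * ‖g τ‖ ^ 2 - σ * c ^ 2 * ‖x τ‖ ^ 2 := by
    intro τ _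
    have e1 : inner ℝ (x τ) (x' τ) = -(c * (inner ℂ (x τ) (L (z τ))).re) -
        σ * c ^ 2 * ‖x τ‖ ^ 2 - σ * (inner ℂ (x τ) (g τ)).re := by
      have hn : inner ℂ (x τ) (x τ) = ((‖x τ‖ ^ 2 : ℝ) : ℂ) := by
        rw [inner_self_eq_norm_sq_to_K]; push_cast; rfl
      rw [hre, hx']
      simp only [inner_sub_right, inner_neg_right, inner_smul_right, hn]
      simp only [Complex.sub_re, Complex.neg_re, Complex.re_ofReal_mul, ← Complex.ofReal_mul,
        Complex.ofReal_re]
    have e2 : inner ℝ (z τ) ((c : ℂ) • L (x τ)) = c * (inner ℂ (x τ) (L (z τ))).re := by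
      rw [hre, inner_smul_right, Complex.re_ofReal_mul, ← hL (z τ) (x τ),
        ← inner_conj_symm (L (z τ)) (x τ), Complex.conj_re]
    have e3 : -(inner ℂ (x τ) (g τ)).re ≤ ‖x τ‖ * ‖g τ‖ := by
      have := (abs_le.1 (Complex.abs_re_le_norm (inner ℂ (x τ) (g τ)))).1
      have h2 := norm_inner_le_norm (𝕜 := ℂ) (x τ) (g τ)
      linarith
    -- The weight c² is chosen so that exactly half of 2σc²‖x‖² is spent.
    have e4 : 2 * (‖x τ‖ * ‖g τ‖) ≤ c ^ 2 * ‖x τ‖ ^ 2 + ‖g τ‖ ^ 2 / c ^ 2 := by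
      have h3 := sq_nonneg (c * ‖x τ‖ - ‖g τ‖ / c)
      have : c * ‖x τ‖ * (‖g τ‖ / c) = ‖x τ‖ * ‖g τ‖ := by field_simp
      rw [div_eq_mul_inv, ← inv_pow]
      rw [div_eq_mul_inv] at h3 this
      nlinarith
    rw [e1, e2]
    have e5 : σ * (2 * (-(inner ℂ (x τ) (g τ)).re)) ≤ σ * (c ^ 2 * ‖x τ‖ ^ 2 + ‖g τ‖ ^ 2 / c ^ 2) :=
      mul_le_mul_of_nonneg_left (by linarith) hσ.le
    have e6 : σ / c ^ 2 * ‖g τ‖ ^ 2 = σ * (‖g τ‖ ^ 2 / c ^ 2) := by ring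
    rw [e6]
    nlinarith
  have hmain : Y t - Y 0 ≤ ∫ τ in (0 : ℝ)..t,
      (σ / c ^ 2 * ‖g τ‖ ^ 2 - σ * c ^ 2 * ‖x τ‖ ^ 2) :=
    intervalIntegral.sub_le_integral_of_hasDeriv_right_of_le ht hYc hder
    ((hI2.const_mul (σ / c ^ 2)).sub (hI1.const_mul (σ * c ^ 2))) hbound
  rw [intervalIntegral.integral_of_le ht, ← integral_Icc_eq_integral_Ioc,
    integral_sub (hI2.const_mul (σ / c ^ 2)) (hI1.const_mul (σ * c ^ 2)), integral_const_mul,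
    integral_const_mul] at hmain
  have conv1 : ∀ {w : ℝ → H}, IntegrableOn (fun τ => ‖w τ‖ ^ 2) (Icc 0 t) volume →
      ∫⁻ τ in Icc 0 t, ‖w τ‖ₑ ^ 2 = ENNReal.ofReal (∫ τ in Icc 0 t, ‖w τ‖ ^ 2) := by
    intro w hw
    rw [ofReal_integral_eq_lintegral_ofReal hw (Filter.Eventually.of_forall fun τ => by positivity)]
    refine lintegral_congr fun τ => ?_
    rw [← ofReal_norm, ENNReal.ofReal_pow (norm_nonneg _)]
  have conv2 : ∀ w : H, ‖w‖ₑ ^ 2 = ENNReal.ofReal (‖w‖ ^ 2) := fun w => by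
    rw [← ofReal_norm, ENNReal.ofReal_pow (norm_nonneg _)]
  have p1 : 0 ≤ ∫ τ in Icc 0 t, ‖x τ‖ ^ 2 := integral_nonneg fun _ => by positivity
  have p2 : 0 ≤ ∫ τ in Icc 0 t, ‖g τ‖ ^ 2 := integral_nonneg fun _ => by positivity
  rw [conv1 hI1, conv1 hI2, conv2, conv2, conv2, conv2, ← ENNReal.ofReal_mul (by positivity),
    ← ENNReal.ofReal_mul (by positivity), ← ENNReal.ofReal_add (by positivity) (by positivity),
    ← ENNReal.ofReal_add (by positivity) (by positivity),
    ← ENNReal.ofReal_add (by positivity) (by positivity),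
    ← ENNReal.ofReal_add (by positivity) (by positivity)]
  refine ENNReal.ofReal_le_ofReal ?_
  simp only [hY] at hmain
  linarith

/-! ### Homogeneous Sobolev norms of scalar functions -/

/-- The homogeneous Sobolev norm of a scalar square-integrable function. -/
def hs (s : ℝ) (f : V3 → ℝ) : ℝ≥0∞ := N2 fun ξ => wt s ξ * ‖ft f ξ‖ₑ

/-- The symbol of `|D|^s` truncated to frequencies at most `n`. -/
def cut (s : ℝ) (n : ℕ) (ξ : V3) : ℝ := if ‖ξ‖ ≤ n then (2 * Real.pi * ‖ξ‖) ^ s else 0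

theorem measurable_cut (s : ℝ) (n : ℕ) : Measurable (cut s n) := by
  unfold cut
  exact Measurable.ite (measurableSet_le (by fun_prop) (by fun_prop)) (by fun_prop) (by fun_prop)

theorem memLp_cut {s : ℝ} (hs : 0 ≤ s) (n : ℕ) :
    MemLp (fun ξ => (cut s n ξ : ℂ)) ⊤ volume := by
  refine memLp_top_of_bound (by have := measurable_cut s n; fun_prop) ((2 * Real.pi * n) ^ s)
    (Filter.Eventually.of_forall fun ξ => ?_)
  rw [Complex.norm_real, cut]
  split_ifs with h
  · rw [Real.norm_of_nonneg (by positivity)]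
    gcongr
  · simp; positivity

theorem enorm_cut {s : ℝ} (hs : 0 ≤ s) (n : ℕ) (ξ : V3) :
    ‖(cut s n ξ : ℂ)‖ₑ = if ‖ξ‖ ≤ n then wt s ξ else 0 := by
  rw [← ofReal_norm, Complex.norm_real, cut]
  split_ifs with h
  · rw [Real.norm_of_nonneg (by positivity), wt, ENNReal.ofReal_rpow_of_nonneg (by positivity) hs]
  · simp

theorem enorm_cut_le {s : ℝ} (hs : 0 ≤ s) (n : ℕ) (ξ : V3) : ‖(cut s n ξ : ℂ)‖ₑ ≤ wt s ξ := by
  rw [enorm_cut hs]; split_ifs <;> simp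

theorem iSup_N2_cut_mul {a : V3 → ℝ≥0∞} (ha : Measurable a) {s : ℝ} (hs : 0 ≤ s) :
    (⨆ n : ℕ, N2 (fun ξ => ‖(cut s n ξ : ℂ)‖ₑ * a ξ)) = N2 fun ξ => wt s ξ * a ξ := by
  have hmono : Monotone fun n : ℕ => fun ξ => (‖(cut s n ξ : ℂ)‖ₑ * a ξ) ^ 2 := by
    intro m n hmn ξ
    have hc' : (m : ℝ) ≤ n := by exact_mod_cast hmn
    refine pow_le_pow_left' (mul_le_mul' ?_ le_rfl) 2
    rw [enorm_cut hs, enorm_cut hs]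
    split_ifs with h1 h2
    · exact le_rfl
    · exact absurd (h1.trans hc') h2
    · exact zero_le
    · exact le_rfl
  have hm : ∀ n : ℕ, Measurable fun ξ => (‖(cut s n ξ : ℂ)‖ₑ * a ξ) ^ 2 := by
    intro n
    have := measurable_cut s n
    fun_prop
  have hsup : ∀ ξ, ⨆ n : ℕ, (‖(cut s n ξ : ℂ)‖ₑ * a ξ) ^ 2 = (wt s ξ * a ξ) ^ 2 := by
    intro ξ
    refine le_antisymm (iSup_le fun n => ?_) ?_
    · exact pow_le_pow_left' (mul_le_mul' (enorm_cut_le hs n ξ) le_rfl) 2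
    · obtain ⟨m, hm⟩ := exists_nat_ge ‖ξ‖
      refine le_trans (le_of_eq ?_) (le_iSup (fun n : ℕ => (‖(cut s n ξ : ℂ)‖ₑ * a ξ) ^ 2) m)
      rw [enorm_cut hs, if_pos hm]
  refine le_antisymm (iSup_le fun n => N2_mono_ae (Filter.Eventually.of_forall fun ξ =>
    mul_le_mul' (enorm_cut_le hs n ξ) le_rfl)) ?_
  rw [← ENNReal.pow_le_pow_left_iff two_ne_zero, N2_sq]
  simp_rw [← hsup]
  rw [lintegral_iSup hm hmono]
  refine iSup_le fun n => ?_
  rw [← N2_sq]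
  exact pow_le_pow_left' (le_iSup (fun n : ℕ => N2 fun ξ => ‖(cut s n ξ : ℂ)‖ₑ * a ξ) n) 2

/-- The truncated symbols are bounded operators on L². This makes the possibly infinite Ḣˢ norm a
supremum of functions continuous in time, hence measurable, and allows the energy estimate to be
done at finite n. -/
theorem hs_eq_iSup {s : ℝ} (h : 0 ≤ s) (f : V3 → ℝ) :
    hs s f = ⨆ n : ℕ, ‖mulOp (memLp_cut h n) (ftL f)‖ₑ := by
  simp only [enorm_mulOp]
  exact (iSup_N2_cut_mul (measurable_ft f).enorm h).symm

theorem monotone_enorm_cut {s : ℝ} (h : 0 ≤ s) (f : V3 → ℝ) :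
    Monotone fun n : ℕ => ‖mulOp (memLp_cut h n) (ftL f)‖ₑ := by
  intro m n hmn
  simp only [enorm_mulOp]
  have hc' : (m : ℝ) ≤ n := by exact_mod_cast hmn
  refine N2_mono_ae (Filter.Eventually.of_forall fun ξ => mul_le_mul' ?_ le_rfl)
  rw [enorm_cut h, enorm_cut h]
  split_ifs with h1 h2
  · exact le_rfl
  · exact absurd (h1.trans hc') h2
  · exact zero_le
  · exact le_rfl

variable {T : ℝ≥0∞}

theorem SC.continuousOn_ftL (hT : 0 < T) {f : ℝ → V3 → ℝ} (hf : SC T f) :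
    ContinuousOn (fun τ => ftL (f τ)) (timeI T) :=
  fun _ hτ => (hf.hasDerivWithinAt_ftL hT hτ).continuousWithinAt

theorem measurableSet_timeI (T : ℝ≥0∞) : MeasurableSet (timeI T) :=
  (convex_timeI T).ordConnected.measurableSet

theorem SC.aemeasurable_hs (hT : 0 < T) {f : ℝ → V3 → ℝ} (hf : SC T f) {s : ℝ} (h : 0 ≤ s) :
    AEMeasurable (fun τ => hs s (f τ)) (volume.restrict (timeI T)) := by
  simp only [hs_eq_iSup h]
  refine AEMeasurable.iSup fun n => ?_
  have : ContinuousOn (fun τ => ‖mulOp (memLp_cut h n) (ftL (f τ))‖ₑ) (timeI T) :=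
    ((mulOp (memLp_cut h n)).continuous.comp_continuousOn (hf.continuousOn_ftL hT)).enorm
  exact this.aemeasurable (measurableSet_timeI T)

theorem SC.hasDerivWithinAt_clm_ftL (hT : 0 < T) {f : ℝ → V3 → ℝ} (hf : SC T f)
    (A : Lp ℂ 2 (volume : Measure V3) →L[ℂ] Lp ℂ 2 (volume : Measure V3)) {t : ℝ}
    (ht : t ∈ timeI T) :
    HasDerivWithinAt (fun τ => A (ftL (f τ))) (A (ftL (NSM.Dm T none f t))) (timeI T) t :=
  (A.restrictScalars ℝ).hasFDerivAt.comp_hasDerivWithinAt t (hf.hasDerivWithinAt_ftL hT ht)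

theorem continuousOn_smul_combination {H : Type*} [NormedAddCommGroup H] [NormedSpace ℂ H]
    {a b d : ℝ → H} {S : Set ℝ} (ha : ContinuousOn a S) (hb : ContinuousOn b S)
    (hd : ContinuousOn d S) (k l m : ℂ) :
    ContinuousOn (fun τ => k • (-(l • a τ) - m • b τ - d τ)) S := by
  fun_prop

set_option maxHeartbeats 2000000 in
/-- The energy estimate for one component of the damped wave equation. -/
theorem damped_wave_hs (hT : 0 < T) {σ c : ℝ} (hσ : 0 < σ) (hc : 0 < c) {e φ : ℝ → V3 → ℝ}
    (he : SC T e) (hφ : SC T φ) (heφ : ∀ t ∈ timeI T, ∀ x, NSM.Dm T none e t x = c * φ t x)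
    {G : ℝ → V3 → ℂ}
    (heq : ∀ t ∈ timeI T, ∀ᵐ ξ, ft (NSM.Dm T none φ t) ξ =
      -(c * (2 * Real.pi * ‖ξ‖ : ℝ) ^ 2 * ft (e t) ξ) - (σ * c ^ 2) * ft (φ t) ξ - σ * G t ξ)
    {s : ℝ} (hs0 : 0 ≤ s) {t : ℝ} (ht : t ∈ timeI T) :
    hs s (φ t) ^ 2 + ENNReal.ofReal (σ * c ^ 2) * ∫⁻ τ in Icc 0 t, hs s (φ τ) ^ 2 ≤
      hs s (φ 0) ^ 2 + hs (s + 1) (e 0) ^ 2 +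
        ENNReal.ofReal (σ / c ^ 2) * ∫⁻ τ in Icc 0 t, (N2 fun ξ => wt s ξ * ‖G τ ξ‖ₑ) ^ 2 := by
  have hsub : Icc 0 t ⊆ timeI T := fun τ hτ => mem_timeI_of_le ht hτ
  have h1 : (0 : ℝ) ≤ 1 := zero_le_one
  set R := hs s (φ 0) ^ 2 + hs (s + 1) (e 0) ^ 2 +
        ENNReal.ofReal (σ / c ^ 2) * ∫⁻ τ in Icc 0 t, (N2 fun ξ => wt s ξ * ‖G τ ξ‖ₑ) ^ 2 with hR
  have key : ∀ n : ℕ, ‖mulOp (memLp_cut hs0 n) (ftL (φ t))‖ₑ ^ 2 + ENNReal.ofReal (σ * c ^ 2) *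
      ∫⁻ τ in Icc 0 t, ‖mulOp (memLp_cut hs0 n) (ftL (φ τ))‖ₑ ^ 2 ≤ R := by
    intro n
    set A := mulOp (memLp_cut hs0 n)
    set A1 := mulOp (memLp_cut h1 n)
    set x := fun τ => A (ftL (φ τ)) with hx
    -- With L the truncated |D|, the second-order equation for e becomes a first-order symmetric
    -- system for x = |D|ˢφ and z = |D|^{s+1}e.
    set z := fun τ => A (A1 (ftL (e τ))) with hz
    have comm : ∀ g, A (A1 g) = A1 (A g) := by
      intro g
      refine Lp.ext ?_
      filter_upwards [coeFn_mulOp (memLp_cut hs0 n) (A1 g), coeFn_mulOp (memLp_cut h1 n) g,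
        coeFn_mulOp (memLp_cut h1 n) (A g), coeFn_mulOp (memLp_cut hs0 n) g] with ξ q1 q2 q3 q4
      rw [q1, q2, q3, q4]; ring
    -- The source is defined by solving the equation for it, so its continuity in time is automatic
    -- and nothing is required of G; the equation is used only to bound g by G pointwise in
    -- frequency.
    set g := fun τ => (σ : ℂ)⁻¹ • (-((c : ℂ) • A1 (z τ)) - ((σ * c ^ 2 : ℝ) : ℂ) • x τ -
      A (ftL (NSM.Dm T none φ τ))) with hg
    have hσ' : (σ : ℂ) ≠ 0 := by exact_mod_cast hσ.ne'
    have hxc : ContinuousOn x (timeI T) := fun τ hτ =>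
      (hφ.hasDerivWithinAt_clm_ftL hT A hτ).continuousWithinAt
    have hzc : ContinuousOn z (timeI T) := fun τ hτ =>
      (he.hasDerivWithinAt_clm_ftL hT (A.comp A1) hτ).continuousWithinAt
    have hgc : ContinuousOn g (timeI T) :=
      continuousOn_smul_combination (A1.continuous.comp_continuousOn hzc) hxc
        (fun τ hτ => ((hφ.Dm hT none).hasDerivWithinAt_clm_ftL hT A hτ).continuousWithinAt) _ _ _
    have hxd : ∀ τ ∈ Icc 0 t, HasDerivWithinAt x
        (-((c : ℂ) • A1 (z τ)) - ((σ * c ^ 2 : ℝ) : ℂ) • x τ - (σ : ℂ) • g τ) (Icc 0 t) τ := by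
      intro τ hτ
      have := (hφ.hasDerivWithinAt_clm_ftL hT A (hsub hτ)).mono hsub
      have e1 : -((c : ℂ) • A1 (z τ)) - ((σ * c ^ 2 : ℝ) : ℂ) • x τ - (σ : ℂ) • g τ =
          A (ftL (NSM.Dm T none φ τ)) := by
        simp only [hg]
        rw [smul_inv_smul₀ hσ']; abel
      rw [e1]
      exact this
    have hzd : ∀ τ ∈ Icc 0 t, HasDerivWithinAt z ((c : ℂ) • A1 (x τ)) (Icc 0 t) τ := by
      intro τ hτ
      have := (he.hasDerivWithinAt_clm_ftL hT (A.comp A1) (hsub hτ)).mono hsub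
      have e1 : (c : ℂ) • A1 (x τ) = A (A1 (ftL (NSM.Dm T none e τ))) := by
        rw [show NSM.Dm T none e τ = fun x => c * φ τ x from funext (heφ τ (hsub hτ)),
          ftL_const_mul (hφ.memLp (hsub hτ)), map_smul, map_smul, comm]
      rw [e1]
      exact this
    have hen := damped_wave_energy (inner_mulOp_real (memLp_cut h1 n)) hσ hc ht.1 hxd hzd
      (hgc.mono hsub)
    have hx0 : ‖x 0‖ₑ ≤ hs s (φ 0) := by
      rw [hs_eq_iSup hs0]; exact le_iSup (fun n : ℕ => ‖mulOp (memLp_cut hs0 n) (ftL (φ 0))‖ₑ) n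
    have hz0 : ‖z 0‖ₑ ≤ hs (s + 1) (e 0) := by
      simp only [hz]
      rw [enorm_mulOp]
      refine N2_mono_ae ?_
      filter_upwards [coeFn_mulOp (memLp_cut h1 n) (ftL (e 0)), ae_ne_zero] with ξ q1 q2
      rw [q1, enorm_mul, wt_add q2, ← mul_assoc]
      gcongr
      · exact enorm_cut_le hs0 n ξ
      · exact enorm_cut_le h1 n ξ
      · exact le_rfl
    have hgle : ∀ τ ∈ Icc 0 t, ‖g τ‖ₑ ≤ N2 fun ξ => wt s ξ * ‖G τ ξ‖ₑ := by
      intro τ hτ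
      rw [Lp.enorm_def, eLpNorm_two_eq_N2]
      refine N2_mono_ae ?_
      have q0 : g τ =ᵐ[volume] fun ξ => (cut s n ξ : ℂ) * G τ ξ := by
        have q1 : g τ =ᵐ[volume] fun ξ => (σ : ℂ)⁻¹ * (-((c : ℂ) * A1 (z τ) ξ) -
            ((σ * c ^ 2 : ℝ) : ℂ) * x τ ξ - A (ftL (NSM.Dm T none φ τ)) ξ) := by
          filter_upwards [Lp.coeFn_smul (σ : ℂ)⁻¹ (-((c : ℂ) • A1 (z τ)) -
            ((σ * c ^ 2 : ℝ) : ℂ) • x τ - A (ftL (NSM.Dm T none φ τ))),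
            Lp.coeFn_sub (-((c : ℂ) • A1 (z τ)) - ((σ * c ^ 2 : ℝ) : ℂ) • x τ)
              (A (ftL (NSM.Dm T none φ τ))),
            Lp.coeFn_sub (-((c : ℂ) • A1 (z τ))) (((σ * c ^ 2 : ℝ) : ℂ) • x τ),
            Lp.coeFn_neg ((c : ℂ) • A1 (z τ)), Lp.coeFn_smul (c : ℂ) (A1 (z τ)),
            Lp.coeFn_smul ((σ * c ^ 2 : ℝ) : ℂ) (x τ)] with ξ r1 r2 r3 r4 r5 r6
          simp only [hg]
          rw [r1, Pi.smul_apply, r2, Pi.sub_apply, r3, Pi.sub_apply, r4, Pi.neg_apply, r5, r6]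
          rfl
        filter_upwards [q1, coeFn_mulOp (memLp_cut h1 n) (z τ),
          coeFn_mulOp (memLp_cut hs0 n) (A1 (ftL (e τ))),
          coeFn_mulOp (memLp_cut h1 n) (ftL (e τ)), coeFn_mulOp (memLp_cut hs0 n) (ftL (φ τ)),
          coeFn_mulOp (memLp_cut hs0 n) (ftL (NSM.Dm T none φ τ)), heq τ (hsub hτ)]
          with ξ r1 r2 r3 r4 r5 r6 r7
        rw [r1, r2, r3, r4, r5, r6]
        have r7' : ftL (NSM.Dm T none φ τ) ξ = -(c * (2 * Real.pi * ‖ξ‖ : ℝ) ^ 2 * ftL (e τ) ξ) -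
          (σ * c ^ 2) * ftL (φ τ) ξ - σ * G τ ξ := r7
        rw [r7']
        by_cases hn : ‖ξ‖ ≤ n
        · have hc1 : cut 1 n ξ = 2 * Real.pi * ‖ξ‖ := by simp [cut, hn]
          rw [hc1]
          field_simp
          push_cast
          ring
        · have hc0 : cut s n ξ = 0 := by simp [cut, hn]
          rw [hc0]; simp
      filter_upwards [q0] with ξ q
      rw [q, enorm_mul]
      exact mul_le_mul' (enorm_cut_le hs0 n ξ) le_rfl
    calc _ ≤ ‖x t‖ₑ ^ 2 + ‖z t‖ₑ ^ 2 + ENNReal.ofReal (σ * c ^ 2) * ∫⁻ τ in Icc 0 t, ‖x τ‖ₑ ^ 2 := by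
          gcongr
          exact le_self_add
      _ ≤ _ := hen
      _ ≤ R := by
          simp only [hR]
          gcongr ?_ ^ 2 + ?_ ^ 2 + _ * ?_
          exact setLIntegral_mono' measurableSet_Icc fun τ hτ => pow_le_pow_left' (hgle τ hτ) 2
  -- The bound R does not depend on n, so the truncation is removed by monotone convergence.
  have hlim1 : Filter.Tendsto (fun n : ℕ => ‖mulOp (memLp_cut hs0 n) (ftL (φ t))‖ₑ ^ 2)
      Filter.atTop (nhds (hs s (φ t) ^ 2)) := by
    rw [hs_eq_iSup hs0]
    exact ((ENNReal.continuous_pow 2).tendsto _).comp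
      (tendsto_atTop_iSup (monotone_enorm_cut hs0 (φ t)))
  have hlim2 : Filter.Tendsto (fun n : ℕ =>
      ∫⁻ τ in Icc 0 t, ‖mulOp (memLp_cut hs0 n) (ftL (φ τ))‖ₑ ^ 2)
      Filter.atTop (nhds (∫⁻ τ in Icc 0 t, hs s (φ τ) ^ 2)) := by
    refine lintegral_tendsto_of_tendsto_of_monotone (fun n => ?_) ?_ ?_
    · have : ContinuousOn (fun τ => ‖mulOp (memLp_cut hs0 n) (ftL (φ τ))‖ₑ) (Icc 0 t) :=
        ((mulOp (memLp_cut hs0 n)).continuous.comp_continuousOn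
          ((hφ.continuousOn_ftL hT).mono hsub)).enorm
      exact (this.aemeasurable measurableSet_Icc).pow_const 2
    · exact Filter.Eventually.of_forall fun τ m n hmn =>
        pow_le_pow_left' (monotone_enorm_cut hs0 (φ τ) hmn) 2
    · refine Filter.Eventually.of_forall fun τ => ?_
      rw [hs_eq_iSup hs0]
      exact ((ENNReal.continuous_pow 2).tendsto _).comp
        (tendsto_atTop_iSup (monotone_enorm_cut hs0 (φ τ)))
  exact le_of_tendsto' (hlim1.add (ENNReal.Tendsto.const_mul hlim2
    (Or.inr ENNReal.ofReal_ne_top))) key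

end NSM
end


/-! ### Axisymmetry as differential identities, and the cancellation in curl (F × B) -/

noncomputable section

namespace NSM

variable {T : ℝ≥0∞}

/-! ### The axisymmetric structure in Cartesian components -/

/-- Infinitesimal form of axisymmetry without swirl, in components. -/
structure NoSwirl (T : ℝ≥0∞) (F : Fin 3 → ℝ → V3 → ℝ) : Prop where
  tang : ∀ t ∈ timeI T, ∀ x : V3, x 0 * F 1 t x - x 1 * F 0 t x = 0
  equi0 : ∀ t ∈ timeI T, ∀ x : V3,
    x 0 * Dm T (some 1) (F 0) t x - x 1 * Dm T (some 0) (F 0) t x = - F 1 t x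
  equi1 : ∀ t ∈ timeI T, ∀ x : V3,
    x 0 * Dm T (some 1) (F 1) t x - x 1 * Dm T (some 0) (F 1) t x = F 0 t x
  equi2 : ∀ t ∈ timeI T, ∀ x : V3,
    x 0 * Dm T (some 1) (F 2) t x - x 1 * Dm T (some 0) (F 2) t x = 0

/-- Infinitesimal form of axisymmetry with pure swirl, in components. -/
structure PureSwirl (T : ℝ≥0∞) (B : Fin 3 → ℝ → V3 → ℝ) : Prop where
  rad : ∀ t ∈ timeI T, ∀ x : V3, x 0 * B 0 t x + x 1 * B 1 t x = 0
  vert : ∀ t ∈ timeI T, ∀ x : V3, B 2 t x = 0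
  equi0 : ∀ t ∈ timeI T, ∀ x : V3,
    x 0 * Dm T (some 1) (B 0) t x - x 1 * Dm T (some 0) (B 0) t x = - B 1 t x
  equi1 : ∀ t ∈ timeI T, ∀ x : V3,
    x 0 * Dm T (some 1) (B 1) t x - x 1 * Dm T (some 0) (B 1) t x = B 0 t x

/-- Each point of the axis is a limit of points off it, reached along the first coordinate
direction. This avoids any discussion of the frame at r = 0. -/
theorem eq_of_eq_off_axis {f g : V3 → ℝ} (hf : Continuous f) (hg : Continuous g)
    (h : ∀ x : V3, cylR x ≠ 0 → f x = g x) (x : V3) : f x = g x := by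
  by_cases hx : cylR x ≠ 0
  · exact h x hx
  rw [not_not, cylR, Real.sqrt_eq_zero (by positivity)] at hx
  have hx0 : x 0 = 0 := by nlinarith [sq_nonneg (x 0), sq_nonneg (x 1)]
  set γ : ℝ → V3 := fun ε => x + ε • EuclideanSpace.single 0 1 with hγ
  have hγc : Continuous γ := by fun_prop
  have key : ∀ ε ∈ ({0}ᶜ : Set ℝ), (f ∘ γ) ε = (g ∘ γ) ε := by
    intro ε hε
    refine h _ ?_
    have h0 : γ ε 0 = ε := by simp [hγ, hx0]
    rw [cylR, h0]
    refine (Real.sqrt_pos.2 ?_).ne'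
    have : ε ≠ 0 := hε
    positivity
  have := Continuous.ext_on (dense_compl_singleton (0 : ℝ)) (hf.comp hγc) (hg.comp hγc) key
  have h0 := congrFun this 0
  simpa [hγ] using h0

/-- The rotation of `x` by the angle `θ` about the vertical axis. -/
def rotZ (x : V3) (θ : ℝ) : V3 :=
  !₂[Real.cos θ * x 0 - Real.sin θ * x 1, Real.sin θ * x 0 + Real.cos θ * x 1, x 2]

theorem cylR_rotZ (x : V3) (θ : ℝ) : cylR (rotZ x θ) = cylR x := by
  unfold cylR rotZ
  congr 1
  simp
  nlinarith [Real.sin_sq_add_cos_sq θ]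

theorem hasDerivAt_rotZ (x : V3) : HasDerivAt (rotZ x)
    (x 0 • EuclideanSpace.single 1 1 - x 1 • EuclideanSpace.single 0 1 : V3) 0 := by
  have h1 : HasDerivAt (fun θ : ℝ => Real.cos θ * x 0 - Real.sin θ * x 1) (-x 1) 0 := by
    refine HasDerivAt.congr_deriv
      (((Real.hasDerivAt_cos 0).mul_const (x 0)).sub ((Real.hasDerivAt_sin 0).mul_const (x 1))) ?_
    simp
  have h2 : HasDerivAt (fun θ : ℝ => Real.sin θ * x 0 + Real.cos θ * x 1) (x 0) 0 := by
    refine HasDerivAt.congr_deriv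
      (((Real.hasDerivAt_sin 0).mul_const (x 0)).add ((Real.hasDerivAt_cos 0).mul_const (x 1))) ?_
    simp
  have h3 : HasDerivAt (fun θ : ℝ => (![Real.cos θ * x 0 - Real.sin θ * x 1,
      Real.sin θ * x 0 + Real.cos θ * x 1, x 2] : Fin 3 → ℝ)) ![-x 1, x 0, 0] 0 := by
    rw [hasDerivAt_pi]
    intro i
    fin_cases i
    · exact h1
    · exact h2
    · exact hasDerivAt_const 0 (x 2)
  have h4 := ((EuclideanSpace.equiv (Fin 3) ℝ).symm.toContinuousLinearMap).hasFDerivAt.comp_hasDerivAt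
    (0 : ℝ) h3
  have e : (x 0 • EuclideanSpace.single 1 1 - x 1 • EuclideanSpace.single 0 1 : V3) =
      (EuclideanSpace.equiv (Fin 3) ℝ).symm ![-x 1, x 0, 0] := by
    ext i; fin_cases i <;> simp [EuclideanSpace.equiv]
  rw [e]
  exact h4

theorem rotZ_zero (x : V3) : rotZ x 0 = x := by
  ext i; fin_cases i <;> simp [rotZ]

/-- The operator x₀∂₁ - x₁∂₀ generates rotations about the axis: differentiate the equivariance at θ
= 0. -/
theorem angular_deriv_eq {f : ℝ → V3 → ℝ} (hf : SC T f) {t : ℝ} (ht : t ∈ timeI T) {x : V3}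
    {a b : ℝ} (h : ∀ θ, f t (rotZ x θ) = Real.cos θ * a + Real.sin θ * b) :
    x 0 * Dm T (some 1) f t x - x 1 * Dm T (some 0) f t x = b := by
  have h1 : HasFDerivAt (f t) (fderiv ℝ (f t) x) (rotZ x 0) := by
    rw [rotZ_zero]; exact (hf.differentiable ht x).hasFDerivAt
  have h2 := h1.comp_hasDerivAt (0 : ℝ) (hasDerivAt_rotZ x)
  have h3 : HasDerivAt (fun θ : ℝ => Real.cos θ * a + Real.sin θ * b) b 0 := by
    refine HasDerivAt.congr_deriv
      (((Real.hasDerivAt_cos 0).mul_const a).add ((Real.hasDerivAt_sin 0).mul_const b)) ?_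
    simp
  have h4 : f t ∘ rotZ x = fun θ : ℝ => Real.cos θ * a + Real.sin θ * b := funext h
  rw [h4] at h2
  have := h2.unique h3
  rw [Dm_some hf 1 ht, Dm_some hf 0 ht, ← this]
  simp

/-- The components of a time-dependent vector field. -/
abbrev comp (F : ℝ → V3 → V3) (i : Fin 3) : ℝ → V3 → ℝ := fun t x => F t x i

theorem continuous_coord_mul {f : V3 → ℝ} (hf : Continuous f) (k : Fin 3) :
    Continuous fun x : V3 => x k * f x :=
  (EuclideanSpace.proj k : V3 →L[ℝ] ℝ).continuous.mul hf

theorem continuous_angular {f : ℝ → V3 → ℝ} (hT : 0 < T) (hf : SC T f) {t : ℝ} (ht : t ∈ timeI T) :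
    Continuous fun x : V3 => x 0 * Dm T (some 1) f t x - x 1 * Dm T (some 0) f t x := by
  exact (continuous_coord_mul ((hf.Dm hT (some 1)).continuous ht) 0).sub
    (continuous_coord_mul ((hf.Dm hT (some 0)).continuous ht) 1)

theorem AxisymNoSwirl.noSwirl (hT : 0 < T) {F : ℝ → V3 → V3} (hF : ∀ i, SC T (comp F i))
    (h : ∀ t ∈ timeI T, AxisymNoSwirl (F t)) : NoSwirl T (comp F) := by
  have hrot : ∀ t ∈ timeI T, ∀ x : V3, cylR x ≠ 0 → ∀ θ,
      comp F 0 t (rotZ x θ) = Real.cos θ * comp F 0 t x + Real.sin θ * (- comp F 1 t x) ∧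
      comp F 1 t (rotZ x θ) = Real.cos θ * comp F 1 t x + Real.sin θ * comp F 0 t x ∧
      comp F 2 t (rotZ x θ) = Real.cos θ * comp F 2 t x + (1 - Real.cos θ) * comp F 2 t x ∧
      x 0 * comp F 1 t x - x 1 * comp F 0 t x = 0 := by
    intro t ht x hx θ
    obtain ⟨Fr, Fz, hF⟩ := h t ht
    have hx' : cylR (rotZ x θ) ≠ 0 := by rwa [cylR_rotZ]
    simp only [comp]
    rw [hF x hx, hF _ hx', cylR_rotZ]
    have h2 : rotZ x θ 2 = x 2 := by simp [rotZ]
    have h0 : rotZ x θ 0 = Real.cos θ * x 0 - Real.sin θ * x 1 := by simp [rotZ]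
    have h1 : rotZ x θ 1 = Real.sin θ * x 0 + Real.cos θ * x 1 := by simp [rotZ]
    rw [h2]
    simp only [eR, eZ, cylR_rotZ, h0, h1, PiLp.add_apply, PiLp.smul_apply, smul_eq_mul,
      Matrix.cons_val_zero, Matrix.cons_val_one, Matrix.cons_val]
    refine ⟨by ring, by ring, by ring, by ring⟩
  refine ⟨fun t ht => ?_, fun t ht => ?_, fun t ht => ?_, fun t ht => ?_⟩
  · exact eq_of_eq_off_axis ((continuous_coord_mul ((hF 1).continuous ht) 0).sub
      (continuous_coord_mul ((hF 0).continuous ht) 1)) continuous_const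
      fun x hx => (hrot t ht x hx 0).2.2.2
  · exact eq_of_eq_off_axis (continuous_angular hT (hF 0) ht) ((hF 1).continuous ht).neg fun x hx =>
      angular_deriv_eq (hF 0) ht fun θ => (hrot t ht x hx θ).1
  · exact eq_of_eq_off_axis (continuous_angular hT (hF 1) ht) ((hF 0).continuous ht) fun x hx =>
      angular_deriv_eq (hF 1) ht fun θ => (hrot t ht x hx θ).2.1
  · refine eq_of_eq_off_axis (continuous_angular hT (hF 2) ht) continuous_const fun x hx => ?_
    have h1 : HasFDerivAt (comp F 2 t) (fderiv ℝ (comp F 2 t) x) (rotZ x 0) := by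
      rw [rotZ_zero]; exact ((hF 2).differentiable ht x).hasFDerivAt
    have h2 := h1.comp_hasDerivAt (0 : ℝ) (hasDerivAt_rotZ x)
    have h4 : comp F 2 t ∘ rotZ x = fun _ : ℝ => comp F 2 t x := by
      ext θ
      have := (hrot t ht x hx θ).2.2.1
      simp only [Function.comp]
      linarith
    rw [h4] at h2
    have := h2.unique (hasDerivAt_const (0 : ℝ) (comp F 2 t x))
    rw [Dm_some (hF 2) 1 ht, Dm_some (hF 2) 0 ht]
    simpa using this

theorem AxisymPureSwirl.pureSwirl (hT : 0 < T) {B : ℝ → V3 → V3} (hB : ∀ i, SC T (comp B i))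
    (h : ∀ t ∈ timeI T, AxisymPureSwirl (B t)) : PureSwirl T (comp B) := by
  have hrot : ∀ t ∈ timeI T, ∀ x : V3, cylR x ≠ 0 → ∀ θ,
      comp B 0 t (rotZ x θ) = Real.cos θ * comp B 0 t x + Real.sin θ * (- comp B 1 t x) ∧
      comp B 1 t (rotZ x θ) = Real.cos θ * comp B 1 t x + Real.sin θ * comp B 0 t x ∧
      x 0 * comp B 0 t x + x 1 * comp B 1 t x = 0 ∧ comp B 2 t x = 0 := by
    intro t ht x hx θ
    obtain ⟨Fθ, hF⟩ := h t ht
    have hx' : cylR (rotZ x θ) ≠ 0 := by rwa [cylR_rotZ]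
    simp only [comp]
    rw [hF x hx, hF _ hx', cylR_rotZ]
    have h2 : rotZ x θ 2 = x 2 := by simp [rotZ]
    have h0 : rotZ x θ 0 = Real.cos θ * x 0 - Real.sin θ * x 1 := by simp [rotZ]
    have h1 : rotZ x θ 1 = Real.sin θ * x 0 + Real.cos θ * x 1 := by simp [rotZ]
    rw [h2]
    simp only [eTheta, cylR_rotZ, h0, h1, PiLp.smul_apply, smul_eq_mul,
      Matrix.cons_val_zero, Matrix.cons_val_one, Matrix.cons_val]
    refine ⟨by ring, by ring, by ring, by ring⟩
  refine ⟨fun t ht => ?_, fun t ht => ?_, fun t ht => ?_, fun t ht => ?_⟩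
  · exact eq_of_eq_off_axis ((continuous_coord_mul ((hB 0).continuous ht) 0).add
      (continuous_coord_mul ((hB 1).continuous ht) 1)) continuous_const
      fun x hx => (hrot t ht x hx 0).2.2.1
  · exact eq_of_eq_off_axis ((hB 2).continuous ht) continuous_const
      fun x hx => (hrot t ht x hx 0).2.2.2
  · exact eq_of_eq_off_axis (continuous_angular hT (hB 0) ht) ((hB 1).continuous ht).neg fun x hx =>
      angular_deriv_eq (hB 0) ht fun θ => (hrot t ht x hx θ).1
  · exact eq_of_eq_off_axis (continuous_angular hT (hB 1) ht) ((hB 0).continuous ht) fun x hx =>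
      angular_deriv_eq (hB 1) ht fun θ => (hrot t ht x hx θ).2.1

/-! ### Permanence of the structure -/

theorem Dm_none_linear {f g h : ℝ → V3 → ℝ} (hT : 0 < T) (hf : SC T f) (hg : SC T g) (hh : SC T h)
    {x : V3} {a b : ℝ} (e : ∀ t ∈ timeI T, a * f t x - b * g t x = h t x) :
    ∀ t ∈ timeI T, a * Dm T none f t x - b * Dm T none g t x = Dm T none h t x := by
  intro t ht
  have h1 := ((hasDerivWithinAt_Dm hf ht x).const_mul a).sub
    ((hasDerivWithinAt_Dm hg ht x).const_mul b)
  have h2 := (hasDerivWithinAt_Dm hh ht x).congr (f₁ := fun τ => a * f τ x - b * g τ x)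
    (fun τ hτ => e τ hτ) (e t ht)
  exact (uniqueDiffOn_timeI hT t ht).eq_deriv _ h1 h2

theorem SC.zero : SC T fun _ _ => 0 := by
  refine ⟨contDiffOn_const, fun l t ht => ⟨0, fun τ hτ => ?_⟩⟩
  have : ∀ l : List (Option (Fin 3)), ∀ t ∈ timeI T, ∀ x, NSM.word T l (fun _ _ => 0) t x = 0 := by
    intro l
    induction l with
    | nil => exact fun _ _ _ => rfl
    | cons d l ih =>
      intro t ht x
      have e : ∀ t ∈ timeI T, ∀ x, NSM.Dm T d (fun _ _ => 0) t x = (fun _ _ => 0 : ℝ → V3 → ℝ) t x := by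
        intro t ht x
        simp [NSM.Dm]
      exact (word_congr e l t ht x).trans (ih t ht x)
  rw [show NSM.word T l (fun _ _ => 0) τ = 0 from funext fun x =>
    this l τ (mem_timeI_of_le ht hτ) x]
  simp

theorem Dm_zero {d : Option (Fin 3)} (t : ℝ) (x : V3) : Dm T d (fun _ _ => 0) t x = 0 := by
  simp [Dm]

/-- The defining identities are linear with coefficients independent of time, so they may be
differentiated in time. -/
theorem NoSwirl.dt (hT : 0 < T) {F : Fin 3 → ℝ → V3 → ℝ} (hF : ∀ i, SC T (F i))
    (h : NoSwirl T F) : NoSwirl T fun i => Dm T none (F i) := by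
  refine ⟨fun t ht x => ?_, fun t ht x => ?_, fun t ht x => ?_, fun t ht x => ?_⟩
  · have := Dm_none_linear hT (hF 1) (hF 0) (SC.zero) (fun t ht => h.tang t ht x) t ht
    rwa [Dm_zero] at this
  · have := Dm_none_linear hT ((hF 0).Dm hT (some 1)) ((hF 0).Dm hT (some 0)) ((hF 1).neg hT)
      (fun t ht => h.equi0 t ht x) t ht
    rwa [Dm_neg hT (hF 1) none t ht, Dm_comm hT (hF 0) none _ t ht, Dm_comm hT (hF 0) none _ t ht]
      at this
  · have := Dm_none_linear hT ((hF 1).Dm hT (some 1)) ((hF 1).Dm hT (some 0)) (hF 0)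
      (fun t ht => h.equi1 t ht x) t ht
    rwa [Dm_comm hT (hF 1) none _ t ht, Dm_comm hT (hF 1) none _ t ht] at this
  · have := Dm_none_linear hT ((hF 2).Dm hT (some 1)) ((hF 2).Dm hT (some 0)) (SC.zero)
      (fun t ht => h.equi2 t ht x) t ht
    rwa [Dm_zero, Dm_comm hT (hF 2) none _ t ht, Dm_comm hT (hF 2) none _ t ht] at this

theorem NoSwirl.sub_const_mul (hT : 0 < T) {F G : Fin 3 → ℝ → V3 → ℝ} (hF : ∀ i, SC T (F i))
    (hG : ∀ i, SC T (G i)) (h : NoSwirl T F) (h' : NoSwirl T G) (a : ℝ) :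
    NoSwirl T fun i t x => F i t x - a * G i t x := by
  have e : ∀ (d : Option (Fin 3)) (i : Fin 3), ∀ t ∈ timeI T, ∀ x,
      Dm T d (fun t x => F i t x - a * G i t x) t x = Dm T d (F i) t x - a * Dm T d (G i) t x := by
    intro d i t ht x
    rw [Dm_sub hT (hF i) ((hG i).const_mul hT a) d t ht x, Dm_const_mul hT (hG i) a d t ht x]
  refine ⟨fun t ht x => ?_, fun t ht x => ?_, fun t ht x => ?_, fun t ht x => ?_⟩
  · have h1 := h.tang t ht x
    have h2 := h'.tang t ht x
    linear_combination h1 - a * h2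
  · rw [e _ _ t ht, e _ _ t ht]
    linear_combination h.equi0 t ht x - a * h'.equi0 t ht x
  · rw [e _ _ t ht, e _ _ t ht]
    linear_combination h.equi1 t ht x - a * h'.equi1 t ht x
  · rw [e _ _ t ht, e _ _ t ht]
    linear_combination h.equi2 t ht x - a * h'.equi2 t ht x

/-- Spatial derivative of a first-order identity with coefficients linear in `x`. -/
theorem Dm_some_linear {f g h : ℝ → V3 → ℝ} (hf : SC T f) (hg : SC T g)
    (hh : SC T h) {k l : Fin 3} {t : ℝ} (ht : t ∈ timeI T) {σ : ℝ}
    (e : ∀ x : V3, x k * f t x + σ * (x l * g t x) = h t x) (i : Fin 3) (x : V3) :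
    ((if i = k then 1 else 0) * f t x + x k * Dm T (some i) f t x) +
      σ * ((if i = l then 1 else 0) * g t x + x l * Dm T (some i) g t x) = Dm T (some i) h t x := by
  have hc : ∀ m : Fin 3, HasFDerivAt (fun y : V3 => y m) (EuclideanSpace.proj m : V3 →L[ℝ] ℝ) x :=
    fun m => (EuclideanSpace.proj m : V3 →L[ℝ] ℝ).hasFDerivAt
  have h1 := ((hc k).mul (hf.differentiable ht x).hasFDerivAt).add
    (((hc l).mul (hg.differentiable ht x).hasFDerivAt).const_mul σ)
  have h2 : HasFDerivAt (h t) _ x := h1.congr_of_eventuallyEq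
    (Filter.Eventually.of_forall fun y => (e y).symm)
  rw [Dm_some hf i ht, Dm_some hg i ht, Dm_some hh i ht, h2.fderiv]
  have hp : ∀ m : Fin 3, (EuclideanSpace.proj m : V3 →L[ℝ] ℝ) (EuclideanSpace.single i 1) =
      if i = m then 1 else 0 := by
    intro m
    rw [PiLp.proj_apply, PiLp.single_apply]
    simp only [eq_comm]
  simp only [add_apply, smul_apply, smul_eq_mul, hp]
  ring

/-- The curl in components. -/
def crl (T : ℝ≥0∞) (F : Fin 3 → ℝ → V3 → ℝ) (i : Fin 3) (t : ℝ) (x : V3) : ℝ :=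
  Dm T (some (i + 1)) (F (i + 2)) t x - Dm T (some (i + 2)) (F (i + 1)) t x

/-- The vector product in components. -/
def crs (F G : Fin 3 → ℝ → V3 → ℝ) (i : Fin 3) (t : ℝ) (x : V3) : ℝ :=
  F (i + 1) t x * G (i + 2) t x - F (i + 2) t x * G (i + 1) t x

theorem SC.crl (hT : 0 < T) {F : Fin 3 → ℝ → V3 → ℝ} (hF : ∀ i, SC T (F i)) (i : Fin 3) :
    SC T (crl T F i) :=
  ((hF (i + 2)).Dm hT _).sub hT ((hF (i + 1)).Dm hT _)

theorem SC.crs (hT : 0 < T) {F G : Fin 3 → ℝ → V3 → ℝ} (hF : ∀ i, SC T (F i))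
    (hG : ∀ i, SC T (G i)) (i : Fin 3) : SC T (crs F G i) :=
  ((hF _).mul hT (hG _)).sub hT ((hF _).mul hT (hG _))

/-- With B₂ = 0 the curl is (-∂₂B₁, ∂₂B₀, ∂₀B₁ - ∂₁B₀). Each identity follows by differentiating
those of B once and commuting derivatives; the tangential one is the vertical derivative of x₀B₀ +
x₁B₁ = 0. -/
theorem PureSwirl.noSwirl_crl (hT : 0 < T) {B : Fin 3 → ℝ → V3 → ℝ} (hB : ∀ i, SC T (B i))
    (h : PureSwirl T B) : NoSwirl T (NSM.crl T B) := by
  have e2 : ∀ d, ∀ t ∈ timeI T, ∀ x, Dm T d (B 2) t x = 0 := by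
    intro d t ht x
    rw [Dm_congr (g := fun _ _ => 0) (fun t ht x => h.vert t ht x) d t ht x, Dm_zero]
  have c0 : ∀ t ∈ timeI T, ∀ x, NSM.crl T B 0 t x = - Dm T (some 2) (B 1) t x := by
    intro t ht x
    change Dm T (some 1) (B 2) t x - Dm T (some 2) (B 1) t x = _
    rw [e2 _ t ht]; ring
  have c1 : ∀ t ∈ timeI T, ∀ x, NSM.crl T B 1 t x = Dm T (some 2) (B 0) t x := by
    intro t ht x
    change Dm T (some 2) (B 0) t x - Dm T (some 0) (B 2) t x = _
    rw [e2 _ t ht]; ring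
  have c2 : ∀ t x, NSM.crl T B 2 t x = Dm T (some 0) (B 1) t x - Dm T (some 1) (B 0) t x :=
    fun t x => rfl
  have D0 : ∀ d, ∀ t ∈ timeI T, ∀ x,
      Dm T d (NSM.crl T B 0) t x = - Dm T d (Dm T (some 2) (B 1)) t x := by
    intro d t ht x
    rw [Dm_congr c0 d t ht x, Dm_neg hT ((hB 1).Dm hT _) d t ht x]
  have D1 : ∀ d, ∀ t ∈ timeI T, ∀ x,
      Dm T d (NSM.crl T B 1) t x = Dm T d (Dm T (some 2) (B 0)) t x := by
    intro d t ht x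
    rw [Dm_congr c1 d t ht x]
  have D2 : ∀ d, ∀ t ∈ timeI T, ∀ x, Dm T d (NSM.crl T B 2) t x =
      Dm T d (Dm T (some 0) (B 1)) t x - Dm T d (Dm T (some 1) (B 0)) t x := by
    intro d t ht x
    exact Dm_sub hT ((hB 1).Dm hT _) ((hB 0).Dm hT _) d t ht x
  have q0 : ∀ i, ∀ t ∈ timeI T, ∀ x : V3, _ := fun i t ht x =>
    Dm_some_linear (k := 0) (l := 1) (σ := -1) ((hB 0).Dm hT (some 1)) ((hB 0).Dm hT (some 0))
      ((hB 1).neg hT) ht (fun x => by rw [← h.equi0 t ht x]; ring) i x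
  have q1 : ∀ i, ∀ t ∈ timeI T, ∀ x : V3, _ := fun i t ht x =>
    Dm_some_linear (k := 0) (l := 1) (σ := -1) ((hB 1).Dm hT (some 1)) ((hB 1).Dm hT (some 0))
      (hB 0) ht (fun x => by rw [← h.equi1 t ht x]; ring) i x
  refine ⟨fun t ht x => ?_, fun t ht x => ?_, fun t ht x => ?_, fun t ht x => ?_⟩
  · rw [c0 t ht, c1 t ht]
    have := Dm_some_linear (k := 0) (l := 1) (σ := 1) (hB 0) (hB 1) (SC.zero) ht
      (fun x => by rw [← h.rad t ht x]; ring) 2 x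
    rw [Dm_zero] at this
    simp at this
    linarith
  · rw [D0 _ t ht, D0 _ t ht, c1 t ht]
    have := q1 2 t ht x
    rw [Dm_comm hT (hB 1) (some 2) _ t ht, Dm_comm hT (hB 1) (some 2) _ t ht] at this
    simp at this
    linarith
  · rw [D1 _ t ht, D1 _ t ht, c0 t ht]
    have := q0 2 t ht x
    rw [Dm_comm hT (hB 0) (some 2) _ t ht, Dm_comm hT (hB 0) (some 2) _ t ht,
      Dm_neg hT (hB 1) _ t ht] at this
    simp at this
    linarith
  · rw [D2 _ t ht, D2 _ t ht]
    have a1 := q1 0 t ht x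
    have a0 := q0 1 t ht x
    rw [Dm_comm hT (hB 1) (some 0) (some 1) t ht] at a1
    rw [Dm_comm hT (hB 0) (some 1) (some 0) t ht, Dm_neg hT (hB 1) _ t ht] at a0
    simp at a1 a0
    linarith

/-! ### The key cancellation -/

/-- Horizontally F is radial and B is tangential. Since B₂ = 0, this is the orthogonality F · B = 0.
-/
theorem sum_pureSwirl_mul_noSwirl {F B : Fin 3 → ℝ → V3 → ℝ} (hF : NoSwirl T F)
    (hB : PureSwirl T B) (hFc : ∀ i, SC T (F i)) (hBc : ∀ i, SC T (B i)) :
    ∀ t ∈ timeI T, ∀ x, B 0 t x * F 0 t x + B 1 t x * F 1 t x = 0 := by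
  intro t ht
  have := (hFc 0).continuous ht
  have := (hFc 1).continuous ht
  have := (hBc 0).continuous ht
  have := (hBc 1).continuous ht
  refine eq_of_eq_off_axis (by fun_prop) continuous_const fun x hx => ?_
  have hr : x 0 ^ 2 + x 1 ^ 2 ≠ 0 := by
    intro h0; apply hx; rw [cylR, h0, Real.sqrt_zero]
  have h1 := hF.tang t ht x
  have h2 := hB.rad t ht x
  have : (x 0 ^ 2 + x 1 ^ 2) * (B 0 t x * F 0 t x + B 1 t x * F 1 t x) = 0 := by
    linear_combination (x 0 * F 0 t x + x 1 * F 1 t x) * h2 +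
      (x 0 * B 1 t x - x 1 * B 0 t x) * h1
  exact (mul_eq_zero.1 this).resolve_left hr

/-- This is B × curl F = 0: the curl of a field without swirl is itself purely swirling, hence
parallel to B. Off the axis the identity is checked after multiplication by r². -/
theorem pureSwirl_cross_curl {F B : Fin 3 → ℝ → V3 → ℝ} (hT : 0 < T) (hF : NoSwirl T F)
    (hB : PureSwirl T B) (hFc : ∀ i, SC T (F i)) (hBc : ∀ i, SC T (B i)) (i : Fin 3) :
    ∀ t ∈ timeI T, ∀ x, B 0 t x * Dm T (some 0) (F i) t x + B 1 t x * Dm T (some 1) (F i) t x =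
      B 0 t x * Dm T (some i) (F 0) t x + B 1 t x * Dm T (some i) (F 1) t x := by
  intro t ht
  have := (hBc 0).continuous ht
  have := (hBc 1).continuous ht
  have hc : ∀ d i, Continuous (Dm T d (F i) t) := fun d i => ((hFc i).Dm hT d).continuous ht
  refine eq_of_eq_off_axis ?_ ?_ fun x hx => ?_
  · exact (this.comp continuous_id |>.mul (hc _ _) |> fun h => ((hBc 0).continuous ht).mul (hc _ _) |>.add h)
  · exact (((hBc 0).continuous ht).mul (hc _ _)).add (((hBc 1).continuous ht).mul (hc _ _))
  have hr : x 0 ^ 2 + x 1 ^ 2 ≠ 0 := by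
    intro h0; apply hx; rw [cylR, h0, Real.sqrt_zero]
  have h2 := hB.rad t ht x
  have h3 := Dm_some_linear (k := 0) (l := 1) (σ := -1) (hFc 1) (hFc 0) (SC.zero) ht
      (fun x => by rw [← hF.tang t ht x]; ring) i x
  rw [Dm_zero] at h3
  have h4 : x 0 * Dm T (some 1) (F i) t x - x 1 * Dm T (some 0) (F i) t x =
      x 0 * Dm T (some i) (F 1) t x - x 1 * Dm T (some i) (F 0) t x := by
    obtain rfl | rfl | rfl : i = 0 ∨ i = 1 ∨ i = 2 := by fin_cases i <;> simp
    · rw [if_pos rfl, if_neg (by decide)] at h3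
      linear_combination hF.equi0 t ht x - h3
    · rw [if_neg (by decide), if_pos rfl] at h3
      linear_combination hF.equi1 t ht x - h3
    · rw [if_neg (by decide), if_neg (by decide)] at h3
      linear_combination hF.equi2 t ht x - h3
  have : (x 0 ^ 2 + x 1 ^ 2) * ((B 0 t x * Dm T (some 0) (F i) t x + B 1 t x * Dm T (some 1) (F i) t x) -
      (B 0 t x * Dm T (some i) (F 0) t x + B 1 t x * Dm T (some i) (F 1) t x)) = 0 := by
    linear_combination (x 0 * (Dm T (some 0) (F i) t x - Dm T (some i) (F 0) t x) +
      x 1 * (Dm T (some 1) (F i) t x - Dm T (some i) (F 1) t x)) * h2 +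
      (x 0 * B 1 t x - x 1 * B 0 t x) * h4
  exact sub_eq_zero.1 ((mul_eq_zero.1 this).resolve_left hr)

theorem fin3_add : (0 : Fin 3) + 1 = 1 ∧ (0 : Fin 3) + 2 = 2 ∧ (1 : Fin 3) + 1 = 2 ∧
    (1 : Fin 3) + 2 = 0 ∧ (2 : Fin 3) + 1 = 0 ∧ (2 : Fin 3) + 2 = 1 := by decide

/-- For a solenoidal field `F` without swirl and a solenoidal field `B` with pure swirl, no
derivative of `F` remains in `curl (F × B)`. -/
theorem crl_crs_eq {F B : Fin 3 → ℝ → V3 → ℝ} (hT : 0 < T) (hF : NoSwirl T F)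
    (hB : PureSwirl T B) (hFc : ∀ i, SC T (F i)) (hBc : ∀ i, SC T (B i))
    (hdF : ∀ t ∈ timeI T, ∀ x, ∑ k, Dm T (some k) (F k) t x = 0)
    (hdB : ∀ t ∈ timeI T, ∀ x, ∑ k, Dm T (some k) (B k) t x = 0) (i : Fin 3) :
    ∀ t ∈ timeI T, ∀ x, NSM.crl T (NSM.crs F B) i t x =
      - ∑ k, F k t x * (Dm T (some k) (B i) t x + Dm T (some i) (B k) t x) := by
  intro t ht x
  have hD : ∀ d k, Dm T d (NSM.crs F B k) t x =
      (Dm T d (F (k + 1)) t x * B (k + 2) t x + F (k + 1) t x * Dm T d (B (k + 2)) t x) -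
      (Dm T d (F (k + 2)) t x * B (k + 1) t x + F (k + 2) t x * Dm T d (B (k + 1)) t x) := by
    intro d k
    refine (Dm_sub hT ((hFc (k + 1)).mul hT (hBc (k + 2))) ((hFc (k + 2)).mul hT (hBc (k + 1)))
      d t ht x).trans ?_
    rw [Dm_mul hT (hFc _) (hBc _) d t ht x, Dm_mul hT (hFc _) (hBc _) d t ht x]
  have h1 := hdF t ht x
  have h2 := hdB t ht x
  have hv := hB.vert t ht x
  -- In curl(F × B) = F div B - B div F + (B·∇)F - (F·∇)B the only dangerous term is (B·∇)F_i. By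
  -- `h3` it equals B·∂ᵢF, and differentiating F·B = 0 (`h4`) turns this into -F·∂ᵢB.
  have h3 := pureSwirl_cross_curl hT hF hB hFc hBc i t ht x
  have h4 : Dm T (some i) (B 0) t x * F 0 t x + B 0 t x * Dm T (some i) (F 0) t x +
      (Dm T (some i) (B 1) t x * F 1 t x + B 1 t x * Dm T (some i) (F 1) t x) = 0 := by
    have := Dm_congr (f := fun t x => B 0 t x * F 0 t x + B 1 t x * F 1 t x) (g := fun _ _ => 0)
      (sum_pureSwirl_mul_noSwirl hF hB hFc hBc) (some i) t ht x
    rw [Dm_zero, Dm_add hT ((hBc 0).mul hT (hFc 0)) ((hBc 1).mul hT (hFc 1)) _ t ht x,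
      Dm_mul hT (hBc _) (hFc _) _ t ht x, Dm_mul hT (hBc _) (hFc _) _ t ht x] at this
    exact this
  have e2 : ∀ d, Dm T d (B 2) t x = 0 := by
    intro d
    rw [Dm_congr (g := fun _ _ => 0) (fun t ht x => hB.vert t ht x) d t ht x, Dm_zero]
  unfold NSM.crl
  rw [hD, hD]
  simp only [Fin.sum_univ_three] at h1 h2 ⊢
  rw [e2] at h2
  obtain rfl | rfl | rfl : i = 0 ∨ i = 1 ∨ i = 2 := by fin_cases i <;> simp
  all_goals
    simp only [fin3_add, e2, hv] at h3 h4 ⊢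
  · linear_combination h4 + h3 + F 0 t x * h2 - B 0 t x * h1
  · linear_combination h4 + h3 + F 1 t x * h2 - B 1 t x * h1
  · linear_combination h4 + h3 + F 2 t x * h2

end NSM
end


noncomputable section

namespace NSM

variable {T : ℝ≥0∞}

/-! ### The system in components -/

/-- The divergence in components. -/
def dvg (T : ℝ≥0∞) (F : Fin 3 → ℝ → V3 → ℝ) (t : ℝ) (x : V3) : ℝ :=
  ∑ k, Dm T (some k) (F k) t x

/-- The convective derivative in components. -/
def cnv (T : ℝ≥0∞) (u F : Fin 3 → ℝ → V3 → ℝ) (i : Fin 3) (t : ℝ) (x : V3) : ℝ :=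
  ∑ k, u k t x * Dm T (some k) (F i) t x

/-- The Laplacian in components. -/
def lap (T : ℝ≥0∞) (f : ℝ → V3 → ℝ) (t : ℝ) (x : V3) : ℝ :=
  ∑ k, Dm T (some k) (Dm T (some k) f) t x

/-- Minus the pressure gradient, as expressed by the momentum equation. -/
def gradP (ν : ℝ) (T : ℝ≥0∞) (u j B : Fin 3 → ℝ → V3 → ℝ) (i : Fin 3) (t : ℝ) (x : V3) : ℝ :=
  Dm T none (u i) t x + cnv T u u i t x - ν * lap T (u i) t x - crs j B i t x

/-- The symbol of Leray's projector. -/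
def leray (i k : Fin 3) (ξ : V3) : ℝ := (if i = k then 1 else 0) - ξ i * ξ k / ‖ξ‖ ^ 2

/-- The Navier--Stokes--Maxwell system in components, with the pressure eliminated. -/
structure Sys (ν σ c : ℝ) (T : ℝ≥0∞) (u E B j : Fin 3 → ℝ → V3 → ℝ) : Prop where
  hu : ∀ i, SC T (u i)
  hE : ∀ i, SC T (E i)
  hB : ∀ i, SC T (B i)
  hj : ∀ i, SC T (j i)
  momentum : ∀ i, ∀ t ∈ timeI T, ∀ x, crl T (gradP ν T u j B) i t x = 0
  ampere : ∀ i, ∀ t ∈ timeI T, ∀ x, j i t x = crl T B i t x - c⁻¹ * Dm T none (E i) t x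
  faraday : ∀ i, ∀ t ∈ timeI T, ∀ x, Dm T none (B i) t x = - c * crl T E i t x
  ohm : ∀ i, ∀ t ∈ timeI T, ∀ᵐ ξ, ft (j i t) ξ =
    σ * (c * ft (E i t) ξ + ∑ k, (leray i k ξ : ℂ) * ft (crs u B k t) ξ)
  div_u : ∀ t ∈ timeI T, ∀ x, dvg T u t x = 0
  div_E : ∀ t ∈ timeI T, ∀ x, dvg T E t x = 0
  div_B : ∀ t ∈ timeI T, ∀ x, dvg T B t x = 0
  div_j : ∀ t ∈ timeI T, ∀ x, dvg T j t x = 0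

theorem fin3_cases (i : Fin 3) : i = 0 ∨ i = 1 ∨ i = 2 := by fin_cases i <;> simp

theorem differentiable_of_comp {F : ℝ → V3 → V3} (hF : ∀ i, SC T (comp F i)) {t : ℝ}
    (ht : t ∈ timeI T) : Differentiable ℝ (F t) :=
  differentiable_euclidean.2 fun i => (hF i).differentiable ht

theorem contDiff_of_comp {F : ℝ → V3 → V3} (hF : ∀ i, SC T (comp F i)) {t : ℝ}
    (ht : t ∈ timeI T) : ContDiff ℝ ∞ (F t) :=
  contDiff_euclidean.2 fun i => (hF i).contDiff ht

theorem dt_apply (hT : 0 < T) {F : ℝ → V3 → V3} (hF : ∀ i, SC T (comp F i)) {t : ℝ}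
    (ht : t ∈ timeI T) (x : V3) (i : Fin 3) : dt T F t x i = Dm T none (comp F i) t x := by
  have h1 : DifferentiableWithinAt ℝ (fun τ => F τ x) (timeI T) t :=
    differentiableWithinAt_euclidean.2 fun i =>
      (hasDerivWithinAt_Dm (hF i) ht x).differentiableWithinAt
  have h2 := (EuclideanSpace.proj i : V3 →L[ℝ] ℝ).hasFDerivAt.comp_hasDerivWithinAt t
    h1.hasDerivWithinAt
  exact (uniqueDiffOn_timeI hT t ht).eq_deriv _ h2 (hasDerivWithinAt_Dm (hF i) ht x)

theorem fderiv_apply_comp {F : ℝ → V3 → V3} (hF : ∀ i, SC T (comp F i)) {t : ℝ}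
    (ht : t ∈ timeI T) (x v : V3) (i : Fin 3) :
    fderiv ℝ (F t) x v i = fderiv ℝ (comp F i t) x v := by
  have h2 := (EuclideanSpace.proj i : V3 →L[ℝ] ℝ).hasFDerivAt.comp x
    (differentiable_of_comp hF ht x).hasFDerivAt
  have : fderiv ℝ (comp F i t) x = _ := h2.fderiv
  rw [this]
  rfl

theorem pd_apply {F : ℝ → V3 → V3} (hF : ∀ i, SC T (comp F i)) {t : ℝ}
    (ht : t ∈ timeI T) (x : V3) (k i : Fin 3) :
    pd k (F t) x i = Dm T (some k) (comp F i) t x := by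
  rw [pd, fderiv_apply_comp hF ht, Dm_some (hF i) k ht]

theorem curl_apply {F : ℝ → V3 → V3} (hF : ∀ i, SC T (comp F i)) {t : ℝ}
    (ht : t ∈ timeI T) (x : V3) (i : Fin 3) : curl (F t) x i = crl T (comp F) i t x := by
  obtain rfl | rfl | rfl := fin3_cases i <;>
    simp only [curl, crl, pd_apply hF ht, fin3_add] <;> rfl

theorem cross_apply (F G : ℝ → V3 → V3) (t : ℝ) (x : V3) (i : Fin 3) :
    cross (F t x) (G t x) i = crs (comp F) (comp G) i t x := by
  obtain rfl | rfl | rfl := fin3_cases i <;> simp only [cross, crs, fin3_add] <;> rfl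

theorem divg_eq {F : ℝ → V3 → V3} (hF : ∀ i, SC T (comp F i)) {t : ℝ}
    (ht : t ∈ timeI T) (x : V3) : divg (F t) x = dvg T (comp F) t x := by
  simp only [divg, dvg, pd_apply hF ht]

theorem v3_eq_sum (v : V3) : v = ∑ k, v k • (EuclideanSpace.single k 1 : V3) := by
  ext i
  obtain rfl | rfl | rfl := fin3_cases i <;> simp [Fin.sum_univ_three]

theorem convect_apply {F : ℝ → V3 → V3} (hF : ∀ i, SC T (comp F i)) {t : ℝ}
    (ht : t ∈ timeI T) (x : V3) (i : Fin 3) (u : ℝ → V3 → V3) :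
    convect (u t) (F t) x i = cnv T (comp u) (comp F) i t x := by
  rw [convect, fderiv_apply_comp hF ht, v3_eq_sum (u t x), map_sum]
  simp only [map_smul, smul_eq_mul, cnv, Dm_some (hF i) _ ht]

theorem laplacian_apply (hT : 0 < T) {F : ℝ → V3 → V3} (hF : ∀ i, SC T (comp F i)) {t : ℝ}
    (ht : t ∈ timeI T) (x : V3) (i : Fin 3) :
    Laplacian.laplacian (F t) x i = lap T (comp F i) t x := by
  rw [InnerProductSpace.laplacian_eq_iteratedFDeriv_orthonormalBasis _
    (EuclideanSpace.basisFun (Fin 3) ℝ)]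
  simp only [WithLp.ofLp_sum, Finset.sum_apply, lap]
  refine Finset.sum_congr rfl fun k _ => ?_
  rw [iteratedFDeriv_two_apply, Dm_some ((hF i).Dm hT (some k)) k ht]
  simp only [EuclideanSpace.basisFun_apply, Matrix.cons_val_zero, Matrix.cons_val_one]
  have h1 : Dm T (some k) (comp F i) t = fun y =>
      (EuclideanSpace.proj i : V3 →L[ℝ] ℝ) (fderiv ℝ (F t) y (EuclideanSpace.single k 1)) :=
    funext fun y => by rw [← pd_apply hF ht]; rfl
  have h2 : DifferentiableAt ℝ (fderiv ℝ (F t)) x :=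
    ((contDiff_of_comp hF ht).fderiv_right (m := ∞) (by simp)).differentiable (by simp) x
  have h3 := (EuclideanSpace.proj i : V3 →L[ℝ] ℝ).hasFDerivAt.comp x
    (h2.hasFDerivAt.clm_apply (hasFDerivAt_const (EuclideanSpace.single k (1 : ℝ) : V3) x))
  rw [h1]
  refine Eq.trans ?_ (congrArg (fun L : V3 →L[ℝ] ℝ => L (EuclideanSpace.single k 1)) h3.fderiv).symm
  simp

theorem gradient_apply (p : V3 → ℝ) (x : V3) (i : Fin 3) :
    gradient p x i = fderiv ℝ p x (EuclideanSpace.single i 1) := by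
  have := InnerProductSpace.toDual_symm_apply (𝕜 := ℝ) (x := (EuclideanSpace.single i 1 : V3))
    (y := fderiv ℝ p x)
  rw [← this]
  change _ = inner ℝ (gradient p x) _
  rw [EuclideanSpace.inner_single_right]
  simp

/-- A differentiable function whose partial derivatives are differentiable has symmetric second
derivatives. -/
theorem fderiv_symm_of_partials {p : V3 → ℝ} (hp : Differentiable ℝ p) {g : Fin 3 → V3 → ℝ}
    (hg : ∀ i, Differentiable ℝ (g i))
    (h : ∀ i x, fderiv ℝ p x (EuclideanSpace.single i 1) = g i x) (i k : Fin 3) (x : V3) :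
    fderiv ℝ (g i) x (EuclideanSpace.single k 1) = fderiv ℝ (g k) x (EuclideanSpace.single i 1) := by
  have hc : ∀ i, HasFDerivAt (g i) (fderiv ℝ (g i) x) x := fun i => (hg i x).hasFDerivAt
  have e : ∀ y v, fderiv ℝ p y v = (∑ l, g l y • (EuclideanSpace.proj l : V3 →L[ℝ] ℝ)) v := by
    intro y v
    conv_lhs => rw [v3_eq_sum v]
    rw [map_sum]
    simp [h, mul_comm]
  have h1 : ∀ y, HasFDerivAt p (∑ l, g l y • (EuclideanSpace.proj l : V3 →L[ℝ] ℝ)) y := by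
    intro y
    have := (hp y).hasFDerivAt
    rwa [ContinuousLinearMap.ext (e y)] at this
  have h2 : HasFDerivAt (fun y => ∑ l, g l y • (EuclideanSpace.proj l : V3 →L[ℝ] ℝ))
      (∑ l, (fderiv ℝ (g l) x).smulRight (EuclideanSpace.proj l : V3 →L[ℝ] ℝ)) x :=
    HasFDerivAt.fun_sum fun l _ => (hc l).smul_const (EuclideanSpace.proj l : V3 →L[ℝ] ℝ)
  have := second_derivative_symmetric h1 h2 (EuclideanSpace.single k 1) (EuclideanSpace.single i 1)
  have hs : ∀ a b : Fin 3, (∑ l, (fderiv ℝ (g l) x).smulRight (EuclideanSpace.proj l : V3 →L[ℝ] ℝ))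
      (EuclideanSpace.single a 1) (EuclideanSpace.single b 1) =
        fderiv ℝ (g b) x (EuclideanSpace.single a 1) := by
    intro a b
    simp only [sum_apply, ContinuousLinearMap.smulRight_apply,
      smul_apply, PiLp.proj_apply, PiLp.single_apply, smul_eq_mul, mul_ite, mul_one, mul_zero]
    simp
  rwa [hs, hs] at this

theorem SC.cnv (hT : 0 < T) {u F : Fin 3 → ℝ → V3 → ℝ} (hu : ∀ i, SC T (u i))
    (hF : ∀ i, SC T (F i)) (i : Fin 3) : SC T (cnv T u F i) :=
  SC.sum hT Finset.univ Finset.univ_nonempty fun k _ => (hu k).mul hT ((hF i).Dm hT _)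

theorem SC.lap (hT : 0 < T) {f : ℝ → V3 → ℝ} (hf : SC T f) : SC T (lap T f) :=
  SC.sum hT Finset.univ Finset.univ_nonempty fun k _ => (hf.Dm hT (some k)).Dm hT (some k)

theorem SC.gradP (hT : 0 < T) (ν : ℝ) {u j B : Fin 3 → ℝ → V3 → ℝ} (hu : ∀ i, SC T (u i))
    (hj : ∀ i, SC T (j i)) (hB : ∀ i, SC T (B i)) (i : Fin 3) : SC T (gradP ν T u j B i) :=
  ((((hu i).Dm hT none).add hT (SC.cnv hT hu hu i)).sub hT (((hu i).lap hT).const_mul hT ν)).sub hT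
    (SC.crs hT hj hB i)

/-- The pressure survives only through the statement that the residual of the momentum equation is
curl free. Regularity of j, which is not assumed, is read off from Ampère's law. -/
theorem IsSmoothSolution.sys (hT : 0 < T) {ν σ c : ℝ} (hc : 0 < c) {u E B j : ℝ → V3 → V3}
    {π : ℝ → V3 → ℝ} (h : IsSmoothSolution ν σ c T u E B j π) :
    Sys ν σ c T (comp u) (comp E) (comp B) (comp j) := by
  have hu := fun i => h.smooth_u.SC hT i
  have hE := fun i => h.smooth_E.SC hT i
  have hB := fun i => h.smooth_B.SC hT i
  have amp : ∀ i, ∀ t ∈ timeI T, ∀ x, comp j i t x =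
      crl T (comp B) i t x - c⁻¹ * Dm T none (comp E i) t x := by
    intro i t ht x
    have h1 := congrArg (fun v : V3 => v i) (h.ampere t ht x)
    simp only [PiLp.sub_apply, PiLp.smul_apply, PiLp.neg_apply, smul_eq_mul,
      dt_apply hT hE ht, curl_apply hB ht] at h1
    simp only [comp]
    linear_combination h1
  have hj : ∀ i, SC T (comp j i) := fun i =>
    SC.congr ((SC.crl hT hB i).sub hT (((hE i).Dm hT none).const_mul hT c⁻¹)) (amp i)
  refine ⟨hu, hE, hB, hj, ?_, amp, ?_, ?_, ?_, ?_, ?_, ?_⟩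
  · intro i t ht x
    -- The pressure is merely differentiable, but its partial derivatives equal smooth fields, so
    -- its second derivatives exist and are symmetric.
    have hg : ∀ i x, fderiv ℝ (π t) x (EuclideanSpace.single i 1) =
        - gradP ν T (comp u) (comp j) (comp B) i t x := by
      intro i x
      have h1 := congrArg (fun v : V3 => v i) (h.navierStokes t ht x)
      simp only [PiLp.add_apply, PiLp.sub_apply, PiLp.smul_apply, smul_eq_mul, dt_apply hT hu ht,
        convect_apply hu ht, laplacian_apply hT hu ht, gradient_apply, cross_apply] at h1
      simp only [gradP]
      linear_combination h1
    have hP := SC.gradP hT ν hu hj hB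
    have := fderiv_symm_of_partials (h.diff_pressure t ht)
      (fun i => ((hP i).neg hT).differentiable ht) hg (i + 2) (i + 1) x
    rw [← Dm_some ((hP _).neg hT) _ ht, ← Dm_some ((hP _).neg hT) _ ht,
      Dm_neg hT (hP _) _ t ht, Dm_neg hT (hP _) _ t ht] at this
    rw [crl]
    linarith
  · intro i t ht x
    have h1 := congrArg (fun v : V3 => v i) (h.faraday t ht x)
    simp only [PiLp.add_apply, PiLp.smul_apply, smul_eq_mul, PiLp.zero_apply,
      dt_apply hT hB ht, curl_apply hE ht] at h1
    field_simp at h1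
    linarith
  · intro i t ht
    obtain ⟨w, ⟨hF, hw, hP⟩, hjw⟩ := h.ohm t ht
    have e1 : comp j i t = fun x => σ * (c * E t x i + w x i) := by
      ext x
      simp only [comp, hjw x, PiLp.smul_apply, PiLp.add_apply, smul_eq_mul]
    have hwi : MemLp (fun x => w x i) 2 volume := memLp_comp_apply hw i
    have hEi : MemLp (fun x => E t x i) 2 volume := (hE i).memLp ht
    have hF' : ∀ k, (fun ξ => fourierL2 (fun x => cross (u t x) (B t x)) ξ k) =ᵐ[volume]
        ft (crs (comp u) (comp B) k t) := by
      intro k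
      refine (fourierL2_apply_ae hF k).trans (ae_of_all _ fun ξ => ?_)
      simp only [cross_apply]
    rw [e1]
    filter_upwards [ft_const_mul ((hEi.const_mul c).add hwi) σ, ft_add (hEi.const_mul c) hwi,
      ft_const_mul hEi c, fourierL2_apply_ae hw i, hP, hF' 0, hF' 1, hF' 2]
      with ξ a1 a2 a3 a4 a5 b0 b1 b2
    have a5 := a5 i
    refine a1.trans ?_
    rw [show ft ((fun x => c * E t x i) + fun x => w x i) ξ = _ from a2, a3, ← a4, a5]
    congr 2
    simp only [Fin.sum_univ_three, b0, b1, b2]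
    obtain rfl | rfl | rfl := fin3_cases i <;> simp [leray, b0, b1, b2] <;> ring
  · intro t ht x; rw [← divg_eq hu ht]; exact h.div_u t ht x
  · intro t ht x; rw [← divg_eq hE ht]; exact h.div_E t ht x
  · intro t ht x; rw [← divg_eq hB ht]; exact h.div_B t ht x
  · intro t ht x; rw [← divg_eq hj ht]; exact h.div_j t ht x

end NSM
end


noncomputable section

namespace NSM

variable {T : ℝ≥0∞}

/-! ### Convolution of nonnegative functions -/

theorem conv_mono_ae {f f' g g' : V3 → ℝ≥0∞} (hf : ∀ᵐ ξ, f ξ ≤ f' ξ) (hg : ∀ᵐ ξ, g ξ ≤ g' ξ)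
    (ξ : V3) : conv f g ξ ≤ conv f' g' ξ := by
  refine lintegral_mono_ae ?_
  filter_upwards [(measurePreserving_sub_left' ξ).quasiMeasurePreserving.ae hf, hg] with η h1 h2
  exact mul_le_mul' h1 h2

theorem conv_add_left {f f' g : V3 → ℝ≥0∞} (hf : Measurable f) (hg : Measurable g) (ξ : V3) :
    conv (fun η => f η + f' η) g ξ = conv f g ξ + conv f' g ξ := by
  simp only [conv, add_mul]
  exact lintegral_add_left ((hf.comp (measurable_const.sub measurable_id)).mul hg) _

theorem conv_const_mul_left {f g : V3 → ℝ≥0∞} (hf : Measurable f) (hg : Measurable g) (a : ℝ≥0∞)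
    (ξ : V3) : conv (fun η => a * f η) g ξ = a * conv f g ξ := by
  simp only [conv, mul_assoc]
  exact lintegral_const_mul _ ((hf.comp (measurable_const.sub measurable_id)).mul hg)

theorem conv_const_mul_right {f g : V3 → ℝ≥0∞} (hf : Measurable f) (hg : Measurable g) (a : ℝ≥0∞)
    (ξ : V3) : conv f (fun η => a * g η) ξ = a * conv f g ξ := by
  simp only [conv, mul_left_comm _ a]
  exact lintegral_const_mul _ ((hf.comp (measurable_const.sub measurable_id)).mul hg)

theorem conv_comm {f g : V3 → ℝ≥0∞} (hf : Measurable f) (hg : Measurable g) (ξ : V3) :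
    conv f g ξ = conv g f ξ := by
  have hm : Measurable fun η => f (ξ - η) * g η :=
    (hf.comp (measurable_const.sub measurable_id)).mul hg
  rw [conv, conv, ← (measurePreserving_sub_left' ξ).lintegral_comp hm]
  refine lintegral_congr fun η => ?_
  rw [sub_sub_cancel, mul_comm]

/-! ### Amplitudes -/

/-- The amplitude `∑ᵢ |F̂ᵢ|` of a vector field at time `t`. -/
def amp (F : Fin 3 → ℝ → V3 → ℝ) (t : ℝ) (ξ : V3) : ℝ≥0∞ := ∑ i, ‖ft (F i t) ξ‖ₑ

/-- The `Ḣˢ` norm of the amplitude. -/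
def Hs (s : ℝ) (F : Fin 3 → ℝ → V3 → ℝ) (t : ℝ) : ℝ≥0∞ := N2 fun ξ => wt s ξ * amp F t ξ

theorem measurable_amp (F : Fin 3 → ℝ → V3 → ℝ) (t : ℝ) : Measurable (amp F t) :=
  Finset.measurable_sum _ fun _ _ => (measurable_ft _).enorm

theorem measurable_wt_mul_amp (s : ℝ) (F : Fin 3 → ℝ → V3 → ℝ) (t : ℝ) :
    Measurable fun ξ => wt s ξ * amp F t ξ := (measurable_wt s).mul (measurable_amp F t)

theorem enorm_ft_le_amp (F : Fin 3 → ℝ → V3 → ℝ) (t : ℝ) (i : Fin 3) (ξ : V3) :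
    ‖ft (F i t) ξ‖ₑ ≤ amp F t ξ :=
  Finset.single_le_sum (f := fun i => ‖ft (F i t) ξ‖ₑ) (fun _ _ => zero_le) (Finset.mem_univ i)

theorem amp_le_of_forall {F : Fin 3 → ℝ → V3 → ℝ} {t : ℝ} {ξ : V3} {a : ℝ≥0∞}
    (h : ∀ i, ‖ft (F i t) ξ‖ₑ ≤ a) : amp F t ξ ≤ 3 * a := by
  refine (Finset.sum_le_card_nsmul _ _ a fun i _ => h i).trans ?_
  simp

theorem wt_one (ξ : V3) : wt 1 ξ = ENNReal.ofReal (2 * Real.pi * ‖ξ‖) := ENNReal.rpow_one _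

theorem abs_coord_le (ξ : V3) (i : Fin 3) : |ξ i| ≤ ‖ξ‖ := PiLp.norm_apply_le ξ i

theorem enorm_symbol_le (ξ : V3) (i : Fin 3) :
    ‖(2 * Real.pi * Complex.I * (ξ i : ℝ) : ℂ)‖ₑ ≤ wt 1 ξ := by
  rw [wt_one, ← ofReal_norm]
  refine ENNReal.ofReal_le_ofReal ?_
  simp only [norm_mul, Complex.norm_ofNat, Complex.norm_real, Complex.norm_I, mul_one,
    Real.norm_eq_abs, abs_of_pos Real.pi_pos]
  have := abs_coord_le ξ i
  have := Real.pi_pos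
  gcongr

theorem enorm_ft_Dm_le (hT : 0 < T) {f : ℝ → V3 → ℝ} (hf : SC T f) {t : ℝ} (ht : t ∈ timeI T)
    (i : Fin 3) : ∀ᵐ ξ, ‖ft (Dm T (some i) f t) ξ‖ₑ ≤ wt 1 ξ * ‖ft (f t) ξ‖ₑ := by
  filter_upwards [ft_Dm hT hf ht i] with ξ h
  rw [h, enorm_mul]
  exact mul_le_mul' (enorm_symbol_le ξ i) le_rfl

theorem enorm_ft_mul_le_conv (hT : 0 < T) {f g : ℝ → V3 → ℝ} (hf : SC T f) (hg : SC T g) {t : ℝ}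
    (ht : t ∈ timeI T) {a b : V3 → ℝ≥0∞} (ha : ∀ᵐ ξ, ‖ft (f t) ξ‖ₑ ≤ a ξ)
    (hb : ∀ᵐ ξ, ‖ft (g t) ξ‖ₑ ≤ b ξ) : ∀ᵐ ξ, ‖ft (fun x => f t x * g t x) ξ‖ₑ ≤ conv a b ξ := by
  filter_upwards [enorm_ft_mul_le (hf.memLp ht) (hg.memLp ht) ((hf.mul hT hg).memLp ht)] with ξ h
  exact h.trans (conv_mono_ae ha hb ξ)

theorem enorm_ft_crs_le (hT : 0 < T) {F G : Fin 3 → ℝ → V3 → ℝ} (hF : ∀ i, SC T (F i))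
    (hG : ∀ i, SC T (G i)) {t : ℝ} (ht : t ∈ timeI T) {b : V3 → ℝ≥0∞}
    (hb : ∀ i, ∀ᵐ ξ, ‖ft (G i t) ξ‖ₑ ≤ b ξ) (i : Fin 3) :
    ∀ᵐ ξ, ‖ft (crs F G i t) ξ‖ₑ ≤ 2 * conv (amp F t) b ξ := by
  have h : ∀ k l, ∀ᵐ ξ, ‖ft (fun x => F k t x * G l t x) ξ‖ₑ ≤ conv (amp F t) b ξ := fun k l =>
    enorm_ft_mul_le_conv hT (hF k) (hG l) ht (ae_of_all _ fun ξ => enorm_ft_le_amp F t k ξ) (hb l)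
  filter_upwards [ft_sub (((hF (i + 1)).mul hT (hG (i + 2))).memLp ht)
    (((hF (i + 2)).mul hT (hG (i + 1))).memLp ht), h (i + 1) (i + 2), h (i + 2) (i + 1)]
    with ξ h0 h1 h2
  rw [show ft (crs F G i t) ξ = _ from h0, two_mul]
  exact (enorm_sub_le).trans (add_le_add h1 h2)

theorem enorm_ft_crl_le (hT : 0 < T) {F : Fin 3 → ℝ → V3 → ℝ} (hF : ∀ i, SC T (F i)) {t : ℝ}
    (ht : t ∈ timeI T) (i : Fin 3) :
    ∀ᵐ ξ, ‖ft (crl T F i t) ξ‖ₑ ≤ 2 * (wt 1 ξ * amp F t ξ) := by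
  filter_upwards [ft_sub (((hF (i + 2)).Dm hT (some (i + 1))).memLp ht)
    (((hF (i + 1)).Dm hT (some (i + 2))).memLp ht), enorm_ft_Dm_le hT (hF (i + 2)) ht (i + 1),
    enorm_ft_Dm_le hT (hF (i + 1)) ht (i + 2)] with ξ h0 h1 h2
  rw [show ft (crl T F i t) ξ = _ from h0, two_mul]
  refine (enorm_sub_le).trans (add_le_add (h1.trans ?_) (h2.trans ?_)) <;>
  exact mul_le_mul' le_rfl (enorm_ft_le_amp F t _ ξ)

theorem enorm_ft_cnv_le (hT : 0 < T) {u F : Fin 3 → ℝ → V3 → ℝ} (hu : ∀ i, SC T (u i))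
    (hF : ∀ i, SC T (F i)) {t : ℝ} (ht : t ∈ timeI T) (i : Fin 3) :
    ∀ᵐ ξ, ‖ft (cnv T u F i t) ξ‖ₑ ≤ 3 * conv (amp u t) (fun η => wt 1 η * amp F t η) ξ := by
  have h : ∀ k, ∀ᵐ ξ, ‖ft (fun x => u k t x * Dm T (some k) (F i) t x) ξ‖ₑ ≤
      conv (amp u t) (fun η => wt 1 η * amp F t η) ξ := fun k =>
    enorm_ft_mul_le_conv hT (hu k) ((hF i).Dm hT _) ht
      (ae_of_all _ fun ξ => enorm_ft_le_amp u t k ξ) (by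
        filter_upwards [enorm_ft_Dm_le hT (hF i) ht k] with ξ h
        exact h.trans (mul_le_mul' le_rfl (enorm_ft_le_amp F t _ ξ)))
  filter_upwards [ft_sum Finset.univ (f := fun k x => u k t x * Dm T (some k) (F i) t x)
    (fun k _ => ((hu k).mul hT ((hF i).Dm hT (some k))).memLp ht), ae_all_iff.2 h] with ξ h0 h1
  rw [show ft (cnv T u F i t) ξ = _ from h0]
  refine (enorm_sum_le _ _).trans ((Finset.sum_le_card_nsmul _ _ _ fun k _ => h1 k).trans ?_)
  simp

theorem ft_lap (hT : 0 < T) {f : ℝ → V3 → ℝ} (hf : SC T f) {t : ℝ} (ht : t ∈ timeI T) :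
    ∀ᵐ ξ, ft (lap T f t) ξ = -(((2 * Real.pi * ‖ξ‖ : ℝ) : ℂ) ^ 2 * ft (f t) ξ) := by
  have h : ∀ k, ∀ᵐ ξ, ft (Dm T (some k) (Dm T (some k) f) t) ξ =
      (2 * Real.pi * Complex.I * (ξ k : ℝ)) ^ 2 * ft (f t) ξ := by
    intro k
    filter_upwards [ft_Dm hT (hf.Dm hT (some k)) ht k, ft_Dm hT hf ht k] with ξ h1 h2
    rw [h1, h2]; ring
  filter_upwards [ft_sum Finset.univ (f := fun k x => Dm T (some k) (Dm T (some k) f) t x)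
    (fun k _ => ((hf.Dm hT (some k)).Dm hT (some k)).memLp ht), ae_all_iff.2 h] with ξ h0 h1
  rw [show ft (lap T f t) ξ = _ from h0]
  have e : (‖ξ‖ : ℂ) ^ 2 = (ξ 0 : ℂ) ^ 2 + (ξ 1 : ℂ) ^ 2 + (ξ 2 : ℂ) ^ 2 := by
    have := EuclideanSpace.real_norm_sq_eq ξ
    rw [Fin.sum_univ_three] at this
    exact_mod_cast this
  simp only [Fin.sum_univ_three]
  rw [show ft (fun x => Dm T (some 0) (Dm T (some 0) f) t x) ξ = _ from h1 0,
    show ft (fun x => Dm T (some 1) (Dm T (some 1) f) t x) ξ = _ from h1 1,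
    show ft (fun x => Dm T (some 2) (Dm T (some 2) f) t x) ξ = _ from h1 2]
  push_cast
  simp only [mul_pow, Complex.I_sq, e]
  ring

/-! ### Leray's projector -/

/-- Leray's projector applied to a field, on the Fourier side. -/
def lerayFt (F : Fin 3 → V3 → ℝ) (i : Fin 3) (ξ : V3) : ℂ := ∑ k, (leray i k ξ : ℂ) * ft (F k) ξ

theorem leray_sum_eq (v : Fin 3 → ℂ) (i : Fin 3) (ξ : V3) :
    ∑ k, (leray i k ξ : ℂ) * v k = v i - (∑ k, (ξ k : ℂ) * v k) * ξ i / (‖ξ‖ : ℂ) ^ 2 := by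
  obtain rfl | rfl | rfl := fin3_cases i <;> simp [leray, Fin.sum_univ_three] <;> ring

theorem abs_leray_le (i k : Fin 3) (ξ : V3) : |leray i k ξ| ≤ 2 := by
  unfold leray
  have h1 : |(if i = k then (1 : ℝ) else 0)| ≤ 1 := by split_ifs <;> simp
  have h2 : |ξ i * ξ k / ‖ξ‖ ^ 2| ≤ 1 := by
    rw [abs_div, abs_mul, abs_of_nonneg (sq_nonneg ‖ξ‖), sq]
    exact div_le_one_of_le₀ (mul_le_mul (abs_coord_le _ _) (abs_coord_le _ _) (abs_nonneg _)
      (norm_nonneg _)) (by positivity)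
  rw [abs_le] at *
  constructor <;> linarith [h1.1, h1.2, h2.1, h2.2]

theorem enorm_lerayFt_le (F : Fin 3 → V3 → ℝ) (i : Fin 3) (ξ : V3) {a : ℝ≥0∞}
    (h : ∀ k, ‖ft (F k) ξ‖ₑ ≤ a) : ‖lerayFt F i ξ‖ₑ ≤ 6 * a := by
  refine (enorm_sum_le _ _).trans ((Finset.sum_le_card_nsmul _ _ (2 * a) fun k _ => ?_).trans ?_)
  · rw [enorm_mul]
    refine mul_le_mul' ?_ (h k)
    rw [← ofReal_norm, Complex.norm_real, Real.norm_eq_abs]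
    exact (ENNReal.ofReal_le_ofReal (abs_leray_le i k ξ)).trans (by simp)
  · simp only [Finset.card_univ, Fintype.card_fin, nsmul_eq_mul, ← mul_assoc]
    norm_num

/-- Because |ξ|² P̂(ξ)v = -ξ × (ξ × v), the projection is controlled by |ξ|⁻¹ |ξ × v|. -/
theorem leray_norm_le (v : Fin 3 → ℂ) (i : Fin 3) {ξ : V3} (hξ : ξ ≠ 0) :
    ‖∑ k, (leray i k ξ : ℂ) * v k‖ * ‖ξ‖ ≤
      ∑ l : Fin 3, ‖(ξ (l + 1) : ℂ) * v (l + 2) - ξ (l + 2) * v (l + 1)‖ := by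
  have hn : (‖ξ‖ : ℂ) ≠ 0 := by simpa using hξ
  have e : (‖ξ‖ : ℂ) ^ 2 = (ξ 0 : ℂ) ^ 2 + (ξ 1 : ℂ) ^ 2 + (ξ 2 : ℂ) ^ 2 := by
    have := EuclideanSpace.real_norm_sq_eq ξ
    rw [Fin.sum_univ_three] at this
    exact_mod_cast this
  set w : Fin 3 → ℂ := fun l => (ξ (l + 1) : ℂ) * v (l + 2) - ξ (l + 2) * v (l + 1) with hw
  have key : (∑ k, (leray i k ξ : ℂ) * v k) * (‖ξ‖ : ℂ) ^ 2 =
      ξ (i + 2) * w (i + 1) - ξ (i + 1) * w (i + 2) := by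
    rw [leray_sum_eq, sub_mul, div_mul_cancel₀ _ (pow_ne_zero 2 hn), e, Fin.sum_univ_three]
    obtain rfl | rfl | rfl := fin3_cases i <;> simp only [hw, fin3_add] <;> ring
  have h1 : ‖∑ k, (leray i k ξ : ℂ) * v k‖ * ‖ξ‖ ^ 2 ≤ ‖ξ‖ * ∑ l, ‖w l‖ := by
    have := congrArg norm key
    rw [norm_mul, norm_pow, Complex.norm_real, norm_norm] at this
    rw [this]
    have a1 : ‖(ξ (i + 2) : ℂ)‖ ≤ ‖ξ‖ := by
      rw [Complex.norm_real]; exact abs_coord_le _ _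
    have a2 : ‖(ξ (i + 1) : ℂ)‖ ≤ ‖ξ‖ := by
      rw [Complex.norm_real]; exact abs_coord_le _ _
    calc _ ≤ ‖ξ‖ * ‖w (i + 1)‖ + ‖ξ‖ * ‖w (i + 2)‖ := by
          refine (norm_sub_le _ _).trans ?_
          rw [norm_mul, norm_mul]
          gcongr
      _ ≤ ‖ξ‖ * ∑ l, ‖w l‖ := by
          rw [← mul_add]
          refine mul_le_mul_of_nonneg_left ?_ (norm_nonneg _)
          rw [Fin.sum_univ_three]
          have := norm_nonneg (w 0)
          have := norm_nonneg (w 1)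
          have := norm_nonneg (w 2)
          obtain rfl | rfl | rfl := fin3_cases i <;> simp only [fin3_add] <;> linarith
  have hp : 0 < ‖ξ‖ := norm_pos_iff.2 hξ
  refine le_of_mul_le_mul_left ?_ hp
  calc _ = ‖∑ k, (leray i k ξ : ℂ) * v k‖ * ‖ξ‖ ^ 2 := by ring
    _ ≤ _ := h1

/-- Serves two purposes: it kills curl-free fields, which removes the pressure, and it trades P(F ×
B) for |D|⁻¹ curl(F × B), where the symmetry acts. -/
theorem enorm_lerayFt_le_crl (hT : 0 < T) {F : Fin 3 → ℝ → V3 → ℝ} (hF : ∀ i, SC T (F i)) {t : ℝ}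
    (ht : t ∈ timeI T) (i : Fin 3) :
    ∀ᵐ ξ, ‖lerayFt (fun k => F k t) i ξ‖ₑ ≤ wt (-1) ξ * ∑ l, ‖ft (crl T F l t) ξ‖ₑ := by
  have hc : ∀ l, ∀ᵐ ξ, ft (crl T F l t) ξ = (2 * Real.pi * Complex.I) *
      ((ξ (l + 1) : ℂ) * ft (F (l + 2) t) ξ - ξ (l + 2) * ft (F (l + 1) t) ξ) := by
    intro l
    filter_upwards [ft_sub (((hF (l + 2)).Dm hT (some (l + 1))).memLp ht)
      (((hF (l + 1)).Dm hT (some (l + 2))).memLp ht), ft_Dm hT (hF (l + 2)) ht (l + 1),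
      ft_Dm hT (hF (l + 1)) ht (l + 2)] with ξ h0 h1 h2
    rw [show ft (crl T F l t) ξ = _ from h0, h1, h2]
    ring
  filter_upwards [ae_all_iff.2 hc, ae_ne_zero] with ξ h hξ
  have h1 := leray_norm_le (fun k => ft (F k t) ξ) i hξ
  have hp : 0 < 2 * Real.pi * ‖ξ‖ := by
    have := norm_pos_iff.2 hξ
    have := Real.pi_pos
    positivity
  have h2 : ‖lerayFt (fun k => F k t) i ξ‖ * (2 * Real.pi * ‖ξ‖) ≤ ∑ l, ‖ft (crl T F l t) ξ‖ := by
    simp only [h, norm_mul, Complex.norm_ofNat, Complex.norm_real, Complex.norm_I, mul_one,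
      Real.norm_eq_abs, abs_of_pos Real.pi_pos, ← Finset.mul_sum]
    have := Real.pi_pos
    calc _ = (2 * Real.pi) * (‖lerayFt (fun k => F k t) i ξ‖ * ‖ξ‖) := by ring
      _ ≤ _ := by gcongr; exact h1
  have h3 : ‖lerayFt (fun k => F k t) i ξ‖ₑ * wt 1 ξ ≤ ∑ l, ‖ft (crl T F l t) ξ‖ₑ := by
    simp only [wt_one, ← ofReal_norm]
    rw [← ENNReal.ofReal_mul (norm_nonneg _), ← ENNReal.ofReal_sum_of_nonneg fun _ _ => norm_nonneg _]
    exact ENNReal.ofReal_le_ofReal h2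
  calc _ = wt (-1) ξ * (‖lerayFt (fun k => F k t) i ξ‖ₑ * wt 1 ξ) := by
        rw [mul_comm, mul_assoc, mul_comm (wt 1 ξ), wt_neg_mul_self hξ, mul_one]
    _ ≤ _ := mul_le_mul' le_rfl h3

/-- The Fourier transform of a solenoidal field is orthogonal to the frequency. -/
theorem sum_mul_ft_eq_zero (hT : 0 < T) {F : Fin 3 → ℝ → V3 → ℝ} (hF : ∀ i, SC T (F i))
    (hd : ∀ t ∈ timeI T, ∀ x, dvg T F t x = 0) {t : ℝ} (ht : t ∈ timeI T) :
    ∀ᵐ ξ : V3, ∑ k, (ξ k : ℂ) * ft (F k t) ξ = 0 := by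
  have h0 : ft (fun x => ∑ k, Dm T (some k) (F k) t x) =ᵐ[volume] fun _ => 0 := by
    have : (fun x => ∑ k, Dm T (some k) (F k) t x) = fun x => (0 : ℝ) * F 0 t x := by
      ext x; rw [zero_mul]; exact hd t ht x
    rw [this]
    filter_upwards [ft_const_mul ((hF 0).memLp ht) 0] with ξ h
    rw [h]; simp
  have h1 : ∀ k, ∀ᵐ ξ, ft (fun x => Dm T (some k) (F k) t x) ξ = _ := fun k => ft_Dm hT (hF k) ht k
  filter_upwards [h0, ft_sum Finset.univ (f := fun k x => Dm T (some k) (F k) t x)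
    (fun k _ => ((hF k).Dm hT (some k)).memLp ht), ae_all_iff.2 h1] with ξ a b d
  rw [b] at a
  simp only [d, mul_assoc, ← Finset.mul_sum] at a
  have hp : (Real.pi : ℂ) ≠ 0 := by exact_mod_cast Real.pi_ne_zero
  simpa [hp] using a

/-- The Fourier-side form of the cancellation in `curl (F × B)`. -/
theorem enorm_lerayFt_crs_le (hT : 0 < T) {F B : Fin 3 → ℝ → V3 → ℝ} (hF : NoSwirl T F)
    (hB : PureSwirl T B) (hFc : ∀ i, SC T (F i)) (hBc : ∀ i, SC T (B i))
    (hdF : ∀ t ∈ timeI T, ∀ x, dvg T F t x = 0) (hdB : ∀ t ∈ timeI T, ∀ x, dvg T B t x = 0)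
    {t : ℝ} (ht : t ∈ timeI T) (i : Fin 3) :
    ∀ᵐ ξ, ‖lerayFt (fun k => crs F B k t) i ξ‖ₑ ≤
      18 * (wt (-1) ξ * conv (amp F t) (fun η => wt 1 η * amp B t η) ξ) := by
  have hD : ∀ k l, SC T fun t x => Dm T (some k) (B l) t x + Dm T (some l) (B k) t x := fun k l =>
    ((hBc l).Dm hT (some k)).add hT ((hBc k).Dm hT (some l))
  have h1 : ∀ l k, ∀ᵐ ξ, ‖ft (fun x => F k t x * (Dm T (some k) (B l) t x + Dm T (some l) (B k) t x))
      ξ‖ₑ ≤ 2 * conv (amp F t) (fun η => wt 1 η * amp B t η) ξ := by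
    intro l k
    have hb : ∀ᵐ ξ, ‖ft (fun x => Dm T (some k) (B l) t x + Dm T (some l) (B k) t x) ξ‖ₑ ≤
        2 * (wt 1 ξ * amp B t ξ) := by
      filter_upwards [ft_add (((hBc l).Dm hT (some k)).memLp ht) (((hBc k).Dm hT (some l)).memLp ht),
        enorm_ft_Dm_le hT (hBc l) ht k, enorm_ft_Dm_le hT (hBc k) ht l] with ξ a b d
      rw [a, two_mul]
      refine (enorm_add_le _ _).trans (add_le_add (b.trans ?_) (d.trans ?_)) <;>
      exact mul_le_mul' le_rfl (enorm_ft_le_amp B t _ ξ)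
    filter_upwards [enorm_ft_mul_le_conv hT (hFc k) (hD k l) ht
      (ae_of_all _ fun ξ => enorm_ft_le_amp F t k ξ) hb] with ξ h
    rwa [conv_const_mul_right (measurable_amp F t) (measurable_wt_mul_amp 1 B t)] at h
  -- The factor 6 counts three values of k and two derivatives of B for each; summing over the three
  -- components of the curl then gives 18.
  have h2 : ∀ l, ∀ᵐ ξ, ‖ft (crl T (crs F B) l t) ξ‖ₑ ≤
      6 * conv (amp F t) (fun η => wt 1 η * amp B t η) ξ := by
    intro l
    have e : crl T (crs F B) l t = fun x => - ∑ k, F k t x *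
        (Dm T (some k) (B l) t x + Dm T (some l) (B k) t x) :=
      funext fun x => crl_crs_eq hT hF hB hFc hBc hdF hdB l t ht x
    have hm : ∀ k, MemLp (fun x => F k t x * (Dm T (some k) (B l) t x + Dm T (some l) (B k) t x))
        2 volume := fun k => ((hFc k).mul hT (hD k l)).memLp ht
    rw [e]
    filter_upwards [ft_neg (memLp_finsetSum Finset.univ fun k _ => hm k),
      ft_sum Finset.univ (fun k _ => hm k), ae_all_iff.2 (h1 l)] with ξ a b d
    rw [a, enorm_neg, b]
    refine (enorm_sum_le _ _).trans ((Finset.sum_le_card_nsmul _ _ _ fun k _ => d k).trans ?_)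
    simp only [Finset.card_univ, Fintype.card_fin, nsmul_eq_mul, ← mul_assoc]
    norm_num
  filter_upwards [enorm_lerayFt_le_crl hT (SC.crs hT hFc hBc) ht i, ae_all_iff.2 h2] with ξ a b
  refine a.trans ?_
  rw [mul_left_comm]
  refine mul_le_mul' le_rfl ((Finset.sum_le_card_nsmul _ _ _ fun k _ => b k).trans ?_)
  simp only [Finset.card_univ, Fintype.card_fin, nsmul_eq_mul, ← mul_assoc]
  norm_num

end NSM
end


noncomputable section

namespace NSM

variable {T : ℝ≥0∞}

/-! ### The nonlinear term at a fixed time -/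

theorem N2_wt_wt (a b : ℝ) (f : V3 → ℝ≥0∞) :
    N2 (fun ξ => wt a ξ * (wt b ξ * f ξ)) = N2 fun ξ => wt (a + b) ξ * f ξ := by
  refine N2_congr_ae ?_
  filter_upwards [ae_ne_zero] with ξ h
  rw [wt_add h, mul_assoc]

/-- The purely harmonic-analytic part. U, B, J, E, V stand for the amplitudes of u, B, j, E and ∂ₜu,
and g for a component of ∂ₜP(u × B). The hypotheses are pointwise bounds in frequency from the
equations; only the convolution inequalities are used. -/
theorem exists_N2_nonlinear_le : ∃ K : ℝ≥0, ∀ s : ℝ, 0 ≤ s → s ≤ 1 / 2 →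
    ∀ U B J E V g : V3 → ℝ≥0∞, Measurable U → Measurable B → Measurable J → Measurable E →
    Measurable V → ∀ a c : ℝ≥0∞,
    (∀ᵐ ξ, V ξ ≤ a * (wt 2 ξ * U ξ + conv U (fun η => wt 1 η * U η) ξ +
      wt (-1) ξ * conv J (fun η => wt 1 η * B η) ξ)) →
    (∀ᵐ ξ, g ξ ≤ 18 * (wt (-1) ξ * conv V (fun η => wt 1 η * B η) ξ) +
      24 * (c * conv U (fun η => wt 1 η * E η) ξ)) →
    N2 (fun ξ => wt s ξ * g ξ) ≤ K * (a + 1) *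
      ((N2 (fun ξ => wt 2 ξ * U ξ) + N2 (fun ξ => wt 0 ξ * J ξ) * N2 (fun ξ => wt (3 / 2) ξ * B ξ)) *
          N2 (fun ξ => wt (s + 3 / 2) ξ * B ξ) +
        c * (N2 (fun ξ => wt 1 ξ * U ξ) * N2 (fun ξ => wt (s + 3 / 2) ξ * E ξ)) +
        N2 (fun ξ => wt (s + 1 / 2) ξ * U ξ) * N2 (fun ξ => wt 2 ξ * U ξ) *
          N2 (fun ξ => wt (3 / 2) ξ * B ξ)) := by
  obtain ⟨K, hK⟩ := exists_conv_bounds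
  refine ⟨24 * (K + K ^ 2), fun s hs0 hs1 U B J E V g mU mB mJ mE mV a c hV hg => ?_⟩
  have mw : ∀ (r : ℝ) {f : V3 → ℝ≥0∞}, Measurable f → Measurable fun ξ => wt r ξ * f ξ :=
    fun r f hf => (measurable_wt r).mul hf
  set W : V3 → ℝ≥0∞ := fun η => wt 1 η * B η with hW
  have mW : Measurable W := mw 1 mB
  set V1 : V3 → ℝ≥0∞ := fun ξ => wt 2 ξ * U ξ with hV1
  set V2 : V3 → ℝ≥0∞ := conv U (fun η => wt 1 η * U η) with hV2
  set V3' : V3 → ℝ≥0∞ := fun ξ => wt (-1) ξ * conv J W ξ with hV3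
  have m1 : Measurable V1 := mw 2 mU
  have m2 : Measurable V2 := measurable_conv mU (mw 1 mU)
  have m3 : Measurable V3' := mw (-1) (measurable_conv mJ mW)
  set X1 : V3 → ℝ≥0∞ := fun ξ => wt (s - 1) ξ * conv V1 W ξ with hX1
  set X2 : V3 → ℝ≥0∞ := fun ξ => wt (s - 1) ξ * conv V2 W ξ with hX2
  set X3 : V3 → ℝ≥0∞ := fun ξ => wt (s - 1) ξ * conv V3' W ξ with hX3
  set X4 : V3 → ℝ≥0∞ := fun ξ => wt s ξ * conv U (fun η => wt 1 η * E η) ξ with hX4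
  have mX1 : Measurable X1 := mw _ (measurable_conv m1 mW)
  have mX2 : Measurable X2 := mw _ (measurable_conv m2 mW)
  have mX3 : Measurable X3 := mw _ (measurable_conv m3 mW)
  have mX4 : Measurable X4 := mw _ (measurable_conv mU (mw 1 mE))
  set n2U := N2 V1
  set n1U := N2 (fun ξ => wt 1 ξ * U ξ)
  set nsU := N2 (fun ξ => wt (s + 1 / 2) ξ * U ξ)
  set n0J := N2 (fun ξ => wt 0 ξ * J ξ)
  set nB := N2 (fun ξ => wt (3 / 2) ξ * B ξ)
  set nsB := N2 (fun ξ => wt (s + 3 / 2) ξ * B ξ)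
  set nsE := N2 (fun ξ => wt (s + 3 / 2) ξ * E ξ)
  have eB : ∀ r : ℝ, N2 (fun ξ => wt r ξ * W ξ) = N2 fun ξ => wt (r + 1) ξ * B ξ :=
    fun r => N2_wt_wt r 1 B
  have eB1 : N2 (fun ξ => wt (s + 1 / 2) ξ * W ξ) = nsB := by
    rw [eB, show s + 1 / 2 + 1 = s + 3 / 2 by ring]
  have eB2 : N2 (fun ξ => wt (1 / 2) ξ * W ξ) = nB := by
    rw [eB, show (1 : ℝ) / 2 + 1 = 3 / 2 by ring]
  have b1 : N2 X1 ≤ K * (n2U * nsB) := by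
    have := (hK s hs0 hs1 V1 W m1 mW).1
    rwa [eB1, hV1, N2_wt_wt, zero_add] at this
  -- The convective part of ∂ₜu is placed in Ḣˢ rather than L²: ∇u is measured in Ḣ¹ and u in
  -- Ḣ^{s+1/2}, so that B is needed only in Ḣ^{3/2} afterwards.
  have b2' : N2 (fun ξ => wt s ξ * V2 ξ) ≤ K * (n2U * nsU) := by
    have := (hK s hs0 hs1 (fun η => wt 1 η * U η) U (mw 1 mU) mU).2.2
    rw [N2_wt_wt, show (1 : ℝ) + 1 = 2 by norm_num] at this
    refine le_trans (le_of_eq ?_) this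
    simp only [hV2, conv_comm mU (mw 1 mU)]
  have b2 : N2 X2 ≤ K * (K * (n2U * nsU) * nB) := by
    refine (hK s hs0 hs1 V2 W m2 mW).2.1.trans ?_
    rw [eB2]
    gcongr
  -- The product law at s = 0: the gain |D|⁻¹ from the cancellation lets j in L² and ∇B in Ḣ^{1/2}
  -- produce an L² field.
  have b3' : N2 (fun ξ => wt 0 ξ * V3' ξ) ≤ K * (n0J * nB) := by
    have := (hK 0 le_rfl (by norm_num) J W mJ mW).1
    rw [zero_add, eB2, zero_sub] at this
    rwa [hV3, N2_wt_wt, zero_add]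
  have b3 : N2 X3 ≤ K * (K * (n0J * nB) * nsB) := by
    refine (hK s hs0 hs1 V3' W m3 mW).1.trans ?_
    rw [eB1]
    gcongr
  have b4 : N2 X4 ≤ K * (n1U * nsE) := by
    have := (hK s hs0 hs1 U (fun η => wt 1 η * E η) mU (mw 1 mE)).2.2
    rwa [N2_wt_wt, show s + 1 / 2 + 1 = s + 3 / 2 by ring] at this
  have hpt : ∀ᵐ ξ, wt s ξ * g ξ ≤ 18 * a * (X1 ξ + X2 ξ + X3 ξ) + 24 * c * X4 ξ := by
    filter_upwards [hg, ae_ne_zero] with ξ h hξ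
    have hc : conv V W ξ ≤ a * (conv V1 W ξ + conv V2 W ξ + conv V3' W ξ) := by
      refine (conv_mono_ae hV (ae_of_all _ fun _ => le_rfl) ξ).trans (le_of_eq ?_)
      refine (conv_const_mul_left (f := fun η => V1 η + V2 η + V3' η) ((m1.add m2).add m3) mW
        a ξ).trans ?_
      rw [conv_add_left (f := fun η => V1 η + V2 η) (m1.add m2) mW, conv_add_left m1 mW]
    have hw : wt (s - 1) ξ = wt s ξ * wt (-1) ξ := by rw [← wt_add hξ, sub_eq_add_neg]
    calc wt s ξ * g ξ ≤ wt s ξ * (18 * (wt (-1) ξ *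
          (a * (conv V1 W ξ + conv V2 W ξ + conv V3' W ξ))) +
          24 * (c * conv U (fun η => wt 1 η * E η) ξ)) := by
          refine mul_le_mul' le_rfl (h.trans ?_)
          gcongr
      _ = _ := by
          simp only [hX1, hX2, hX3, hX4, hw]
          ring
  have hN : N2 (fun ξ => wt s ξ * g ξ) ≤ 18 * a * (N2 X1 + N2 X2 + N2 X3) + 24 * c * N2 X4 := by
    refine (N2_mono_ae hpt).trans ((N2_add_le (((mX1.add mX2).add mX3).const_mul _)
      (mX4.const_mul _)).trans ?_)
    rw [N2_const_mul ((mX1.add mX2).add mX3), N2_const_mul mX4]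
    gcongr
    exact (N2_add_le (mX1.add mX2) mX3).trans (add_le_add (N2_add_le mX1 mX2) le_rfl)
  have hK1 : (K : ℝ≥0∞) ≤ K + K ^ 2 := le_self_add
  have hK2 : (K : ℝ≥0∞) ^ 2 ≤ K + K ^ 2 := le_add_self
  calc _ ≤ _ := hN
    _ ≤ 18 * a * (K * (n2U * nsB) + K * (K * (n2U * nsU) * nB) + K * (K * (n0J * nB) * nsB)) +
        24 * c * (K * (n1U * nsE)) := by gcongr
    _ = 18 * a * ((K : ℝ≥0∞) * (n2U * nsB) + (K : ℝ≥0∞) ^ 2 * ((n2U * nsU) * nB) +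
        (K : ℝ≥0∞) ^ 2 * ((n0J * nB) * nsB)) + 24 * c * (K * (n1U * nsE)) := by ring
    _ ≤ 24 * (a + 1) * ((K + K ^ 2 : ℝ≥0∞) * (n2U * nsB) + (K + K ^ 2 : ℝ≥0∞) * ((n2U * nsU) * nB) +
        (K + K ^ 2 : ℝ≥0∞) * ((n0J * nB) * nsB)) +
        24 * (a + 1) * c * ((K + K ^ 2 : ℝ≥0∞) * (n1U * nsE)) := by
        have h1 : a ≤ a + 1 := le_self_add
        have h2 : 24 * c ≤ 24 * (a + 1) * c := by
          calc 24 * c = 24 * 1 * c := by ring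
            _ ≤ _ := by gcongr; exact le_add_self
        gcongr
        norm_num
    _ = _ := by push_cast; ring

theorem NoSwirl.congr {F G : Fin 3 → ℝ → V3 → ℝ} (h : NoSwirl T F)
    (e : ∀ i, ∀ t ∈ timeI T, ∀ x, G i t x = F i t x) : NoSwirl T G where
  tang t ht x := by rw [e _ t ht, e _ t ht]; exact h.tang t ht x
  equi0 t ht x := by
    rw [Dm_congr (e 0) _ t ht, Dm_congr (e 0) _ t ht, e 1 t ht]; exact h.equi0 t ht x
  equi1 t ht x := by
    rw [Dm_congr (e 1) _ t ht, Dm_congr (e 1) _ t ht, e 0 t ht]; exact h.equi1 t ht x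
  equi2 t ht x := by
    rw [Dm_congr (e 2) _ t ht, Dm_congr (e 2) _ t ht]; exact h.equi2 t ht x

/-- The axisymmetric structure of the solution. -/
structure Axi (T : ℝ≥0∞) (u E B : Fin 3 → ℝ → V3 → ℝ) : Prop where
  u : NoSwirl T u
  E : NoSwirl T E
  B : PureSwirl T B

variable {ν σ c : ℝ} {u E B j : Fin 3 → ℝ → V3 → ℝ}

/-- No symmetry of j is assumed; Ampère's law writes it as curl B - c⁻¹∂ₜE, and both terms are
without swirl. -/
theorem Sys.noSwirl_j (h : Sys ν σ c T u E B j) (hT : 0 < T) (ha : Axi T u E B) : NoSwirl T j :=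
  (NoSwirl.sub_const_mul hT (SC.crl hT h.hB) (fun i => (h.hE i).Dm hT none)
    (PureSwirl.noSwirl_crl hT h.hB ha.B) (NoSwirl.dt hT h.hE ha.E) c⁻¹).congr h.ampere

theorem dvg_Dm_none (hT : 0 < T) {F : Fin 3 → ℝ → V3 → ℝ} (hF : ∀ i, SC T (F i))
    (hd : ∀ t ∈ timeI T, ∀ x, dvg T F t x = 0) :
    ∀ t ∈ timeI T, ∀ x, dvg T (fun i => Dm T none (F i)) t x = 0 := by
  intro t ht x
  have h1 := Dm_congr (g := fun _ _ => 0) hd none t ht x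
  have e : dvg T F = fun t x => Dm T (some 0) (F 0) t x + Dm T (some 1) (F 1) t x +
      Dm T (some 2) (F 2) t x := by
    funext t x; exact Fin.sum_univ_three _
  rw [Dm_zero, e, Dm_add hT (((hF 0).Dm hT _).add hT ((hF 1).Dm hT _)) ((hF 2).Dm hT _) none t ht,
    Dm_add hT ((hF 0).Dm hT _) ((hF 1).Dm hT _) none t ht, Dm_comm hT (hF 0) none _ t ht,
    Dm_comm hT (hF 1) none _ t ht, Dm_comm hT (hF 2) none _ t ht] at h1
  rw [dvg, Fin.sum_univ_three]
  exact h1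

theorem enorm_two_pi_norm (ξ : V3) : ‖((2 * Real.pi * ‖ξ‖ : ℝ) : ℂ) ^ 2‖ₑ = wt 2 ξ := by
  rw [enorm_pow, ← ofReal_norm, Complex.norm_real, Real.norm_of_nonneg (by positivity), wt]
  exact (ENNReal.rpow_natCast _ 2).symm

/-- Apply Leray's projector to the momentum equation: u and ∂ₜu are solenoidal and unchanged, the
pressure gradient disappears, and the cancellation is used on j × B. -/
theorem Sys.amp_dtu_le (h : Sys ν σ c T u E B j) (hT : 0 < T) (ha : Axi T u E B) (hν : 0 < ν)
    {t : ℝ} (ht : t ∈ timeI T) :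
    ∀ᵐ ξ, amp (fun i => Dm T none (u i)) t ξ ≤ 3 * (ENNReal.ofReal ν + 18) *
      (wt 2 ξ * amp u t ξ + conv (amp u t) (fun η => wt 1 η * amp u t η) ξ +
        wt (-1) ξ * conv (amp j t) (fun η => wt 1 η * amp B t η) ξ) := by
  have hP := SC.gradP hT ν h.hu h.hj h.hB
  have hC := SC.cnv hT h.hu h.hu
  have hX := SC.crs hT h.hj h.hB
  have hP0 : ∀ i, ∀ᵐ ξ, lerayFt (fun k => gradP ν T u j B k t) i ξ = 0 := by
    intro i
    have h0 : ∀ l, ft (crl T (gradP ν T u j B) l t) =ᵐ[volume] fun _ => 0 := by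
      intro l
      have : crl T (gradP ν T u j B) l t = fun x => (0 : ℝ) * u 0 t x := by
        ext x; rw [zero_mul]; exact h.momentum l t ht x
      rw [this]
      filter_upwards [ft_const_mul ((h.hu 0).memLp ht) 0] with ξ h
      rw [h]; simp
    filter_upwards [enorm_lerayFt_le_crl hT hP ht i, h0 0, h0 1, h0 2] with ξ a a0 a1 a2
    rw [Fin.sum_univ_three, a0, a1, a2] at a
    simpa using a
  have hd := sum_mul_ft_eq_zero hT h.hu h.div_u ht
  have hd' := sum_mul_ft_eq_zero hT (fun i => (h.hu i).Dm hT none)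
    (dvg_Dm_none hT h.hu h.div_u) ht
  have hG : ∀ i, ∀ᵐ ξ, ft (gradP ν T u j B i t) ξ = ft (Dm T none (u i) t) ξ +
      ft (cnv T u u i t) ξ - ν * ft (lap T (u i) t) ξ - ft (crs j B i t) ξ := by
    intro i
    have q1 := ((h.hu i).Dm hT none).memLp ht
    have q2 := (hC i).memLp ht
    have q3 := ((h.hu i).lap hT).memLp ht
    have q4 := (hX i).memLp ht
    filter_upwards [ft_sub ((q1.add q2).sub (q3.const_mul ν)) q4, ft_sub (q1.add q2)
      (q3.const_mul ν), ft_add q1 q2, ft_const_mul q3 ν] with ξ a1 a2 a3 a4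
    rw [show ft (gradP ν T u j B i t) ξ = _ from a1, show ft ((Dm T none (u i) t + cnv T u u i t) -
      fun x => ν * lap T (u i) t x) ξ = _ from a2, show ft (Dm T none (u i) t + cnv T u u i t) ξ = _
      from a3, a4]
  filter_upwards [hd, hd', ae_all_iff.2 hG, ae_all_iff.2 hP0,
    ae_all_iff.2 fun i => ft_lap hT (h.hu i) ht,
    ae_all_iff.2 fun i => enorm_ft_cnv_le hT h.hu h.hu ht i,
    ae_all_iff.2 fun i => enorm_lerayFt_crs_le hT (h.noSwirl_j hT ha) ha.B h.hj h.hB h.div_j h.div_B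
      ht i] with ξ d d' g p l n x
  rw [mul_assoc]
  refine amp_le_of_forall fun i => ?_
  have e : ft (Dm T none (u i) t) ξ = -(ν * (((2 * Real.pi * ‖ξ‖ : ℝ) : ℂ) ^ 2 * ft (u i t) ξ)) -
      lerayFt (fun k => cnv T u u k t) i ξ + lerayFt (fun k => crs j B k t) i ξ := by
    have h1 := p i
    have f1 := leray_sum_eq (fun k => ft (Dm T none (u k) t) ξ) i ξ
    have f2 := leray_sum_eq (fun k => ft (u k t) ξ) i ξ
    rw [d', zero_mul, zero_div, sub_zero] at f1
    rw [d, zero_mul, zero_div, sub_zero] at f2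
    simp only [lerayFt, g, l] at h1 ⊢
    rw [← f1, ← f2]
    simp only [Fin.sum_univ_three] at h1 ⊢
    linear_combination h1
  rw [e]
  have k1 : ‖(ν : ℂ) * (((2 * Real.pi * ‖ξ‖ : ℝ) : ℂ) ^ 2 * ft (u i t) ξ)‖ₑ ≤
      ENNReal.ofReal ν * (wt 2 ξ * amp u t ξ) := by
    rw [enorm_mul, enorm_mul, enorm_two_pi_norm, ← ofReal_norm (ν : ℂ), Complex.norm_real,
      Real.norm_of_nonneg hν.le]
    gcongr
    exact enorm_ft_le_amp u t i ξ
  have k2 := enorm_lerayFt_le (fun k => cnv T u u k t) i ξ n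
  refine (enorm_add_le _ _).trans ((add_le_add ((enorm_sub_le).trans (add_le_add
    ((enorm_neg _).trans_le k1) k2)) (x i)).trans ?_)
  set X := wt 2 ξ * amp u t ξ
  set Y := conv (amp u t) (fun η => wt 1 η * amp u t η) ξ
  set Z := wt (-1) ξ * conv (amp j t) (fun η => wt 1 η * amp B t η) ξ
  calc ENNReal.ofReal ν * X + 6 * (3 * Y) + 18 * Z = ENNReal.ofReal ν * X + 18 * Y + 18 * Z := by
        ring
    _ ≤ (ENNReal.ofReal ν + 18) * X + (ENNReal.ofReal ν + 18) * Y + (ENNReal.ofReal ν + 18) * Z := by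
        gcongr <;> first | exact le_self_add | exact le_add_self
    _ = _ := by ring

/-- The Fourier transform of `∂ₜ P (u × B)`. -/
def nlFt (T : ℝ≥0∞) (u B : Fin 3 → ℝ → V3 → ℝ) (i : Fin 3) (t : ℝ) : V3 → ℂ :=
  lerayFt (fun k => Dm T none (crs u B k) t) i

/-- The cancellation applies to ∂ₜu × B because ∂ₜu is still solenoidal and without swirl. In u ×
∂ₜB, Faraday's law is used directly; 24 = 6 · 2 · 2 comes from the projector, the vector product and
the curl. -/
theorem Sys.enorm_nlFt_le (h : Sys ν σ c T u E B j) (hT : 0 < T) (ha : Axi T u E B) (hc : 0 < c)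
    {t : ℝ} (ht : t ∈ timeI T) (i : Fin 3) :
    ∀ᵐ ξ, ‖nlFt T u B i t ξ‖ₑ ≤ 18 * (wt (-1) ξ * conv (amp (fun i => Dm T none (u i)) t)
        (fun η => wt 1 η * amp B t η) ξ) +
      24 * (ENNReal.ofReal c * conv (amp u t) (fun η => wt 1 η * amp E t η) ξ) := by
  have hu' : ∀ i, SC T (Dm T none (u i)) := fun i => (h.hu i).Dm hT none
  have hB' : ∀ i, SC T (Dm T none (B i)) := fun i => (h.hB i).Dm hT none
  have e : ∀ k, Dm T none (crs u B k) t = fun x => crs (fun i => Dm T none (u i)) B k t x +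
      crs u (fun i => Dm T none (B i)) k t x := by
    intro k
    funext x
    refine (Dm_sub hT ((h.hu (k + 1)).mul hT (h.hB (k + 2))) ((h.hu (k + 2)).mul hT (h.hB (k + 1)))
      none t ht x).trans ?_
    rw [Dm_mul hT (h.hu _) (h.hB _) none t ht x, Dm_mul hT (h.hu _) (h.hB _) none t ht x, crs, crs]
    ring
  have hb : ∀ i, ∀ᵐ ξ, ‖ft (Dm T none (B i) t) ξ‖ₑ ≤
      2 * ENNReal.ofReal c * (wt 1 ξ * amp E t ξ) := by
    intro i
    have : Dm T none (B i) t = fun x => -c * crl T E i t x := funext fun x => h.faraday i t ht x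
    rw [this]
    filter_upwards [ft_const_mul ((SC.crl hT h.hE i).memLp ht) (-c),
      enorm_ft_crl_le hT h.hE ht i] with ξ a b
    rw [a, enorm_mul, ← ofReal_norm (((-c : ℝ)) : ℂ), Complex.norm_real, norm_neg,
      Real.norm_of_nonneg hc.le]
    calc _ ≤ _ := mul_le_mul' le_rfl b
      _ = _ := by ring
  filter_upwards [ae_all_iff.2 fun k => ft_add ((SC.crs hT hu' h.hB k).memLp ht)
      ((SC.crs hT h.hu hB' k).memLp ht),
    enorm_lerayFt_crs_le hT (NoSwirl.dt hT h.hu ha.u) ha.B hu' h.hB (dvg_Dm_none hT h.hu h.div_u)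
      h.div_B ht i, ae_all_iff.2 fun k => enorm_ft_crs_le hT h.hu hB' ht hb k] with ξ a b d
  have e2 : nlFt T u B i t ξ = lerayFt (fun k => crs (fun i => Dm T none (u i)) B k t) i ξ +
      lerayFt (fun k => crs u (fun i => Dm T none (B i)) k t) i ξ := by
    simp only [nlFt, lerayFt, e, ← Finset.sum_add_distrib, ← mul_add]
    exact Finset.sum_congr rfl fun k _ => congrArg _ (a k)
  rw [e2]
  refine (enorm_add_le _ _).trans (add_le_add b ((enorm_lerayFt_le _ i ξ d).trans ?_))
  rw [conv_const_mul_right (measurable_amp u t) (measurable_wt_mul_amp 1 E t)]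
  refine le_of_eq ?_
  ring

theorem exists_N2_nlFt_le (hν : 0 < ν) : ∃ K : ℝ≥0, ∀ {σ c : ℝ} {T : ℝ≥0∞}
    {u E B j : Fin 3 → ℝ → V3 → ℝ}, 0 < c → 0 < T → Sys ν σ c T u E B j → Axi T u E B →
    ∀ s : ℝ, 0 ≤ s → s ≤ 1 / 2 → ∀ t ∈ timeI T, ∀ i,
    N2 (fun ξ => wt s ξ * ‖nlFt T u B i t ξ‖ₑ) ≤ K *
      ((Hs 2 u t + Hs 0 j t * Hs (3 / 2) B t) * Hs (s + 3 / 2) B t +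
        ENNReal.ofReal c * (Hs 1 u t * Hs (s + 3 / 2) E t) +
        Hs (s + 1 / 2) u t * Hs 2 u t * Hs (3 / 2) B t) := by
  obtain ⟨K, hK⟩ := exists_N2_nonlinear_le
  refine ⟨K * (3 * (ν.toNNReal + 18) + 1), fun hc hT h ha s hs0 hs1 t ht i => ?_⟩
  refine (hK s hs0 hs1 _ _ _ _ _ _ (measurable_amp _ t) (measurable_amp _ t) (measurable_amp _ t)
    (measurable_amp _ t) (measurable_amp _ t) _ _ (h.amp_dtu_le hT ha hν ht)
    (h.enorm_nlFt_le hT ha hc ht i)).trans (le_of_eq ?_)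
  push_cast
  rfl

/-- Interpolation of homogeneous norms. -/
theorem Hs_interpolate {s : ℝ} (hs0 : 0 ≤ s) (hs1 : s ≤ 1 / 2) (F : Fin 3 → ℝ → V3 → ℝ) (t : ℝ) :
    Hs (s + 1 / 2) F t ≤ Hs 0 F t ^ (1 / 2 - s) * Hs 1 F t ^ (s + 1 / 2) := by
  have hp : 0 ≤ 1 / 2 - s := by linarith
  have hq : 0 ≤ s + 1 / 2 := by linarith
  have h := ENNReal.lintegral_mul_norm_pow_le (μ := (volume : Measure V3))
    (f := fun ξ => (wt 0 ξ * amp F t ξ) ^ 2) (g := fun ξ => (wt 1 ξ * amp F t ξ) ^ 2)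
    ((measurable_wt_mul_amp 0 F t).pow_const 2).aemeasurable
    ((measurable_wt_mul_amp 1 F t).pow_const 2).aemeasurable hp hq (by ring)
  have e : ∀ ξ, ((wt 0 ξ * amp F t ξ) ^ 2) ^ (1 / 2 - s) * ((wt 1 ξ * amp F t ξ) ^ 2) ^ (s + 1 / 2) =
      (wt (s + 1 / 2) ξ * amp F t ξ) ^ 2 := by
    intro ξ
    have hw : wt (s + 1 / 2) ξ = wt 1 ξ ^ (s + 1 / 2) := by rw [wt_one]; rfl
    rw [wt_zero, one_mul, hw, mul_pow, ENNReal.mul_rpow_of_nonneg _ _ hq, mul_left_comm,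
      ← ENNReal.rpow_add_of_nonneg _ _ hp hq, show 1 / 2 - s + (s + 1 / 2) = 1 by ring,
      ENNReal.rpow_one, mul_pow]
    congr 1
    simp only [← ENNReal.rpow_natCast, ← ENNReal.rpow_mul]
    rw [mul_comm]
  simp only [e] at h
  have h2 := ENNReal.rpow_le_rpow h (show (0 : ℝ) ≤ 1 / 2 by norm_num)
  rw [ENNReal.mul_rpow_of_nonneg _ _ (by norm_num)] at h2
  refine h2.trans (le_of_eq ?_)
  simp only [Hs, N2, ← ENNReal.rpow_mul, mul_comm]

end NSM
end


noncomputable section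

namespace NSM

variable {T : ℝ≥0∞} {ν σ c : ℝ} {u E B j : Fin 3 → ℝ → V3 → ℝ}

/-! ### The energy inequality -/

theorem inner_toL2 {f g : V3 → ℝ} (hf : MemLp f 2 volume) (hg : MemLp g 2 volume) :
    inner ℂ (toL2 f) (toL2 g) = ((∫ x, f x * g x : ℝ) : ℂ) := by
  rw [L2.inner_def, ← integral_complex_ofReal]
  refine integral_congr_ae ?_
  filter_upwards [coeFn_toL2 hf, coeFn_toL2 hg] with x h1 h2
  rw [h1, h2]
  simp [mul_comm]

theorem norm_sq_toL2 {f : V3 → ℝ} (hf : MemLp f 2 volume) : ‖toL2 f‖ ^ 2 = ∫ x, f x * f x := by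
  have h := inner_toL2 hf hf
  rw [inner_self_eq_norm_sq_to_K] at h
  refine Complex.ofReal_injective (Eq.trans ?_ h)
  push_cast
  rfl

theorem hasDerivWithinAt_norm_sq_complex {H : Type*} [NormedAddCommGroup H] [InnerProductSpace ℂ H]
    {f : ℝ → H} {f' : H} {s : Set ℝ} {t : ℝ} (hf : HasDerivWithinAt f f' s t) :
    HasDerivWithinAt (fun τ => ‖f τ‖ ^ 2) (2 * (inner ℂ (f t) f').re) s t := by
  let _ : InnerProductSpace ℝ H := InnerProductSpace.rclikeToReal ℂ H
  exact hf.norm_sq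

theorem SC.integrable_mul {f g : ℝ → V3 → ℝ} (hf : SC T f) (hg : SC T g) {t : ℝ}
    (ht : t ∈ timeI T) : Integrable (fun x => f t x * g t x) volume :=
  (hf.memLp ht).integrable_mul (hg.memLp ht)

theorem SC.hasDerivWithinAt_norm_sq (hT : 0 < T) {f : ℝ → V3 → ℝ} (hf : SC T f) {t : ℝ}
    (ht : t ∈ timeI T) : HasDerivWithinAt (fun τ => ‖toL2 (f τ)‖ ^ 2)
      (2 * ∫ x, f t x * NSM.Dm T none f t x) (timeI T) t := by
  have h := hasDerivWithinAt_norm_sq_complex (hf.hasDerivWithinAt_toL2 hT ht)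
  rwa [inner_toL2 (hf.memLp ht) ((hf.Dm hT none).memLp ht), Complex.ofReal_re] at h

theorem integral_mul_Dm (hT : 0 < T) {f g : ℝ → V3 → ℝ} (hf : SC T f) (hg : SC T g) {t : ℝ}
    (ht : t ∈ timeI T) (k : Fin 3) :
    ∫ x, f t x * Dm T (some k) g t x = - ∫ x, Dm T (some k) f t x * g t x := by
  have h1 := (hf.Dm hT (some k)).integrable_mul hg ht
  have h2 := hf.integrable_mul (hg.Dm hT (some k)) ht
  have h3 := hf.integrable_mul hg ht
  simp only [Dm_some hf k ht, Dm_some hg k ht] at h1 h2 ⊢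
  exact integral_mul_fderiv_eq_neg_fderiv_mul_of_integrable h1 h2 h3
    (fun x _ => hf.differentiable ht x) fun x _ => hg.differentiable ht x

/-- A solenoidal field only sees the Leray projection of another field. -/
theorem sum_integral_mul_eq_of_leray (hT : 0 < T) {F G H : Fin 3 → ℝ → V3 → ℝ}
    (hF : ∀ i, SC T (F i)) (hG : ∀ i, SC T (G i)) (hH : ∀ i, SC T (H i))
    (hd : ∀ t ∈ timeI T, ∀ x, dvg T F t x = 0) {t : ℝ} (ht : t ∈ timeI T)
    (h : ∀ i, ∀ᵐ ξ, lerayFt (fun k => G k t) i ξ = ft (H i t) ξ) :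
    ∑ i, ∫ x, F i t x * G i t x = ∑ i, ∫ x, F i t x * H i t x := by
  have hi : ∀ f g : V3 → ℝ, Integrable (fun ξ => ft f ξ * (starRingEnd ℂ) (ft g ξ)) volume :=
    fun f g => (memLp_ft f).integrable_mul (memLp_ft g).star
  have e : ((∑ i, ∫ x, F i t x * G i t x : ℝ) : ℂ) = ((∑ i, ∫ x, F i t x * H i t x : ℝ) : ℂ) := by
    push_cast
    simp only [integral_mul_eq_re_inner ((hF _).memLp ht) ((hG _).memLp ht),
      integral_mul_eq_re_inner ((hF _).memLp ht) ((hH _).memLp ht)]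
    rw [← integral_finsetSum _ fun i _ => hi _ _, ← integral_finsetSum _ fun i _ => hi _ _]
    refine integral_congr_ae ?_
    filter_upwards [sum_mul_ft_eq_zero hT hF hd ht, ae_all_iff.2 h] with ξ h1 h2
    simp only [← h2, lerayFt, leray_sum_eq, map_sub, mul_sub, Finset.sum_sub_distrib]
    rw [eq_comm, sub_eq_self]
    simp only [map_div₀, map_mul, Complex.conj_ofReal]
    set S := (starRingEnd ℂ) (∑ k, (ξ k : ℂ) * ft (G k t) ξ)
    have : ∀ i, ft (F i t) ξ * (S * (ξ i : ℂ) / (starRingEnd ℂ) ((‖ξ‖ : ℂ) ^ 2)) =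
        ((ξ i : ℂ) * ft (F i t) ξ) * (S / (starRingEnd ℂ) ((‖ξ‖ : ℂ) ^ 2)) := fun i => by ring
    simp only [this]
    rw [← Finset.sum_mul, h1, zero_mul]
  exact_mod_cast e

/-- A solenoidal field is orthogonal to a curl-free one. Working with the residual, which is in L²,
avoids integrating the pressure itself by parts. -/
theorem sum_integral_mul_gradP (h : Sys ν σ c T u E B j) (hT : 0 < T) {t : ℝ} (ht : t ∈ timeI T) :
    ∑ i, ∫ x, u i t x * gradP ν T u j B i t x = 0 := by
  have hP := SC.gradP hT ν h.hu h.hj h.hB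
  have hz : ft (fun _ => (0 : ℝ)) =ᵐ[volume] fun _ => 0 := by
    filter_upwards [ft_const_mul ((h.hu 0).memLp ht) 0] with ξ a
    simpa using a
  rw [sum_integral_mul_eq_of_leray hT h.hu hP (H := fun _ _ _ => 0) (fun _ => SC.zero) h.div_u ht]
  · simp
  intro i
  have h0 : ∀ l, crl T (gradP ν T u j B) l t = fun _ => 0 := fun l =>
    funext fun x => h.momentum l t ht x
  filter_upwards [enorm_lerayFt_le_crl hT hP ht i, hz] with ξ a b
  simp only [h0, b] at a ⊢
  simpa using a

theorem sum_integral_j_mul (h : Sys ν σ c T u E B j) (hT : 0 < T) (hσ : 0 < σ) {t : ℝ}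
    (ht : t ∈ timeI T) :
    ∑ i, ∫ x, j i t x * crs u B i t x = ∑ i, ∫ x, j i t x * (σ⁻¹ * j i t x - c * E i t x) := by
  have hσ' : (σ : ℂ) ≠ 0 := by exact_mod_cast hσ.ne'
  refine sum_integral_mul_eq_of_leray hT h.hj (SC.crs hT h.hu h.hB)
    (H := fun i t x => σ⁻¹ * j i t x - c * E i t x)
    (fun i => ((h.hj i).const_mul hT _).sub hT ((h.hE i).const_mul hT _)) h.div_j ht fun i => ?_
  have m1 := ((h.hj i).const_mul hT σ⁻¹).memLp ht
  have m2 := ((h.hE i).const_mul hT c).memLp ht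
  filter_upwards [h.ohm i t ht, ft_sub m1 m2, ft_const_mul ((h.hj i).memLp ht) σ⁻¹,
    ft_const_mul ((h.hE i).memLp ht) c] with ξ a b d e
  rw [b, d, e, a, lerayFt]
  push_cast
  field_simp
  ring

theorem sum_integral_mul_cnv (hT : 0 < T) (hu : ∀ i, SC T (u i))
    (hd : ∀ t ∈ timeI T, ∀ x, dvg T u t x = 0) {t : ℝ} (ht : t ∈ timeI T) :
    ∑ i, ∫ x, u i t x * cnv T u u i t x = 0 := by
  refine Finset.sum_eq_zero fun i _ => ?_
  have hs := (hu i).mul hT (hu i)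
  have e1 : ∀ x, u i t x * cnv T u u i t x =
      ∑ k, 2⁻¹ * (u k t x * Dm T (some k) (fun t x => u i t x * u i t x) t x) := by
    intro x
    rw [cnv, Finset.mul_sum]
    refine Finset.sum_congr rfl fun k _ => ?_
    rw [Dm_mul hT (hu i) (hu i) (some k) t ht x]
    ring
  have e2 : ∀ x, ∑ k, Dm T (some k) (u k) t x * (u i t x * u i t x) = 0 := by
    intro x
    rw [← Finset.sum_mul]
    exact mul_eq_zero_of_left (hd t ht x) _
  simp only [e1]
  rw [integral_finsetSum _ fun k _ => ((hu k).integrable_mul (hs.Dm hT (some k)) ht).const_mul _]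
  simp only [integral_const_mul, integral_mul_Dm hT (hu _) hs ht]
  rw [← Finset.mul_sum, Finset.sum_neg_distrib,
    ← integral_finsetSum _ fun k _ => ((hu k).Dm hT (some k)).integrable_mul hs ht]
  simp only [e2]
  simp

theorem integral_mul_lap_nonpos (hT : 0 < T) {f : ℝ → V3 → ℝ} (hf : SC T f) {t : ℝ}
    (ht : t ∈ timeI T) : ∫ x, f t x * lap T f t x ≤ 0 := by
  simp only [lap, Finset.mul_sum]
  rw [integral_finsetSum _ fun k _ => hf.integrable_mul ((hf.Dm hT (some k)).Dm hT (some k)) ht]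
  refine Finset.sum_nonpos fun k _ => ?_
  rw [integral_mul_Dm hT hf (hf.Dm hT (some k)) ht]
  exact neg_nonpos.2 (integral_nonneg fun x => mul_self_nonneg _)

theorem integral_mul_crl (hT : 0 < T) {F G : Fin 3 → ℝ → V3 → ℝ} (hF : ∀ i, SC T (F i))
    (hG : ∀ i, SC T (G i)) {t : ℝ} (ht : t ∈ timeI T) :
    ∑ i, ∫ x, F i t x * crl T G i t x = ∑ i, ∫ x, G i t x * crl T F i t x := by
  have key : ∀ {F G : Fin 3 → ℝ → V3 → ℝ}, (∀ i, SC T (F i)) → (∀ i, SC T (G i)) → ∀ i,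
      ∫ x, F i t x * crl T G i t x = (∫ x, F i t x * Dm T (some (i + 1)) (G (i + 2)) t x) -
        ∫ x, F i t x * Dm T (some (i + 2)) (G (i + 1)) t x := by
    intro F G hF hG i
    simp only [crl, mul_sub]
    exact integral_sub ((hF i).integrable_mul ((hG (i + 2)).Dm hT _) ht)
      ((hF i).integrable_mul ((hG (i + 1)).Dm hT _) ht)
  have ib : ∀ i k l, ∫ x, F i t x * Dm T (some k) (G l) t x =
      - ∫ x, G l t x * Dm T (some k) (F i) t x := by
    intro i k l
    rw [integral_mul_Dm hT (hF i) (hG l) ht]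
    simp only [mul_comm]
  simp only [key hF hG, key hG hF, Fin.sum_univ_three, fin3_add, ib]
  ring

/-- Convection and pressure do no work, the two curl terms cancel, and viscosity has a sign. The
work of the Lorentz force, -∫ j·(u × B), equals -∫ j·(σ⁻¹j - cE) by Ohm's law since j is solenoidal;
its electric part cancels against Ampère's law and the Ohmic dissipation remains. -/
theorem Sys.energy_deriv_le (h : Sys ν σ c T u E B j) (hT : 0 < T) (hν : 0 < ν) (hσ : 0 < σ)
    (hc : 0 < c) {t : ℝ} (ht : t ∈ timeI T) :
    ∑ i, ((∫ x, u i t x * Dm T none (u i) t x) + (∫ x, E i t x * Dm T none (E i) t x) +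
      ∫ x, B i t x * Dm T none (B i) t x) ≤ -(σ⁻¹ * ∑ i, ∫ x, j i t x * j i t x) := by
  have hP := SC.gradP hT ν h.hu h.hj h.hB
  have hC := SC.cnv hT h.hu h.hu
  have hX := SC.crs hT h.hj h.hB
  have hX' := SC.crs hT h.hu h.hB
  have e1 : ∀ i, ∫ x, u i t x * Dm T none (u i) t x = (∫ x, u i t x * gradP ν T u j B i t x) -
      (∫ x, u i t x * cnv T u u i t x) + ν * (∫ x, u i t x * lap T (u i) t x) +
      ∫ x, u i t x * crs j B i t x := by
    intro i
    have m1 := (h.hu i).integrable_mul (hP i) ht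
    have m2 := (h.hu i).integrable_mul (hC i) ht
    have m3 := ((h.hu i).integrable_mul ((h.hu i).lap hT) ht).const_mul ν
    have m4 := (h.hu i).integrable_mul (hX i) ht
    have m5 : Integrable (fun x => u i t x * gradP ν T u j B i t x - u i t x * cnv T u u i t x)
      volume := m1.sub m2
    have m6 : Integrable (fun x => u i t x * gradP ν T u j B i t x - u i t x * cnv T u u i t x +
      ν * (u i t x * lap T (u i) t x)) volume := m5.add m3
    rw [← integral_const_mul, ← integral_sub m1 m2, ← integral_add m5 m3, ← integral_add m6 m4]
    refine integral_congr_ae (ae_of_all _ fun x => ?_)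
    simp only [gradP]
    ring
  have e2 : ∀ i, ∫ x, E i t x * Dm T none (E i) t x = c * (∫ x, E i t x * crl T B i t x) -
      c * ∫ x, j i t x * E i t x := by
    intro i
    have m1 := ((h.hE i).integrable_mul (SC.crl hT h.hB i) ht).const_mul c
    have m2 := ((h.hj i).integrable_mul (h.hE i) ht).const_mul c
    rw [← integral_const_mul, ← integral_const_mul, ← integral_sub m1 m2]
    refine integral_congr_ae (ae_of_all _ fun x => ?_)
    simp only [h.ampere i t ht x]
    field_simp
    ring
  have e3 : ∀ i, ∫ x, B i t x * Dm T none (B i) t x = - (c * ∫ x, B i t x * crl T E i t x) := by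
    intro i
    rw [← integral_const_mul, ← integral_neg]
    refine integral_congr_ae (ae_of_all _ fun x => ?_)
    simp only [h.faraday i t ht x]
    ring
  have e4 : ∑ i, ∫ x, u i t x * crs j B i t x = - ∑ i, ∫ x, j i t x * crs u B i t x := by
    rw [← integral_finsetSum _ fun i _ => (h.hu i).integrable_mul (hX i) ht,
      ← integral_finsetSum _ fun i _ => (h.hj i).integrable_mul (hX' i) ht, ← integral_neg]
    refine integral_congr_ae (ae_of_all _ fun x => ?_)
    simp only [crs, Fin.sum_univ_three, fin3_add]
    ring
  have e5 : ∑ i, ∫ x, j i t x * (σ⁻¹ * j i t x - c * E i t x) =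
      σ⁻¹ * (∑ i, ∫ x, j i t x * j i t x) - c * ∑ i, ∫ x, j i t x * E i t x := by
    rw [Finset.mul_sum, Finset.mul_sum, ← Finset.sum_sub_distrib]
    refine Finset.sum_congr rfl fun i _ => ?_
    rw [← integral_const_mul, ← integral_const_mul, ← integral_sub
      (((h.hj i).integrable_mul (h.hj i) ht).const_mul _)
      (((h.hj i).integrable_mul (h.hE i) ht).const_mul _)]
    refine integral_congr_ae (ae_of_all _ fun x => ?_)
    ring
  have f1 := sum_integral_mul_gradP h hT ht
  have f2 := sum_integral_mul_cnv hT h.hu h.div_u ht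
  have f3 : ν * ∑ i, ∫ x, u i t x * lap T (u i) t x ≤ 0 :=
    mul_nonpos_of_nonneg_of_nonpos hν.le
      (Finset.sum_nonpos fun i _ => integral_mul_lap_nonpos hT (h.hu i) ht)
  have f4 := sum_integral_j_mul h hT hσ ht
  have f5 := integral_mul_crl hT h.hE h.hB ht
  simp only [e1, e2, e3, Finset.sum_add_distrib, Finset.sum_sub_distrib, Finset.sum_neg_distrib,
    ← Finset.mul_sum]
  rw [f1, f2, e4, f4, e5, f5]
  linarith

theorem Sys.lintegral_j_le (h : Sys ν σ c T u E B j) (hT : 0 < T) (hν : 0 < ν) (hσ : 0 < σ)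
    (hc : 0 < c) {t : ℝ} (ht : t ∈ timeI T) :
    ∫⁻ τ in Icc 0 t, ∑ i, eLpNorm (j i τ) 2 volume ^ 2 ≤ ENNReal.ofReal (σ / 2) *
      ∑ i, (eLpNorm (u i 0) 2 volume ^ 2 + eLpNorm (E i 0) 2 volume ^ 2 +
        eLpNorm (B i 0) 2 volume ^ 2) := by
  have hsub : Icc 0 t ⊆ timeI T := fun τ hτ => mem_timeI_of_le ht hτ
  set Y : ℝ → ℝ := fun τ => ∑ i, (‖toL2 (u i τ)‖ ^ 2 + ‖toL2 (E i τ)‖ ^ 2 + ‖toL2 (B i τ)‖ ^ 2)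
    with hY
  set J : ℝ → ℝ := fun τ => ∑ i, ‖toL2 (j i τ)‖ ^ 2 with hJ
  have hder : ∀ τ ∈ timeI T, HasDerivWithinAt Y (∑ i, (2 * (∫ x, u i τ x * Dm T none (u i) τ x) +
      2 * (∫ x, E i τ x * Dm T none (E i) τ x) + 2 * ∫ x, B i τ x * Dm T none (B i) τ x))
      (timeI T) τ := fun τ hτ => HasDerivWithinAt.fun_sum fun i _ =>
    (((h.hu i).hasDerivWithinAt_norm_sq hT hτ).add ((h.hE i).hasDerivWithinAt_norm_sq hT hτ)).add
      ((h.hB i).hasDerivWithinAt_norm_sq hT hτ)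
  have hYc : ContinuousOn Y (Icc 0 t) := fun τ hτ =>
    ((hder τ (hsub hτ)).continuousWithinAt).mono hsub
  have hJc : ContinuousOn J (Icc 0 t) := continuousOn_finsetSum _ fun i _ => fun τ hτ =>
    (((h.hj i).hasDerivWithinAt_norm_sq hT (hsub hτ)).continuousWithinAt).mono hsub
  have hJi : IntegrableOn J (Icc 0 t) volume := hJc.integrableOn_Icc
  have hmain : Y t - Y 0 ≤ ∫ τ in (0 : ℝ)..t, -(2 * σ⁻¹) * J τ := by
    refine intervalIntegral.sub_le_integral_of_hasDeriv_right_of_le ht.1 hYc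
      (g' := fun τ => ∑ i, (2 * (∫ x, u i τ x * Dm T none (u i) τ x) +
      2 * (∫ x, E i τ x * Dm T none (E i) τ x) + 2 * ∫ x, B i τ x * Dm T none (B i) τ x))
      (fun τ hτ => ?_) (hJi.const_mul _) fun τ hτ => ?_
    · exact (((hder τ (hsub (Ioo_subset_Icc_self hτ))).mono hsub).hasDerivAt
        (Icc_mem_nhds hτ.1 hτ.2)).hasDerivWithinAt
    · have hτ' := hsub (Ioo_subset_Icc_self hτ)
      have := h.energy_deriv_le hT hν hσ hc hτ'
      simp only [hJ, norm_sq_toL2 ((h.hj _).memLp hτ')]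
      simp only [← mul_add, ← Finset.mul_sum]
      linarith
  rw [intervalIntegral.integral_const_mul, intervalIntegral.integral_of_le ht.1,
    ← integral_Icc_eq_integral_Ioc] at hmain
  have hYt : 0 ≤ Y t := Finset.sum_nonneg fun i _ => by positivity
  have hJ0 : ∀ τ, 0 ≤ J τ := fun τ => Finset.sum_nonneg fun i _ => by positivity
  have hfin : ∫ τ in Icc 0 t, J τ ≤ σ / 2 * Y 0 := by
    have : 2 * σ⁻¹ * (∫ τ in Icc 0 t, J τ) ≤ Y 0 := by linarith
    calc _ = σ / 2 * (2 * σ⁻¹ * ∫ τ in Icc 0 t, J τ) := by field_simp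
      _ ≤ _ := mul_le_mul_of_nonneg_left this (by positivity)
  have hn : ∀ {f : ℝ → V3 → ℝ}, SC T f → ∀ τ ∈ timeI T,
      eLpNorm (f τ) 2 volume ^ 2 = ENNReal.ofReal (‖toL2 (f τ)‖ ^ 2) := by
    intro f hf τ hτ
    rw [← norm_toL2 (hf.memLp hτ), ← ofReal_norm, ENNReal.ofReal_pow (norm_nonneg _)]
  have h0 := zero_mem_timeI hT
  calc ∫⁻ τ in Icc 0 t, ∑ i, eLpNorm (j i τ) 2 volume ^ 2
      = ∫⁻ τ in Icc 0 t, ENNReal.ofReal (J τ) := by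
        refine setLIntegral_congr_fun measurableSet_Icc fun τ hτ => ?_
        simp only [hJ, hn (h.hj _) τ (hsub hτ)]
        rw [ENNReal.ofReal_sum_of_nonneg fun i _ => by positivity]
    _ = ENNReal.ofReal (∫ τ in Icc 0 t, J τ) :=
        (ofReal_integral_eq_lintegral_ofReal hJi (ae_of_all _ hJ0)).symm
    _ ≤ ENNReal.ofReal (σ / 2 * Y 0) := ENNReal.ofReal_le_ofReal hfin
    _ = _ := by
        rw [ENNReal.ofReal_mul (by positivity)]
        simp only [hY, hn (h.hu _) 0 h0, hn (h.hE _) 0 h0, hn (h.hB _) 0 h0]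
        rw [ENNReal.ofReal_sum_of_nonneg fun i _ => by positivity]
        congr 1
        refine Finset.sum_congr rfl fun i _ => ?_
        rw [ENNReal.ofReal_add (by positivity) (by positivity),
          ENNReal.ofReal_add (by positivity) (by positivity)]

end NSM
end


noncomputable section

namespace NSM

variable {T : ℝ≥0∞} {ν σ c : ℝ} {u E B j : Fin 3 → ℝ → V3 → ℝ}

/-! ### Sobolev norms of vector fields and of their components -/

theorem enorm_wt_eq {s : ℝ} (hs : 0 ≤ s) (ξ : V3) :
    ‖((2 * Real.pi * ‖ξ‖) ^ s : ℝ)‖ₑ = wt s ξ := by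
  rw [Real.enorm_of_nonneg (by positivity), wt, ENNReal.ofReal_rpow_of_nonneg (by positivity) hs]

theorem hs_comp_le_hsNorm {s : ℝ} (h : 0 ≤ s) (F : V3 → V3) (i : Fin 3) :
    hs s (fun x => F x i) ≤ hsNorm s F := by
  by_cases hF : MemLp F 2 volume
  · rw [hsNorm, if_pos hF, eLpNorm_two_eq_N2]
    refine N2_mono_ae ?_
    filter_upwards [fourierL2_apply_ae hF i] with ξ e
    rw [enorm_smul, enorm_wt_eq h, ← e, ← ofReal_norm, ← ofReal_norm]
    gcongr
    exact PiLp.norm_apply_le _ i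
  · rw [hsNorm, if_neg hF]
    exact le_top

theorem hsNorm_le_sum {s : ℝ} (h : 0 ≤ s) {F : V3 → V3} (hF : MemLp F 2 volume) :
    hsNorm s F ≤ ∑ i, hs s (fun x => F x i) := by
  rw [hsNorm, if_pos hF, eLpNorm_two_eq_N2]
  refine le_trans ?_ (N2_sum_le Finset.univ fun i =>
    (measurable_wt s).mul (measurable_ft fun x => F x i).enorm)
  refine N2_mono_ae ?_
  filter_upwards [ae_all_iff.2 fun i => fourierL2_apply_ae hF i] with ξ e
  rw [enorm_smul, enorm_wt_eq h, ← Finset.mul_sum]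
  refine mul_le_mul' le_rfl ?_
  simp only [← e, ← ofReal_norm]
  rw [← ENNReal.ofReal_sum_of_nonneg fun _ _ => norm_nonneg _]
  refine ENNReal.ofReal_le_ofReal ?_
  rw [EuclideanSpace.norm_eq, Real.sqrt_le_left (Finset.sum_nonneg fun _ _ => norm_nonneg _)]
  exact Finset.sum_sq_le_sq_sum_of_nonneg fun _ _ => norm_nonneg _

theorem hsNorm_neg (s : ℝ) (F : V3 → V3) : hsNorm s (fun x => - F x) = hsNorm s F := by
  have key : ∀ F : V3 → V3, MemLp F 2 volume → hsNorm s (fun x => - F x) = hsNorm s F := by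
    intro F hF
    have hF' : MemLp (fun x => - F x) 2 volume := hF.neg
    rw [hsNorm, if_pos hF', hsNorm, if_pos hF, eLpNorm_two_eq_N2, eLpNorm_two_eq_N2]
    refine N2_congr_ae ?_
    filter_upwards [ae_all_iff.2 fun i => fourierL2_apply_ae hF i,
      ae_all_iff.2 fun i => fourierL2_apply_ae hF' i,
      ae_all_iff.2 fun i => ft_neg (memLp_comp_apply hF i)] with ξ e1 e2 e3
    have : fourierL2 (fun x => - F x) ξ = - fourierL2 F ξ := by
      ext i
      rw [e2 i, PiLp.neg_apply, e1 i]
      exact e3 i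
    rw [this, smul_neg, enorm_neg]
  by_cases hF : MemLp F 2 volume
  · exact key F hF
  · have hF' : ¬ MemLp (fun x => - F x) 2 volume := fun h => hF (by
      have := h.neg
      rwa [show (-fun x => - F x) = F from funext fun x => neg_neg (F x)] at this)
    rw [hsNorm, if_neg hF', hsNorm, if_neg hF]

/-- The sum of the `Ḣˢ` norms of the components. -/
def nn (s : ℝ) (F : Fin 3 → ℝ → V3 → ℝ) (t : ℝ) : ℝ≥0∞ := ∑ i, hs s (F i t)

theorem Hs_le_nn (s : ℝ) (F : Fin 3 → ℝ → V3 → ℝ) (t : ℝ) : Hs s F t ≤ nn s F t := by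
  simp only [Hs, amp, Finset.mul_sum]
  exact N2_sum_le _ fun i => (measurable_wt s).mul (measurable_ft (F i t)).enorm

theorem aemeasurable_nn (hT : 0 < T) {F : Fin 3 → ℝ → V3 → ℝ} (hF : ∀ i, SC T (F i)) {s : ℝ}
    (h : 0 ≤ s) : AEMeasurable (nn s F) (volume.restrict (timeI T)) :=
  Finset.aemeasurable_fun_sum _ fun i _ => (hF i).aemeasurable_hs hT h

theorem nn_le_hsNorm {s : ℝ} (h : 0 ≤ s) (F : ℝ → V3 → V3) (t : ℝ) :
    nn s (comp F) t ≤ 3 * hsNorm s (F t) := by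
  refine (Finset.sum_le_card_nsmul _ _ _ fun i _ => hs_comp_le_hsNorm h (F t) i).trans ?_
  simp

theorem hs_zero {f : V3 → ℝ} (hf : MemLp f 2 volume) : hs 0 f = eLpNorm f 2 volume := by
  rw [← eLpNorm_ft hf, eLpNorm_two_eq_N2]
  simp only [hs, wt_zero, one_mul]

theorem eLpNorm_comp_le (F : V3 → V3) (i : Fin 3) :
    eLpNorm (fun x => F x i) 2 volume ≤ eLpNorm F 2 volume :=
  eLpNorm_mono fun x => PiLp.norm_apply_le (F x) i

theorem nn_zero_le {F : ℝ → V3 → V3} {t : ℝ} (hF : ∀ i, MemLp (comp F i t) 2 volume) :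
    nn 0 (comp F) t ≤ 3 * eLpNorm (F t) 2 volume := by
  refine (Finset.sum_le_card_nsmul _ _ (eLpNorm (F t) 2 volume) fun i _ => ?_).trans ?_
  · rw [hs_zero (hF i)]
    exact eLpNorm_comp_le (F t) i
  · simp

/-! ### Norms in time -/

/-- The `L²` norm in time. -/
def L2t (T : ℝ≥0∞) (f : ℝ → ℝ≥0∞) : ℝ≥0∞ := (∫⁻ τ in timeI T, f τ ^ 2) ^ (1 / 2 : ℝ)

theorem L2t_sq (f : ℝ → ℝ≥0∞) : L2t T f ^ 2 = ∫⁻ τ in timeI T, f τ ^ 2 := by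
  rw [L2t, ← ENNReal.rpow_natCast, ← ENNReal.rpow_mul]
  norm_num

theorem L2t_mono_ae {f g : ℝ → ℝ≥0∞} (h : ∀ᵐ τ ∂volume.restrict (timeI T), f τ ≤ g τ) :
    L2t T f ≤ L2t T g := by
  refine ENNReal.rpow_le_rpow (lintegral_mono_ae ?_) (by norm_num)
  filter_upwards [h] with τ h
  exact pow_le_pow_left' h 2

theorem L2t_const_mul {f : ℝ → ℝ≥0∞} (hf : AEMeasurable f (volume.restrict (timeI T)))
    (a : ℝ≥0∞) : L2t T (fun τ => a * f τ) = a * L2t T f := by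
  simp only [L2t, mul_pow]
  rw [lintegral_const_mul'' _ (hf.pow_const 2), ENNReal.mul_rpow_of_nonneg _ _ (by norm_num),
    ← ENNReal.rpow_natCast, ← ENNReal.rpow_mul]
  norm_num

theorem L2t_const_mul' (f : ℝ → ℝ≥0∞) {a : ℝ≥0∞} (ha : a ≠ ⊤) :
    L2t T (fun τ => a * f τ) = a * L2t T f := by
  simp only [L2t, mul_pow]
  rw [lintegral_const_mul' _ _ (ENNReal.pow_ne_top ha), ENNReal.mul_rpow_of_nonneg _ _ (by norm_num),
    ← ENNReal.rpow_natCast, ← ENNReal.rpow_mul]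
  norm_num

theorem L2t_add_le {f g : ℝ → ℝ≥0∞} (hf : AEMeasurable f (volume.restrict (timeI T)))
    (hg : AEMeasurable g (volume.restrict (timeI T))) :
    L2t T (fun τ => f τ + g τ) ≤ L2t T f + L2t T g := by
  have := ENNReal.lintegral_Lp_add_le hf hg (show (1 : ℝ) ≤ 2 by norm_num)
  simpa [L2t] using this

theorem eLpNorm_two_eq_L2t (f : ℝ → ℝ≥0∞) : eLpNorm f 2 (volume.restrict (timeI T)) = L2t T f := by
  rw [eLpNorm_eq_lintegral_rpow_enorm_toReal (by norm_num) (by norm_num)]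
  simp [L2t]

theorem ae_le_eLpNorm_top (f : ℝ → ℝ≥0∞) :
    ∀ᵐ τ ∂volume.restrict (timeI T), f τ ≤ eLpNorm f ∞ (volume.restrict (timeI T)) := by
  rw [eLpNorm_exponent_top]
  exact ae_le_eLpNormEssSup

/-- Exhausts [0,T) by the intervals [0,q] with q rational, a countable directed family. It needs no
measurability of f and treats T = ∞ in the same way. -/
theorem setLIntegral_timeI_le {f : ℝ → ℝ≥0∞} {R : ℝ≥0∞}
    (h : ∀ t ∈ timeI T, ∫⁻ τ in Icc 0 t, f τ ≤ R) : ∫⁻ τ in timeI T, f τ ≤ R := by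
  have e : timeI T = ⋃ q : {q : ℚ // (q : ℝ) ∈ timeI T}, Icc 0 (q : ℝ) := by
    ext t
    simp only [mem_iUnion]
    constructor
    · intro ht
      obtain ⟨t', ht', hlt⟩ := exists_Icc_subset_timeI ht
      obtain ⟨q, hq1, hq2⟩ := exists_rat_btwn hlt
      have hq : (q : ℝ) ∈ timeI T := mem_timeI_of_le ht' ⟨ht.1.trans hq1.le, hq2.le⟩
      exact ⟨⟨q, hq⟩, ht.1, hq1.le⟩
    · rintro ⟨q, hq⟩
      exact mem_timeI_of_le q.2 hq
  rw [e, setLIntegral_iUnion_of_directed]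
  · exact iSup_le fun q => h _ q.2
  · intro a b
    rcases le_total a.1 b.1 with hab | hab
    · exact ⟨b, Icc_subset_Icc_right (by exact_mod_cast hab), subset_rfl⟩
    · exact ⟨a, subset_rfl, Icc_subset_Icc_right (by exact_mod_cast hab)⟩

/-- Interpolation between `L²` and `L^∞` in time. -/
theorem eLpNorm_time_le {f : ℝ → ℝ≥0∞} {N : ℝ≥0∞} {σ c : ℝ} (hσ : 0 < σ) (hc : 0 < c)
    (h1 : ∀ t ∈ timeI T, f t ≤ N)
    (h2 : ENNReal.ofReal (σ * c ^ 2) * ∫⁻ τ in timeI T, f τ ^ 2 ≤ N ^ 2) {p : ℝ≥0∞} (hp : 2 ≤ p) :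
    eLpNorm f p (volume.restrict (timeI T)) ≤
      ENNReal.ofReal (1 + σ⁻¹) * ENNReal.ofReal (c ^ (-(2 * (p⁻¹).toReal))) * N := by
  have h1' : ∀ᵐ τ ∂volume.restrict (timeI T), f τ ≤ N :=
    (ae_restrict_iff' (measurableSet_timeI T)).2 (ae_of_all _ h1)
  have hone : (1 : ℝ≥0∞) ≤ ENNReal.ofReal (1 + σ⁻¹) := by
    rw [← ENNReal.ofReal_one]
    exact ENNReal.ofReal_le_ofReal (by have := inv_pos.2 hσ; linarith)
  by_cases hpt : p = ⊤
  · subst hpt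
    rw [eLpNorm_exponent_top]
    refine (eLpNormEssSup_le_of_ae_enorm_bound (C := N) ?_).trans ?_
    · filter_upwards [h1'] with τ h; simpa using h
    · simpa using mul_le_mul' hone (le_refl N)
  by_cases hN : N = ⊤
  · subst hN
    rw [ENNReal.mul_top]
    · exact le_top
    · have := Real.rpow_pos_of_pos hc (-(2 * (p⁻¹).toReal))
      have : 0 < 1 + σ⁻¹ := by positivity
      simp only [ne_eq, mul_eq_zero, ENNReal.ofReal_eq_zero, not_or, not_le]
      exact ⟨by assumption, by assumption⟩
  set r := p.toReal with hr
  have hr2 : 2 ≤ r := by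
    have := ENNReal.toReal_mono hpt hp
    simpa using this
  have hr0 : 0 < r := by linarith
  have hp0 : p ≠ 0 := by rintro rfl; simp at hp
  rw [eLpNorm_eq_lintegral_rpow_enorm_toReal hp0 hpt]
  simp only [enorm_eq_self]
  have hk : 0 < σ * c ^ 2 := by positivity
  have hI : ∫⁻ τ in timeI T, f τ ^ 2 ≤ ENNReal.ofReal ((σ * c ^ 2)⁻¹) * N ^ 2 := by
    rw [ENNReal.ofReal_inv_of_pos hk]
    rw [mul_comm, ← div_eq_mul_inv, ENNReal.le_div_iff_mul_le (Or.inl (by simpa using hk))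
      (Or.inl ENNReal.ofReal_ne_top), mul_comm]
    exact h2
  -- Write f^r = f^{r-2} f² and bound the first factor by N^{r-2}. The r-th root of (σc²)⁻¹ then
  -- yields c^{-2/r}, and σ^{-1/r} ≤ 1 + σ⁻¹ makes the constant independent of p.
  have hle : ∫⁻ τ in timeI T, f τ ^ r ≤ ENNReal.ofReal ((σ * c ^ 2)⁻¹) * N ^ r := by
    calc ∫⁻ τ in timeI T, f τ ^ r ≤ ∫⁻ τ in timeI T, N ^ (r - 2) * f τ ^ 2 := by
          refine lintegral_mono_ae ?_
          filter_upwards [h1'] with τ h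
          have : f τ ^ r = f τ ^ (r - 2) * f τ ^ (2 : ℝ) := by
            rw [← ENNReal.rpow_add_of_nonneg _ _ (by linarith) (by norm_num), sub_add_cancel]
          rw [this, ENNReal.rpow_two]
          gcongr
      _ = N ^ (r - 2) * ∫⁻ τ in timeI T, f τ ^ 2 :=
          lintegral_const_mul' _ _ (ENNReal.rpow_ne_top_of_nonneg (by linarith) hN)
      _ ≤ N ^ (r - 2) * (ENNReal.ofReal ((σ * c ^ 2)⁻¹) * N ^ 2) := by gcongr
      _ = _ := by
          rw [mul_left_comm, ← ENNReal.rpow_two, ← ENNReal.rpow_add_of_nonneg _ _ (by linarith)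
            (by norm_num), sub_add_cancel]
  have hpr : (p⁻¹).toReal = 1 / r := by rw [ENNReal.toReal_inv, one_div]
  have hreal : ((σ * c ^ 2)⁻¹) ^ (1 / r) ≤ (1 + σ⁻¹) * c ^ (-(2 * (1 / r))) := by
    rw [mul_inv, Real.mul_rpow (by positivity) (by positivity)]
    have e : ((c ^ 2)⁻¹) ^ (1 / r) = c ^ (-(2 * (1 / r))) := by
      rw [← Real.rpow_natCast, ← Real.rpow_neg hc.le, ← Real.rpow_mul hc.le]
      push_cast
      ring_nf
    rw [e]
    refine mul_le_mul_of_nonneg_right ?_ (by positivity)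
    calc (σ⁻¹) ^ (1 / r) ≤ (1 + σ⁻¹) ^ (1 / r) := by
          refine Real.rpow_le_rpow (by positivity) (by linarith) (by positivity)
      _ ≤ (1 + σ⁻¹) ^ (1 : ℝ) := by
          refine Real.rpow_le_rpow_of_exponent_le (by have := inv_pos.2 hσ; linarith) ?_
          rw [div_le_one hr0]; linarith
      _ = _ := Real.rpow_one _
  calc _ ≤ (ENNReal.ofReal ((σ * c ^ 2)⁻¹) * N ^ r) ^ (1 / r) :=
        ENNReal.rpow_le_rpow hle (by positivity)
    _ = ENNReal.ofReal (((σ * c ^ 2)⁻¹) ^ (1 / r)) * N := by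
        rw [ENNReal.mul_rpow_of_nonneg _ _ (by positivity), ← ENNReal.rpow_mul,
          mul_one_div_cancel hr0.ne', ENNReal.rpow_one,
          ENNReal.ofReal_rpow_of_nonneg (by positivity) (by positivity)]
    _ ≤ ENNReal.ofReal ((1 + σ⁻¹) * c ^ (-(2 * (1 / r)))) * N := by gcongr
    _ = _ := by rw [ENNReal.ofReal_mul (by positivity), hpr]

/-! ### The damped wave equation for the electric field -/

theorem memLp_leray (i k : Fin 3) : MemLp (fun ξ => (leray i k ξ : ℂ)) ⊤ (volume : Measure V3) := by
  refine memLp_top_of_bound ?_ 2 (ae_of_all _ fun ξ => ?_)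
  · refine Measurable.aestronglyMeasurable (Complex.measurable_ofReal.comp ?_)
    unfold leray
    have h : ∀ m : Fin 3, Measurable fun ξ : V3 => ξ m := fun m =>
      (EuclideanSpace.proj m : V3 →L[ℝ] ℝ).continuous.measurable
    exact measurable_const.sub (((h i).mul (h k)).div (measurable_norm.pow_const 2))
  · rw [Complex.norm_real]
    exact abs_leray_le i k ξ

/-- Ohm's law holds for almost every frequency, with an exceptional set depending on t, so it cannot
be differentiated pointwise. It is differentiated as an identity in L² between bounded multipliers
of transforms. -/
theorem Sys.ft_dt_j (h : Sys ν σ c T u E B j) (hT : 0 < T) {t : ℝ} (ht : t ∈ timeI T) (i : Fin 3) :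
    ∀ᵐ ξ, ft (Dm T none (j i) t) ξ =
      σ * (c * ft (Dm T none (E i) t) ξ + nlFt T u B i t ξ) := by
  have hX := SC.crs hT h.hu h.hB
  set A : Fin 3 → Lp ℂ 2 (volume : Measure V3) →L[ℂ] Lp ℂ 2 (volume : Measure V3) :=
    fun k => mulOp (memLp_leray i k) with hA
  have hform : ∀ a : Lp ℂ 2 (volume : Measure V3), ∀ v : Fin 3 → Lp ℂ 2 (volume : Measure V3),
      ((σ : ℂ) • ((c : ℂ) • a + (A 0 (v 0) + A 1 (v 1) + A 2 (v 2))) :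
        Lp ℂ 2 (volume : Measure V3)) =ᵐ[volume] fun ξ =>
        σ * (c * a ξ + ∑ k, (leray i k ξ : ℂ) * v k ξ) := by
    intro a v
    filter_upwards [Lp.coeFn_smul (σ : ℂ) ((c : ℂ) • a + (A 0 (v 0) + A 1 (v 1) + A 2 (v 2))),
      Lp.coeFn_add ((c : ℂ) • a) (A 0 (v 0) + A 1 (v 1) + A 2 (v 2)), Lp.coeFn_smul (c : ℂ) a,
      Lp.coeFn_add (A 0 (v 0) + A 1 (v 1)) (A 2 (v 2)), Lp.coeFn_add (A 0 (v 0)) (A 1 (v 1)),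
      coeFn_mulOp (memLp_leray i 0) (v 0), coeFn_mulOp (memLp_leray i 1) (v 1),
      coeFn_mulOp (memLp_leray i 2) (v 2)] with ξ r1 r2 r3 r4 r5 r6 r7 r8
    rw [r1, Pi.smul_apply, r2, Pi.add_apply, r3, r4, Pi.add_apply, r5, Pi.add_apply, r6, r7, r8,
      Fin.sum_univ_three]
    rfl
  have hj : ∀ τ ∈ timeI T, ftL (j i τ) = (σ : ℂ) • ((c : ℂ) • ftL (E i τ) +
      (A 0 (ftL (crs u B 0 τ)) + A 1 (ftL (crs u B 1 τ)) + A 2 (ftL (crs u B 2 τ)))) := by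
    intro τ hτ
    refine Lp.ext ?_
    filter_upwards [hform (ftL (E i τ)) fun k => ftL (crs u B k τ), h.ohm i τ hτ] with ξ a b
    rw [a]
    exact b
  have hd := ((((h.hE i).hasDerivWithinAt_ftL hT ht).const_smul (c : ℂ)).add
    ((((hX 0).hasDerivWithinAt_clm_ftL hT (A 0) ht).add
      ((hX 1).hasDerivWithinAt_clm_ftL hT (A 1) ht)).add
      ((hX 2).hasDerivWithinAt_clm_ftL hT (A 2) ht))).const_smul (σ : ℂ)
  have hd' := ((h.hj i).hasDerivWithinAt_ftL hT ht).congr (fun τ hτ => (hj τ hτ).symm) (hj t ht).symm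
  have he := (uniqueDiffOn_timeI hT t ht).eq_deriv _ hd' hd
  have hfin := hform (ftL (Dm T none (E i) t)) fun k => ftL (Dm T none (crs u B k) t)
  filter_upwards [hfin] with ξ a
  refine Eq.trans ?_ a
  rw [← he]
  rfl

theorem crl_crl (hT : 0 < T) (hE : ∀ i, SC T (E i)) (hd : ∀ t ∈ timeI T, ∀ x, dvg T E t x = 0)
    (i : Fin 3) : ∀ t ∈ timeI T, ∀ x, crl T (crl T E) i t x = - lap T (E i) t x := by
  intro t ht x
  have hD : ∀ d k, Dm T d (crl T E k) t x = Dm T d (Dm T (some (k + 1)) (E (k + 2))) t x -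
      Dm T d (Dm T (some (k + 2)) (E (k + 1))) t x := fun d k =>
    Dm_sub hT ((hE _).Dm hT _) ((hE _).Dm hT _) d t ht x
  have h1 := Dm_congr (g := fun _ _ => 0) hd (some i) t ht x
  have e : dvg T E = fun t x => Dm T (some 0) (E 0) t x + Dm T (some 1) (E 1) t x +
      Dm T (some 2) (E 2) t x := by
    funext t x; exact Fin.sum_univ_three _
  rw [Dm_zero, e, Dm_add hT (((hE 0).Dm hT _).add hT ((hE 1).Dm hT _)) ((hE 2).Dm hT _) _ t ht,
    Dm_add hT ((hE 0).Dm hT _) ((hE 1).Dm hT _) _ t ht] at h1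
  rw [crl, hD, hD, lap, Fin.sum_univ_three]
  have cm : ∀ a b k, Dm T a (Dm T b (E k)) t x = Dm T b (Dm T a (E k)) t x :=
    fun a b k => Dm_comm hT (hE k) a b t ht x
  obtain rfl | rfl | rfl := fin3_cases i <;> simp only [fin3_add]
  · linear_combination h1 + cm (some 1) (some 0) 1 + cm (some 2) (some 0) 2
  · linear_combination h1 + cm (some 2) (some 1) 2 + cm (some 0) (some 1) 0
  · linear_combination h1 + cm (some 0) (some 2) 0 + cm (some 1) (some 2) 1

/-- For φ = curl B - j: Faraday's law and curl curl E = -ΔE give ∂ₜ curl B = cΔE, while ∂ₜj = σ(c²φ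
+ ∂ₜP(u × B)). -/
theorem Sys.ft_dt_dt_E (h : Sys ν σ c T u E B j) (hT : 0 < T) (hc : 0 < c) (i : Fin 3) :
    ∀ t ∈ timeI T, ∀ᵐ ξ, ft (Dm T none (fun t x => c⁻¹ * Dm T none (E i) t x) t) ξ =
      -(c * (2 * Real.pi * ‖ξ‖ : ℝ) ^ 2 * ft (E i t) ξ) -
        (σ * c ^ 2) * ft (fun x => c⁻¹ * Dm T none (E i) t x) ξ - σ * nlFt T u B i t ξ := by
  intro t ht
  have hB' : ∀ i, SC T (Dm T none (B i)) := fun i => (h.hB i).Dm hT none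
  have hcE := SC.crl hT h.hE
  have e0 : ∀ t ∈ timeI T, ∀ x, c⁻¹ * Dm T none (E i) t x = crl T B i t x - j i t x :=
    fun t ht x => by rw [h.ampere i t ht x]; ring
  have e1 : ∀ x, Dm T none (crl T B i) t x = c * lap T (E i) t x := by
    intro x
    have q1 : Dm T none (crl T B i) t x = crl T (fun i => Dm T none (B i)) i t x := by
      refine (Dm_sub hT ((h.hB _).Dm hT _) ((h.hB _).Dm hT _) none t ht x).trans ?_
      rw [Dm_comm hT (h.hB _) none _ t ht, Dm_comm hT (h.hB _) none _ t ht]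
      rfl
    have q2 : ∀ d k, Dm T d (Dm T none (B k)) t x = -c * Dm T d (crl T E k) t x := by
      intro d k
      rw [Dm_congr (g := fun t x => -c * crl T E k t x) (h.faraday k) d t ht x,
        Dm_const_mul hT (hcE k) _ d t ht x]
    have q3 := crl_crl hT h.hE h.div_E i t ht x
    rw [q1]
    simp only [crl, q2] at q3 ⊢
    linear_combination (-c) * q3
  have e2 : Dm T none (fun t x => c⁻¹ * Dm T none (E i) t x) t =
      fun x => c * lap T (E i) t x - Dm T none (j i) t x := by
    funext x
    rw [Dm_congr e0 none t ht x, Dm_sub hT (SC.crl hT h.hB i) (h.hj i) none t ht x, e1]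
  have m1 := ((h.hE i).lap hT).memLp ht
  have m2 := ((h.hE i).Dm hT none).memLp ht
  have hc' : (c : ℂ) ≠ 0 := by exact_mod_cast hc.ne'
  rw [e2]
  filter_upwards [ft_sub (m1.const_mul c) (((h.hj i).Dm hT none).memLp ht), ft_const_mul m1 c,
    ft_lap hT (h.hE i) ht, h.ft_dt_j hT ht i, ft_const_mul m2 c⁻¹] with ξ a1 a2 a3 a4 a5
  refine a1.trans ?_
  rw [a2, a3, a4, a5]
  push_cast
  field_simp
  ring

end NSM
end


/-! ### Integration in time and assembly of the estimate -/

noncomputable section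

namespace NSM

variable {T : ℝ≥0∞} {ν σ c : ℝ}

/-! ### Time integration of the nonlinear term -/

theorem rpow_mul_rpow_three {x y a b : ℝ≥0∞} {s : ℝ} (hs0 : 0 ≤ s) (hs1 : s ≤ 1 / 2)
    (hx : x ≤ 3 * a) (hy : y ≤ 3 * b) :
    x ^ (1 / 2 - s) * y ^ (s + 1 / 2) ≤ 3 * (a ^ (1 / 2 - s) * b ^ (s + 1 / 2)) := by
  have hp : 0 ≤ 1 / 2 - s := by linarith
  have hq : 0 ≤ s + 1 / 2 := by linarith
  calc _ ≤ (3 * a) ^ (1 / 2 - s) * (3 * b) ^ (s + 1 / 2) := by gcongr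
    _ = (3 ^ (1 / 2 - s) * 3 ^ (s + 1 / 2)) * (a ^ (1 / 2 - s) * b ^ (s + 1 / 2)) := by
        rw [ENNReal.mul_rpow_of_nonneg _ _ hp, ENNReal.mul_rpow_of_nonneg _ _ hq]; ring
    _ = _ := by
        rw [← ENNReal.rpow_add_of_nonneg _ _ hp hq, show 1 / 2 - s + (s + 1 / 2) = 1 by ring,
          ENNReal.rpow_one]

theorem sq_sum_three_le (a : Fin 3 → ℝ≥0∞) : (∑ i, a i) ^ 2 ≤ 3 * ∑ i, a i ^ 2 := by
  have := ENNReal.inner_le_Lp_mul_Lq Finset.univ (fun _ => (1 : ℝ≥0∞)) a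
    (p := 2) (q := 2) (by constructor <;> norm_num)
  have h2 := pow_le_pow_left' this 2
  simp only [one_mul, ENNReal.one_rpow] at h2
  refine h2.trans (le_of_eq ?_)
  rw [mul_pow, ← ENNReal.rpow_natCast, ← ENNReal.rpow_natCast, ← ENNReal.rpow_mul,
    ← ENNReal.rpow_mul]
  simp

variable {u E B j : ℝ → V3 → V3}

/-- The constant is σ/2 from the energy inequality, times 3 for squaring a sum of three components,
times 3 for bounding each initial component by the whole field. -/
theorem Sys.L2t_j_le (h : Sys ν σ c T (comp u) (comp E) (comp B) (comp j)) (hT : 0 < T)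
    (hν : 0 < ν) (hσ : 0 < σ) (hc : 0 < c) :
    L2t T (nn 0 (comp j)) ≤ ENNReal.ofReal (9 * σ / 2) ^ (1 / 2 : ℝ) *
      energy0 (u 0) (E 0) (B 0) := by
  rw [energy0, ← ENNReal.mul_rpow_of_nonneg _ _ (by norm_num)]
  refine ENNReal.rpow_le_rpow ?_ (by norm_num)
  refine setLIntegral_timeI_le fun t ht => ?_
  calc ∫⁻ τ in Icc 0 t, nn 0 (comp j) τ ^ 2
      ≤ ∫⁻ τ in Icc 0 t, 3 * ∑ i, eLpNorm (comp j i τ) 2 volume ^ 2 := by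
        refine setLIntegral_mono' measurableSet_Icc fun τ hτ => ?_
        refine (sq_sum_three_le _).trans (le_of_eq ?_)
        simp only [hs_zero ((h.hj _).memLp (mem_timeI_of_le ht hτ))]
    _ = 3 * ∫⁻ τ in Icc 0 t, ∑ i, eLpNorm (comp j i τ) 2 volume ^ 2 :=
        lintegral_const_mul' _ _ (by norm_num)
    _ ≤ 3 * (ENNReal.ofReal (σ / 2) * ∑ i : Fin 3, (eLpNorm (comp u i 0) 2 volume ^ 2 +
          eLpNorm (comp E i 0) 2 volume ^ 2 + eLpNorm (comp B i 0) 2 volume ^ 2)) :=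
        mul_le_mul' le_rfl (h.lintegral_j_le hT hν hσ hc ht)
    _ ≤ 3 * (ENNReal.ofReal (σ / 2) * ∑ _i : Fin 3, (eLpNorm (u 0) 2 volume ^ 2 +
          eLpNorm (E 0) 2 volume ^ 2 + eLpNorm (B 0) 2 volume ^ 2)) := by
        gcongr <;> exact eLpNorm_comp_le _ _
    _ = _ := by
        rw [show 9 * σ / 2 = 9 * (σ / 2) by ring, ENNReal.ofReal_mul (by norm_num)]
        simp only [Finset.sum_const, Finset.card_univ, Fintype.card_fin, nsmul_eq_mul]
        rw [ENNReal.ofReal_ofNat]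
        push_cast
        ring

theorem ae_nn_le_lpHs {F : ℝ → V3 → V3} {s : ℝ} (hs : 0 ≤ s) :
    ∀ᵐ τ ∂volume.restrict (timeI T), nn s (comp F) τ ≤ 3 * lpHs T ∞ s F := by
  filter_upwards [ae_le_eLpNorm_top (T := T) fun t => hsNorm s (F t)] with τ h
  exact (nn_le_hsNorm hs F τ).trans (mul_le_mul' le_rfl h)

theorem L2t_nn_le {F : ℝ → V3 → V3} {s : ℝ} (hs : 0 ≤ s) :
    L2t T (nn s (comp F)) ≤ 3 * lpHs T 2 s F := by
  rw [lpHs, eLpNorm_two_eq_L2t, ← L2t_const_mul' _ (by norm_num)]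
  exact L2t_mono_ae (ae_of_all _ fun τ => nn_le_hsNorm hs F τ)

theorem L2t_linear_combination_le {f g h : ℝ → ℝ≥0∞}
    (hf : AEMeasurable f (volume.restrict (timeI T)))
    (hg : AEMeasurable g (volume.restrict (timeI T)))
    (hh : AEMeasurable h (volume.restrict (timeI T))) (a b d : ℝ≥0∞) :
    L2t T (fun τ => a * f τ + b * g τ + d * h τ) ≤ a * L2t T f + b * L2t T g + d * L2t T h := by
  rw [← L2t_const_mul hf, ← L2t_const_mul hg, ← L2t_const_mul hh]
  exact (L2t_add_le ((hf.const_mul a).add (hg.const_mul b)) (hh.const_mul d)).trans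
    (add_le_add (L2t_add_le (hf.const_mul a) (hg.const_mul b)) le_rfl)

/-- In each product exactly one factor is taken in L² in time, namely u in Ḣ², j in L² or E in
Ḣ^{s+3/2}; the others are in L^∞. Interpolating u between L² and Ḣ¹ gives the last term of
`nonlinA`. -/
theorem Sys.L2t_nonlinear_le (h : Sys ν σ c T (comp u) (comp E) (comp B) (comp j)) (hT : 0 < T)
    (hν : 0 < ν) (hσ : 0 < σ) (hc : 0 < c) {s : ℝ} (hs0 : 0 ≤ s) (hs1 : s ≤ 1 / 2) :
    L2t T (fun t => (Hs 2 (comp u) t + Hs 0 (comp j) t * Hs (3 / 2) (comp B) t) *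
          Hs (s + 3 / 2) (comp B) t +
        ENNReal.ofReal c * (Hs 1 (comp u) t * Hs (s + 3 / 2) (comp E) t) +
        Hs (s + 1 / 2) (comp u) t * Hs 2 (comp u) t * Hs (3 / 2) (comp B) t) ≤
      27 * (1 + ENNReal.ofReal (9 * σ / 2) ^ (1 / 2 : ℝ)) * nonlinA c T s u E B := by
  set κ := ENNReal.ofReal (9 * σ / 2) ^ (1 / 2 : ℝ)
  set b := lpHs T ∞ (3 / 2) B with hb
  set b' := lpHs T ∞ (s + 3 / 2) B with hb'
  set a1 := lpHs T ∞ 1 u with ha1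
  set a0 := lpL2 T ∞ u with ha0
  set R := a0 ^ (1 / 2 - s) * a1 ^ (s + 1 / 2) with hR
  set e0 := energy0 (u 0) (E 0) (B 0)
  set n2 := lpHs T 2 2 u
  set nE := lpHs T 2 (s + 3 / 2) E
  have hae0 : ∀ᵐ τ ∂volume.restrict (timeI T), Hs 0 (comp u) τ ≤ 3 * a0 := by
    filter_upwards [ae_le_eLpNorm_top (T := T) fun t => eLpNorm (u t) 2 volume,
      ae_restrict_mem (measurableSet_timeI T)] with τ q hτ
    exact (Hs_le_nn 0 _ τ).trans ((nn_zero_le fun i => (h.hu i).memLp hτ).trans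
      (mul_le_mul' le_rfl q))
  have hpt : ∀ᵐ τ ∂volume.restrict (timeI T),
      (Hs 2 (comp u) τ + Hs 0 (comp j) τ * Hs (3 / 2) (comp B) τ) * Hs (s + 3 / 2) (comp B) τ +
        ENNReal.ofReal c * (Hs 1 (comp u) τ * Hs (s + 3 / 2) (comp E) τ) +
        Hs (s + 1 / 2) (comp u) τ * Hs 2 (comp u) τ * Hs (3 / 2) (comp B) τ ≤
      (3 * b' + 9 * (R * b)) * nn 2 (comp u) τ + 9 * (b * b') * nn 0 (comp j) τ +
        3 * (ENNReal.ofReal c * a1) * nn (s + 3 / 2) (comp E) τ := by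
    filter_upwards [hae0, ae_nn_le_lpHs (T := T) (F := u) (s := 1) (by norm_num),
      ae_nn_le_lpHs (T := T) (F := B) (s := 3 / 2) (by norm_num),
      ae_nn_le_lpHs (T := T) (F := B) (s := s + 3 / 2) (by linarith)] with τ q0 q1 q2 q3
    have r1 := (Hs_le_nn 1 (comp u) τ).trans q1
    have r2 := (Hs_le_nn (3 / 2) (comp B) τ).trans q2
    have r3 := (Hs_le_nn (s + 3 / 2) (comp B) τ).trans q3
    have r4 := (Hs_interpolate hs0 hs1 (comp u) τ).trans (rpow_mul_rpow_three hs0 hs1 q0 r1)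
    calc _ ≤ (nn 2 (comp u) τ + nn 0 (comp j) τ * (3 * b)) * (3 * b') +
          ENNReal.ofReal c * (3 * a1 * nn (s + 3 / 2) (comp E) τ) +
          3 * R * nn 2 (comp u) τ * (3 * b) := by
          gcongr <;> exact Hs_le_nn _ _ _
      _ = _ := by ring
  refine (L2t_mono_ae hpt).trans ((L2t_linear_combination_le (aemeasurable_nn hT h.hu (by norm_num))
    (aemeasurable_nn hT h.hj le_rfl) (aemeasurable_nn hT h.hE (by linarith)) _ _ _).trans ?_)
  calc _ ≤ (3 * b' + 9 * (R * b)) * (3 * n2) + 9 * (b * b') * (κ * e0) +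
        3 * (ENNReal.ofReal c * a1) * (3 * nE) := by
        gcongr
        · exact L2t_nn_le (by norm_num)
        · exact h.L2t_j_le hT hν hσ hc
        · exact L2t_nn_le (by linarith)
    _ ≤ ((3 * b' + 9 * (R * b)) * (3 * n2) + 9 * (b * b') * (κ * e0) +
        3 * (ENNReal.ofReal c * a1) * (3 * nE)) +
        -- The added nonnegative terms are precisely those missing from the expansion of 27(1 + κ)
        -- times the nonlinear quantity.
        ((18 * (b' * n2) + 27 * (a1 * b') + 18 * (a1 * (ENNReal.ofReal c * nE)) +
          27 * (n2 * (ENNReal.ofReal c * nE)) + 27 * (e0 * b * b') +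
          27 * (e0 * b * (ENNReal.ofReal c * nE))) + κ * (27 * (a1 * b') + 27 * (n2 * b') +
          18 * (e0 * b * b') + 27 * ((a1 + n2) * (ENNReal.ofReal c * nE)) +
          27 * (e0 * b * (ENNReal.ofReal c * nE)) + 27 * (R * n2 * b))) := le_self_add
    _ = _ := by
        simp only [nonlinA]
        ring

/-! ### The estimate in components -/

theorem exists_eLpNorm_sum_hs_le (hν : 0 < ν) (hσ : 0 < σ) : ∃ C : ℝ≥0, ∀ {c : ℝ} {T : ℝ≥0∞}
    {u E B j : ℝ → V3 → V3}, 0 < c → 0 < T →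
    Sys ν σ c T (comp u) (comp E) (comp B) (comp j) → Axi T (comp u) (comp E) (comp B) →
    ∀ s : ℝ, 0 ≤ s → s ≤ 1 / 2 → ∀ p : ℝ≥0∞, 2 ≤ p →
    eLpNorm (nn s fun i t x => c⁻¹ * Dm T none (comp E i) t x) p (volume.restrict (timeI T)) ≤
      C * (ENNReal.ofReal (c ^ (-(2 * (p⁻¹).toReal))) *
        (hsNorm s (fun x => curl (B 0) x - j 0 x) + hsNorm (s + 1) (E 0) +
          ENNReal.ofReal c⁻¹ * nonlinA c T s u E B)) := by
  obtain ⟨K, hK⟩ := exists_N2_nlFt_le hν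
  refine ⟨(1 + σ⁻¹).toNNReal * (3 * (1 + Real.sqrt σ).toNNReal * (K + 1) *
    (27 * (1 + (9 * σ / 2).toNNReal ^ (1 / 2 : ℝ)) + 1)),
    fun {c T u E B j} hc hT h ha s hs0 hs1 p hp => ?_⟩
  set φ : Fin 3 → ℝ → V3 → ℝ := fun i t x => c⁻¹ * Dm T none (comp E i) t x with hφ
  have hφS : ∀ i, SC T (φ i) := fun i => ((h.hE i).Dm hT none).const_mul hT c⁻¹
  set A : ℝ → ℝ≥0∞ := fun t => (Hs 2 (comp u) t + Hs 0 (comp j) t * Hs (3 / 2) (comp B) t) *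
          Hs (s + 3 / 2) (comp B) t +
        ENNReal.ofReal c * (Hs 1 (comp u) t * Hs (s + 3 / 2) (comp E) t) +
        Hs (s + 1 / 2) (comp u) t * Hs 2 (comp u) t * Hs (3 / 2) (comp B) t with hA
  set a := hsNorm s (fun x => curl (B 0) x - j 0 x) with hadef
  set b := hsNorm (s + 1) (E 0) with hbdef
  -- Chosen so that d² bounds the source term (σ/c²) ∫ of the energy estimate over every [0,t]; this
  -- is where the extra factor c⁻¹ appears.
  set d := ENNReal.ofReal (Real.sqrt σ * c⁻¹) * (K * L2t T A) with hd
  have h0 := zero_mem_timeI hT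
  have hφ0 : ∀ i, hs s (φ i 0) ≤ a := by
    intro i
    have e : φ i 0 = fun x => (fun x => curl (B 0) x - j 0 x) x i := by
      funext x
      have := h.ampere i 0 h0 x
      simp only [hφ, PiLp.sub_apply, curl_apply h.hB h0]
      simp only [comp] at this ⊢
      rw [this]
      ring
    rw [e]
    exact hs_comp_le_hsNorm hs0 _ i
  have hE0 : ∀ i, hs (s + 1) (comp E i 0) ≤ b := fun i => hs_comp_le_hsNorm (by linarith) (E 0) i
  have key : ∀ i, ∀ t ∈ timeI T, hs s (φ i t) ^ 2 + ENNReal.ofReal (σ * c ^ 2) *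
      ∫⁻ τ in Icc 0 t, hs s (φ i τ) ^ 2 ≤ a ^ 2 + b ^ 2 + d ^ 2 := by
    intro i t ht
    refine (damped_wave_hs hT hσ hc (h.hE i) (hφS i) (fun t ht x => ?_) (h.ft_dt_dt_E hT hc i) hs0
      ht).trans ?_
    · simp only [hφ]; field_simp
    gcongr ?_ ^ 2 + ?_ ^ 2 + ?_
    · exact hφ0 i
    · exact hE0 i
    · have e1 : d ^ 2 = ENNReal.ofReal (σ / c ^ 2) * (K ^ 2 * ∫⁻ τ in timeI T, A τ ^ 2) := by
        rw [hd, mul_pow, mul_pow, L2t_sq, ← ENNReal.ofReal_pow (by positivity), mul_pow,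
          Real.sq_sqrt hσ.le, inv_pow, div_eq_mul_inv]
      rw [e1]
      gcongr
      calc ∫⁻ τ in Icc 0 t, (N2 fun ξ => wt s ξ * ‖nlFt T (comp u) (comp B) i τ ξ‖ₑ) ^ 2
          ≤ ∫⁻ τ in Icc 0 t, (K : ℝ≥0∞) ^ 2 * A τ ^ 2 := by
            refine setLIntegral_mono' measurableSet_Icc fun τ hτ => ?_
            rw [← mul_pow]
            exact pow_le_pow_left' (hK hc hT h ha s hs0 hs1 τ (mem_timeI_of_le ht hτ) i) 2
        _ ≤ ∫⁻ τ in timeI T, (K : ℝ≥0∞) ^ 2 * A τ ^ 2 :=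
            lintegral_mono_set fun τ hτ => mem_timeI_of_le ht hτ
        _ = _ := lintegral_const_mul' _ _ (ENNReal.pow_ne_top ENNReal.coe_ne_top)
  have hsq : a ^ 2 + b ^ 2 + d ^ 2 ≤ (a + b + d) ^ 2 := by
    calc _ ≤ a ^ 2 + b ^ 2 + d ^ 2 + 2 * (a * b + a * d + b * d) := le_self_add
      _ = _ := by ring
  have hnn : ∀ τ, nn s φ τ ^ 2 ≤ 3 * ∑ i, hs s (φ i τ) ^ 2 := fun τ => sq_sum_three_le _
  have hN1 : ∀ t ∈ timeI T, nn s φ t ≤ 3 * (a + b + d) := by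
    intro t ht
    have h1 : ∀ i, hs s (φ i t) ≤ a + b + d := by
      intro i
      have := (le_self_add.trans (key i t ht)).trans hsq
      exact (ENNReal.pow_le_pow_left_iff two_ne_zero).1 this
    refine (Finset.sum_le_card_nsmul _ _ _ fun i _ => h1 i).trans ?_
    simp only [Finset.card_univ, Fintype.card_fin, nsmul_eq_mul, Nat.cast_ofNat, le_refl]
  have hN2 : ENNReal.ofReal (σ * c ^ 2) * ∫⁻ τ in timeI T, nn s φ τ ^ 2 ≤
      (3 * (a + b + d)) ^ 2 := by
    have hk : ENNReal.ofReal (σ * c ^ 2) ≠ ⊤ := ENNReal.ofReal_ne_top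
    rw [← lintegral_const_mul' _ _ hk]
    have hm : ∀ i, AEMeasurable (fun τ => hs s (φ i τ) ^ 2) (volume.restrict (timeI T)) := fun i =>
      ((hφS i).aemeasurable_hs hT hs0).pow_const 2
    calc ∫⁻ τ in timeI T, ENNReal.ofReal (σ * c ^ 2) * nn s φ τ ^ 2
        ≤ ∫⁻ τ in timeI T, (3 * ENNReal.ofReal (σ * c ^ 2)) * ∑ i, hs s (φ i τ) ^ 2 := by
          refine lintegral_mono fun τ => ?_
          calc _ ≤ _ := mul_le_mul' le_rfl (hnn τ)
            _ = _ := by ring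
      _ = 3 * ∑ i, ENNReal.ofReal (σ * c ^ 2) * ∫⁻ τ in timeI T, hs s (φ i τ) ^ 2 := by
          rw [lintegral_const_mul' _ _ (ENNReal.mul_ne_top (by norm_num) hk),
            lintegral_finsetSum' _ fun i _ => hm i, mul_assoc, Finset.mul_sum]
      _ ≤ 3 * ∑ _i : Fin 3, (a + b + d) ^ 2 := by
          gcongr with i
          rw [← lintegral_const_mul' _ _ hk]
          refine setLIntegral_timeI_le fun t ht => ?_
          rw [lintegral_const_mul' _ _ hk]
          exact (le_add_self.trans (key i t ht)).trans hsq
      _ = _ := by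
          simp only [Finset.sum_const, Finset.card_univ, Fintype.card_fin, nsmul_eq_mul]
          push_cast
          ring
  have hfin := eLpNorm_time_le hσ hc hN1 hN2 hp
  have hAle := h.L2t_nonlinear_le hT hν hσ hc hs0 hs1
  set κ := ENNReal.ofReal (9 * σ / 2) ^ (1 / 2 : ℝ) with hκ
  set Z := ENNReal.ofReal (c ^ (-(2 * (p⁻¹).toReal)))
  set Q := nonlinA c T s u E B
  have hS : ENNReal.ofReal (Real.sqrt σ) ≤ ENNReal.ofReal (1 + Real.sqrt σ) :=
    ENNReal.ofReal_le_ofReal (by linarith)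
  have hS1 : 1 ≤ ENNReal.ofReal (1 + Real.sqrt σ) := by
    rw [← ENNReal.ofReal_one]
    exact ENNReal.ofReal_le_ofReal (by have := Real.sqrt_nonneg σ; linarith)
  set S := ENNReal.ofReal (1 + Real.sqrt σ) with hSdef
  set X := 27 * (1 + κ)
  have hX : (1 : ℝ≥0∞) ≤ X + 1 := le_add_self
  have hK1 : (1 : ℝ≥0∞) ≤ K + 1 := le_add_self
  have hd' : d ≤ S * (K + 1) * (X + 1) * (ENNReal.ofReal c⁻¹ * Q) := by
    calc d ≤ ENNReal.ofReal (Real.sqrt σ * c⁻¹) * (K * (X * Q)) := by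
          rw [hd]; gcongr
      _ = ENNReal.ofReal (Real.sqrt σ) * K * X * (ENNReal.ofReal c⁻¹ * Q) := by
          rw [ENNReal.ofReal_mul (Real.sqrt_nonneg σ)]; ring
      _ ≤ _ := by gcongr <;> exact le_self_add
  have hM : 1 ≤ S * (K + 1) * (X + 1) := by
    calc (1 : ℝ≥0∞) = 1 * 1 * 1 := by norm_num
      _ ≤ _ := by gcongr
  have hCc : (((1 + σ⁻¹).toNNReal * (3 * (1 + Real.sqrt σ).toNNReal * (K + 1) *
    (27 * (1 + (9 * σ / 2).toNNReal ^ (1 / 2 : ℝ)) + 1)) : ℝ≥0) : ℝ≥0∞) =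
      ENNReal.ofReal (1 + σ⁻¹) * (3 * S * (K + 1) * (X + 1)) := by
    push_cast
    rw [ENNReal.coe_rpow_of_nonneg _ (by norm_num)]
    rfl
  rw [hCc]
  calc _ ≤ ENNReal.ofReal (1 + σ⁻¹) * Z * (3 * (a + b + d)) := hfin
    _ ≤ ENNReal.ofReal (1 + σ⁻¹) * Z * (3 * (S * (K + 1) * (X + 1) * a +
        S * (K + 1) * (X + 1) * b + S * (K + 1) * (X + 1) * (ENNReal.ofReal c⁻¹ * Q))) := by
        gcongr
        · exact le_mul_of_one_le_left' hM
        · exact le_mul_of_one_le_left' hM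
    _ = _ := by ring

end NSM
end

/-! ### The theorem, deduced from the componentwise estimate -/

theorem proposition4p1 (ν σ : ℝ) (hν : 0 < ν) (hσ : 0 < σ) :
    ∃ C : ℝ≥0, ∀ (c : ℝ) (T : ℝ≥0∞) (u E B j : ℝ → NSM.V3 → NSM.V3) (π : ℝ → NSM.V3 → ℝ),
      0 < c → 0 < T →
      NSM.IsSmoothSolution ν σ c T u E B j π →
      (∀ t ∈ NSM.timeI T, NSM.AxisymNoSwirl (u t)) →
      (∀ t ∈ NSM.timeI T, NSM.AxisymNoSwirl (E t)) →
      (∀ t ∈ NSM.timeI T, NSM.AxisymPureSwirl (B t)) →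
      ∀ (s : ℝ) (p : ℝ≥0∞), 0 ≤ s → s ≤ 1 / 2 → 2 ≤ p →
        NSM.lpHs T p s (fun t x => c⁻¹ • NSM.dt T E t x) =
            NSM.lpHs T p s (fun t x => j t x - NSM.curl (B t) x) ∧
        NSM.lpHs T p s (fun t x => c⁻¹ • NSM.dt T E t x) ≤
          C * (ENNReal.ofReal (c ^ (-(2 * (p⁻¹).toReal))) *
                  NSM.hsNorm s (fun x => NSM.curl (B 0) x - j 0 x) +
                ENNReal.ofReal (c ^ (-(2 * (p⁻¹).toReal))) * NSM.hsNorm (s + 1) (E 0) +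
                ENNReal.ofReal (c ^ (-(2 * (p⁻¹).toReal + 1))) *
                  NSM.nonlinA c T s u E B) := by
  obtain ⟨C, hC⟩ := NSM.exists_eLpNorm_sum_hs_le hν hσ
  refine ⟨C, fun c T u E B j π hc hT h hu hE hB s p hs0 hs1 hp => ⟨?_, ?_⟩⟩
  · refine eLpNorm_congr_ae ?_
    filter_upwards [ae_restrict_mem (NSM.measurableSet_timeI T)] with t ht
    -- By Ampère's law, j - curl B is minus c⁻¹∂ₜE, so the two norms agree at each time in [0,T).
    rw [← NSM.hsNorm_neg]
    congr 1
    funext x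
    have := h.ampere t ht x
    rw [← neg_eq_iff_eq_neg.2 this]
    abel
  · have hS := h.sys hT hc
    have hA : NSM.Axi T (NSM.comp u) (NSM.comp E) (NSM.comp B) :=
      ⟨NSM.AxisymNoSwirl.noSwirl hT hS.hu hu, NSM.AxisymNoSwirl.noSwirl hT hS.hE hE,
        NSM.AxisymPureSwirl.pureSwirl hT hS.hB hB⟩
    have h1 : NSM.lpHs T p s (fun t x => c⁻¹ • NSM.dt T E t x) ≤
        eLpNorm (NSM.nn s fun i t x => c⁻¹ * NSM.Dm T none (NSM.comp E i) t x) p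
          (volume.restrict (NSM.timeI T)) := by
      refine eLpNorm_mono_enorm_ae ?_
      filter_upwards [ae_restrict_mem (NSM.measurableSet_timeI T)] with t ht
      simp only [enorm_eq_self]
      have e : ∀ i, (fun x => (c⁻¹ • NSM.dt T E t x) i) =
          fun x => c⁻¹ * NSM.Dm T none (NSM.comp E i) t x := by
        intro i
        funext x
        rw [PiLp.smul_apply, smul_eq_mul, NSM.dt_apply hT hS.hE ht]
      have hm : MemLp (fun x => c⁻¹ • NSM.dt T E t x) 2 volume :=
        MemLp.of_eval_piLp fun i => by
          rw [e i]
          exact (((hS.hE i).Dm hT none).const_mul hT c⁻¹).memLp ht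
      refine (NSM.hsNorm_le_sum hs0 hm).trans (le_of_eq ?_)
      simp only [e, NSM.nn]
    refine h1.trans ((hC hc hT hS hA s hs0 hs1 p hp).trans (le_of_eq ?_))
    have e2 : ENNReal.ofReal (c ^ (-(2 * (p⁻¹).toReal + 1))) =
        ENNReal.ofReal (c ^ (-(2 * (p⁻¹).toReal))) * ENNReal.ofReal c⁻¹ := by
      rw [← ENNReal.ofReal_mul (by positivity), neg_add, Real.rpow_add hc, Real.rpow_neg_one]
    rw [e2]
    ring
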